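/- Let $p$ be a prime, let $E=K_1\times\cdots\times K_m$ where each $K_i/\mathbb{Q}_p$ is a finite field extension of degree $r_i$ and ramification index $e_i$, and put $r=r_1+\cdots+r_m$. Let $\mathcal{O}_E=\mathcal{O}_{K_1}\times\cdots\times\mathcal{O}_{K_m}$ be the ring of integers of $E$, and let $\mathfrak{x}=(x_1,\ldots,x_m)\in\mathcal{O}_E$ be such that $E=\mathbb{Q}_p[\mathfrak{x}]$. Let $Z=\prod_{i=1}^m Z_i$, where $Z_i$ is the minimal polynomial of $x_i$ over $\mathbb{Q}_p$, and let $\mathrm{Disc}(\mathfrak{x})$ be the discriminant of $Z$. Let $\mathrm{val}$ denote the $p$-adic valuation on $\mathbb{Q}_p$ and on each $K_i$, normalized by $\mathrm{val}(p)=1$. Let $s_i\in\frac{1}{e_i}\mathbb{Z}_{\ge 0}$ satisfy $s_i>r\,\mathrm{val}(\mathrm{Disc}(\mathfrak{x}))$ for all $1\le i\le m$, and set $$F_Z=\{f\in\mathbb{Z}_p[x] : \deg f\le r-1,\ \mathrm{val}(f(x_i)-x_i)+\mathrm{val}(Z'(x_i))\ge s_i\ \text{ for all } 1\le i\le m\}.$$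 A lattice class $\mathcal{C}$ is an orbit, under multiplication by $E^\times$, on the set of $\mathbb{Z}_p[\mathfrak{x}]$-submodules $M\subset E$ that are $\mathbb{Z}_p$-lattices of rank $r$. Let $\mathrm{Aut}(\mathcal{C})$ be the group of $\mathbb{Q}_p$-linear maps $T$ on $E$ that commute with multiplication by $\mathfrak{x}$ and satisfy $TM=M$, for any $M\in\mathcal{C}$ (it does not depend on $M$), and let $A_\mathcal{C}\in\mathrm{Mat}_r(\mathbb{Z}_p)$ be the matrix by which $\mathfrak{x}$ acts on some $M\in\mathcal{C}$ in some $\mathbb{Z}_p$-basis of $M$. Identify $\mathcal{O}_E^\times$ with the group of its multiplication operators on $E$. Let $\mathbf{P}$ be the Haar probability measure on the additive group $\mathrm{Mat}_r(\mathbb{Z}_p)$. Then, for each lattice class $\mathcal{C}$ and each choice of $A_\mathcal{C}$, $\mathrm{Aut}(\mathcal{C})$ is a subgroup of finite index in $\mathcal{O}_E^\times$, the set $\{Tf(A_\mathcal{C})T^{-1} : T\in\mathrm{GL}_r(\mathbb{Z}_p),\ f\in F_Z\}$ is Borel measurable, and $$\mathbf{P}\big(\{Tf(A_\mathcal{C})T^{-1}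 : T\in\mathrm{GL}_r(\mathbb{Z}_p),\ f\in F_Z\}\big)=\frac{(1-p^{-1})\cdots(1-p^{-r})}{\prod_{i=1}^m(1-p^{-r_i/e_i})\,p^{s_ir_i}}\;\#\big(\mathcal{O}_E^\times/\mathrm{Aut}(\mathcal{C})\big).$$ -/

import Mathlib

open scoped Polynomial

namespace PadicOrbit

/-! ### Finite extensions of `ℚ_[p]` -/

section LocalField

variable (p : ℕ) [Fact p.Prime] (K : Type*) [Field K] [Algebra ℚ_[p] K]
  [FiniteDimensional ℚ_[p] K] [Algebra ℤ_[p] K] [IsScalarTower ℤ_[p] ℚ_[p] K]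

/-- The valuation of a finite extension `K` of `ℚ_[p]`, normalized by `val p = 1` and with
`val 0 = ⊤`. It is `- log_p` of the unique absolute value of `K` extending the one of `ℚ_[p]`. -/
noncomputable def val {p : ℕ} [Fact p.Prime] {K : Type*} [Field K] [Algebra ℚ_[p] K] (y : K) :
    WithTop ℝ :=
  open scoped Classical in
  if y = 0 then ⊤ else ((-Real.logb p (spectralNorm ℚ_[p] K y) : ℝ) : WithTop ℝ)

theorem isIntegral_iff_spectralNorm_le_one (y : K) :
    IsIntegral ℤ_[p] y ↔ spectralNorm ℚ_[p] K y ≤ 1 := by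
  have hy : IsIntegral ℚ_[p] y := Algebra.IsIntegral.isIntegral y
  rw [spectralNorm, spectralValue_le_one_iff (minpoly.monic hy)]
  constructor
  · intro h n
    rw [minpoly.isIntegrallyClosed_eq_field_fractions' ℚ_[p] h, Polynomial.coeff_map]
    exact PadicInt.norm_le_one _
  · intro h
    have hlift : minpoly ℚ_[p] y ∈ Polynomial.lifts (algebraMap ℤ_[p] ℚ_[p]) := by
      rw [Polynomial.lifts_iff_coeff_lifts]
      exact fun n => ⟨⟨_, h n⟩, rfl⟩
    obtain ⟨q, hq, -, hm⟩ :=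
      Polynomial.lifts_and_natDegree_eq_and_monic hlift (minpoly.monic hy)
    refine ⟨q, hm, ?_⟩
    have := minpoly.aeval ℚ_[p] y
    rwa [← hq, Polynomial.aeval_map_algebraMap] at this

instance isLocalRing_integralClosure : IsLocalRing (integralClosure ℤ_[p] K) := by
  have key : ∀ a : integralClosure ℤ_[p] K, IsUnit a ↔ spectralNorm ℚ_[p] K (a : K) = 1 := by
    intro a
    have ha := (isIntegral_iff_spectralNorm_le_one p K a).1 a.2
    constructor
    · rintro ⟨u, rfl⟩
      have hb := (isIntegral_iff_spectralNorm_le_one p K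
        ((u⁻¹ : (integralClosure ℤ_[p] K)ˣ) : integralClosure ℤ_[p] K)).1 (Subtype.prop _)
      have hmul := spectralAlgNorm_mul (K := ℚ_[p]) (L := K)
        ((u : integralClosure ℤ_[p] K) : K)
        (((u⁻¹ : (integralClosure ℤ_[p] K)ˣ) : integralClosure ℤ_[p] K) : K)
      rw [← MulMemClass.coe_mul, Units.mul_inv, OneMemClass.coe_one, spectralAlgNorm_one] at hmul
      simp only [spectralAlgNorm_def] at hmul
      nlinarith [spectralNorm_nonneg (K := ℚ_[p]) ((u : integralClosure ℤ_[p] K) : K)]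
    · intro h
      have h0 : (a : K) ≠ 0 := by
        intro h0
        rw [h0, spectralNorm_zero] at h
        exact zero_ne_one h
      have hmul := spectralAlgNorm_mul (K := ℚ_[p]) (L := K) (a : K) (a : K)⁻¹
      rw [mul_inv_cancel₀ h0, spectralAlgNorm_one] at hmul
      simp only [spectralAlgNorm_def, h, one_mul] at hmul
      have hint := (isIntegral_iff_spectralNorm_le_one p K (a : K)⁻¹).2 hmul.symm.le
      exact IsUnit.of_mul_eq_one (⟨(a : K)⁻¹, hint⟩ : integralClosure ℤ_[p] K)
        (Subtype.ext (mul_inv_cancel₀ h0))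
  refine IsLocalRing.of_nonunits_add fun a b ha hb => ?_
  rw [mem_nonunits_iff, key] at ha hb ⊢
  have ha' := lt_of_le_of_ne ((isIntegral_iff_spectralNorm_le_one p K a).1 a.2) ha
  have hb' := lt_of_le_of_ne ((isIntegral_iff_spectralNorm_le_one p K b).1 b.2) hb
  have hna := isNonarchimedean_spectralNorm (K := ℚ_[p]) (L := K) (a : K) (b : K)
  exact (lt_of_le_of_lt hna (max_lt ha' hb')).ne

/-- The ramification index of the extension `K / ℚ_[p]`. -/
noncomputable def ramIndex : ℕ :=
  (IsLocalRing.maximalIdeal (integralClosure ℤ_[p] K)).ramificationIdx ℤ_[p]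

end LocalField

/-! ### Lattices in a finite-dimensional `ℚ_[p]`-algebra -/

section Lattices

variable {p : ℕ} [Fact p.Prime] {E : Type*} [CommRing E] [Algebra ℚ_[p] E]
  [Algebra ℤ_[p] E] [IsScalarTower ℤ_[p] ℚ_[p] E]

/-- The set of full rank `ℤ_[p]`-lattices of `E` that are `ℤ_[p][x]`-submodules of `E`. -/
def latticeModules (x : E) : Set (Submodule ℤ_[p] E) :=
  {M | (∀ a ∈ Algebra.adjoin ℤ_[p] {x}, ∀ m ∈ M, a * m ∈ M) ∧ M.IsLattice ℚ_[p]}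

/-- Two lattices are equivalent if they differ by scaling by a unit of `E`. -/
def scalingSetoid (x : E) : Setoid (latticeModules (p := p) x) where
  r M N := ∃ u : Eˣ, ((N : Submodule ℤ_[p] E) : Set E) =
    (fun m => (u : E) * m) '' ((M : Submodule ℤ_[p] E) : Set E)
  iseqv :=
    { refl := fun M => ⟨1, by simp⟩
      symm := by
        rintro M N ⟨u, h⟩
        exact ⟨u⁻¹, by rw [h, Set.image_image]; simp⟩
      trans := by
        rintro M N P ⟨u, h⟩ ⟨v, h'⟩
        exact ⟨v * u, by rw [h', h, Set.image_image]; simp [mul_assoc]⟩ }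

/-- The set of lattice classes: lattices up to scaling by units of `E`. -/
def LatticeClass (p : ℕ) [Fact p.Prime] {E : Type*} [CommRing E] [Algebra ℚ_[p] E]
    [Algebra ℤ_[p] E] [IsScalarTower ℤ_[p] ℚ_[p] E] (x : E) : Type _ :=
  Quotient (scalingSetoid (p := p) x)

/-- The class of a lattice. -/
def latticeClass {x : E} (M : latticeModules (p := p) x) : LatticeClass p x :=
  Quotient.mk (scalingSetoid x) M

/-- `Aut(M)`: the `ℚ_[p]`-linear maps `T` of `E` that commute with multiplication by `x` and satisfy
`T M = M`. Such a map is invertible, as `M` spans `E`. -/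
def autLattice (x : E) (M : Submodule ℤ_[p] E) : Subgroup (Module.End ℚ_[p] E)ˣ where
  carrier := {T | (∀ y, (T : Module.End ℚ_[p] E) (x * y) = x * (T : Module.End ℚ_[p] E) y) ∧
    (T : Module.End ℚ_[p] E) '' (M : Set E) = M}
  one_mem' := ⟨fun _ => rfl, by simp⟩
  mul_mem' := by
    rintro S T ⟨hS, hS'⟩ ⟨hT, hT'⟩
    refine ⟨fun y => ?_, ?_⟩
    · simp only [Units.val_mul, Module.End.mul_apply, hS, hT]
    · simp only [Units.val_mul, Module.End.coe_mul, Set.image_comp, hS', hT']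
  inv_mem' := by
    rintro T ⟨hT, hT'⟩
    have h1 : ∀ y, (T : Module.End ℚ_[p] E) (((T⁻¹ : (Module.End ℚ_[p] E)ˣ) :
        Module.End ℚ_[p] E) y) = y := fun y => by
      rw [← Module.End.mul_apply, Units.mul_inv, Module.End.one_apply]
    have h2 : ∀ y, ((T⁻¹ : (Module.End ℚ_[p] E)ˣ) : Module.End ℚ_[p] E)
        ((T : Module.End ℚ_[p] E) y) = y := fun y => by
      rw [← Module.End.mul_apply, Units.inv_mul, Module.End.one_apply]
    refine ⟨fun y => ?_, ?_⟩
    · conv_lhs => rw [← h1 y, ← hT, h2]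
    · conv_lhs => rw [← hT', Set.image_image]
      simp only [h2, Set.image_id']

/-- Lattices in the same class have the same automorphism group, if `x` generates `E`. -/
theorem autLattice_eq_of_scaling {x : E} (hx : Algebra.adjoin ℚ_[p] {x} = ⊤)
    (M N : Submodule ℤ_[p] E) (u : Eˣ) (h : (N : Set E) = (fun m => (u : E) * m) '' (M : Set E)) :
    autLattice x M = autLattice x N := by
  have comm : ∀ T : Module.End ℚ_[p] E, (∀ y, T (x * y) = x * T y) →
      ∀ a y, T (a * y) = a * T y := by
    intro T hT a
    have ha : a ∈ Algebra.adjoin ℚ_[p] {x} := hx ▸ Algebra.mem_top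
    induction ha using Algebra.adjoin_induction with
    | mem a ha => rw [Set.mem_singleton_iff.1 ha]; exact hT
    | algebraMap c => intro y; rw [← Algebra.smul_def, map_smul, Algebra.smul_def]
    | add a b _ _ ha hb => intro y; rw [add_mul, map_add, ha, hb, add_mul]
    | mul a b _ _ ha hb => intro y; rw [mul_assoc, ha, hb, mul_assoc]
  ext T
  refine and_congr_right fun hT => ?_
  have himg : (T : Module.End ℚ_[p] E) '' (N : Set E) =
      (fun m => (u : E) * m) '' ((T : Module.End ℚ_[p] E) '' (M : Set E)) := by
    rw [h, Set.image_image, Set.image_image]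
    exact Set.image_congr fun y _ => comm _ hT _ _
  have hinj : Function.Injective (fun m : E => (u : E) * m) := fun a b hab =>
    (Units.mul_right_inj u).1 hab
  rw [himg, h, hinj.image_injective.eq_iff]

/-- `Aut(𝒞)`, the group `Aut(M)` of any representative `M` of the lattice class `𝒞`. -/
def autClass {x : E} (hx : Algebra.adjoin ℚ_[p] {x} = ⊤) (C : LatticeClass p x) :
    Subgroup (Module.End ℚ_[p] E)ˣ :=
  Quotient.lift (s := scalingSetoid x) (fun M => autLattice x (M : Submodule ℤ_[p] E))
    (by
      rintro M N ⟨u, h⟩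
      exact autLattice_eq_of_scaling hx _ _ u h) C

variable (p E) in
/-- The units of the ring of integers `𝒪_E` (the integral closure of `ℤ_[p]` in `E`), acting on `E`
by multiplication. -/
noncomputable def integerUnits : Subgroup (Module.End ℚ_[p] E)ˣ :=
  ((Units.map (Algebra.lmul ℚ_[p] E : E →* Module.End ℚ_[p] E)).comp
    (Units.map ((integralClosure ℤ_[p] E).val : integralClosure ℤ_[p] E →* E))).range

/-- The matrix by which `x` acts on a lattice `M` in a given `ℤ_[p]`-basis of `M`. -/
noncomputable def actionMatrix {x : E} (M : latticeModules (p := p) x) {r : ℕ}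
    (b : Module.Basis (Fin r) ℤ_[p] (M : Submodule ℤ_[p] E)) : Matrix (Fin r) (Fin r) ℤ_[p] :=
  LinearMap.toMatrix b b ((LinearMap.mulLeft ℤ_[p] x).restrict
    (fun m hm => M.2.1 x (Algebra.self_mem_adjoin_singleton _ x) m hm))

end Lattices

/-! ### The polynomials and the set of matrices -/

section Polynomials

variable {p : ℕ} [Fact p.Prime] {ι : Type*} [Fintype ι] {K : ι → Type*} [∀ i, Field (K i)]
  [∀ i, Algebra ℚ_[p] (K i)] [∀ i, Algebra ℤ_[p] (K i)]

/-- The product `Z` of the minimal polynomials over `ℚ_[p]` of the components of `x`. -/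
noncomputable def polyZ (p : ℕ) [Fact p.Prime] {ι : Type*} [Fintype ι] {K : ι → Type*}
    [∀ i, Field (K i)] [∀ i, Algebra ℚ_[p] (K i)] (x : ∀ i, K i) : ℚ_[p][X] :=
  ∏ i, minpoly ℚ_[p] (x i)

/-- The polynomials `f` over `ℤ_[p]` of degree at most `r - 1` such that
`val (f (x i) - x i) + val (Z' (x i)) ≥ s i` for all `i`. -/
def polyF (r : ℕ) (x : ∀ i, K i) (s : ι → ℝ) : Set ℤ_[p][X] :=
  {f | f.degree < r ∧ ∀ i, ((s i : ℝ) : WithTop ℝ) ≤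
    val (p := p) (Polynomial.aeval (x i) f - x i) +
      val (p := p) (Polynomial.aeval (x i) (Polynomial.derivative (polyZ p x)))}

/-- The matrices `T f(A) T⁻¹` for `T ∈ GL_r(ℤ_[p])` and `f ∈ F`. -/
def conjOrbit {r : ℕ} (A : Matrix (Fin r) (Fin r) ℤ_[p]) (F : Set ℤ_[p][X]) :
    Set (Matrix (Fin r) (Fin r) ℤ_[p]) :=
  {B | ∃ T : GL (Fin r) ℤ_[p], ∃ f ∈ F,
    B = (T : Matrix (Fin r) (Fin r) ℤ_[p]) * Polynomial.aeval A f *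
      ((T⁻¹ : GL (Fin r) ℤ_[p]) : Matrix (Fin r) (Fin r) ℤ_[p])}

end Polynomials

end PadicOrbit

/-! Write `R = ℤ_p[x]`, `u = Z'(x)`, `𝒪 = 𝒪_E`, `𝔪 = ∏ 𝔪_i`, `s_i = n_i / e_i`, and let `q_i = p ^
(r_i / e_i)` be the cardinality of the residue field of `K_i`. The values `f(x)`, `f ∈ F_Z`, fill
the coset `x + L`, where `L = {z : u z ∈ ∏ 𝔪_i ^ n_i}` (`exists_mem_polyF_iff`). The set to be
measured is therefore the union of the conjugates of `x + L`, with multiplications on `E` written as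
matrices in a basis of `M`.

The discriminant hypothesis makes `L` small. The resultant `D` of `Z` and `Z'` is `u β` with `β ∈
R`, and `L ⊆ D 𝔪` (`exists_discriminant_bound`). First, Euler's formula expresses the coordinates of
`u m` in the powers of `x` as traces, and traces of elements of `𝔪` are divisible by `p`; hence `L ⊆
p R`. Secondly, a Hensel argument (`eq_of_conj`) shows that distinct points of `x + L` are not
conjugate, and that only the centralizer of `x` can fix one of them.

The measure comes from tubes. Let `Γ = 1 + p ^ N End(R)` with `N` large. By successive approximation
and compactness (`tube_eq`, `conj_ball_eq`), the `Γ`-conjugates of `x + z + p ^ N R`, `z ∈ L`, form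
the full translate `x + z + p ^ N ([End(R), x] + R)`. The map `evalQuot`, built from the
coefficients of `Z / (X - x)`, sends `End(R)` onto `R`, kills exactly the commutators with `x`, and
multiplies `R` by `u`; so `[End(R), x] + R` has index `[R : u R]` in `End(R)`. The translates of the
tubes cover each point of the set exactly `[A : A ∩ Γ]` times, where `A = Aut(M)`
(`measure_union_orbits`). As `Γ` has index `∏ (1 - p ^ (-j)) * [Mat_r(ℤ_p) : p ^ N End(R)]` in
`GL_r(ℤ_p)`, this gives (`measure_conjOrbit`) `P * [A : A ∩ Γ] * [R : u R] = ∏ (1 - p ^ (-j)) * [L :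
p ^ N R]`.

The remaining indices are computed in `𝒪`: `[𝒪ˣ : 𝒪ˣ ∩ Γ] = ∏ (q_i - 1) * [𝔪 : p ^ N R]`, `[𝒪 : L] *
[R : u R] = ∏ q_i ^ n_i` and `[𝒪 : 𝔪] = ∏ q_i`. Since `𝒪ˣ ∩ Γ ⊆ A ⊆ 𝒪ˣ`, the auxiliary `N` cancels
and the formula follows. -/

namespace PadicOrbit

/-! ### Groups of units congruent to one modulo an additive subgroup -/

section OnePlus

variable {O : Type*} [Ring O]

/-- The units `u` of `O` such that `u` and `u⁻¹` lie in `1 + J`, for an additive subgroup `J` closed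
under multiplication. -/
def onePlus (J : AddSubgroup O) (hJ : ∀ a ∈ J, ∀ b ∈ J, a * b ∈ J) : Subgroup Oˣ where
  carrier := {u | (u : O) - 1 ∈ J ∧ ((u⁻¹ : Oˣ) : O) - 1 ∈ J}
  one_mem' := by simp
  mul_mem' := by
    rintro u v ⟨hu, hu'⟩ ⟨hv, hv'⟩
    constructor
    · have : ((u * v : Oˣ) : O) - 1 = ((u : O) - 1) * (v - 1) + (u - 1) + (v - 1) := by
        push_cast; noncomm_ring
      rw [this]
      exact J.add_mem (J.add_mem (hJ _ hu _ hv) hu) hv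
    · have : (((u * v)⁻¹ : Oˣ) : O) - 1 = (((v⁻¹ : Oˣ) : O) - 1) * ((u⁻¹ : Oˣ) - 1) +
          ((u⁻¹ : Oˣ) - 1) + ((v⁻¹ : Oˣ) - 1) := by
        rw [mul_inv_rev]; push_cast; noncomm_ring
      rw [this]
      exact J.add_mem (J.add_mem (hJ _ hv' _ hu') hu') hv'
  inv_mem' := by
    rintro u ⟨hu, hu'⟩
    exact ⟨hu', by simpa using hu⟩

theorem mem_onePlus {J : AddSubgroup O} {hJ : ∀ a ∈ J, ∀ b ∈ J, a * b ∈ J} {u : Oˣ} :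
    u ∈ onePlus J hJ ↔ (u : O) - 1 ∈ J ∧ ((u⁻¹ : Oˣ) : O) - 1 ∈ J := Iff.rfl

theorem onePlus_mono {I J : AddSubgroup O} {hI : ∀ a ∈ I, ∀ b ∈ I, a * b ∈ I}
    {hJ : ∀ a ∈ J, ∀ b ∈ J, a * b ∈ J} (h : I ≤ J) : onePlus I hI ≤ onePlus J hJ :=
  fun _ hu => ⟨h hu.1, h hu.2⟩

/-- The map `u ↦ u - 1` is a bijection of `1 + J` with `J`. It matches cosets because `u⁻¹ v - 1 =
u⁻¹ (v - u)` and multiplication by elements of `1 + J` preserves `I`. -/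
theorem relIndex_onePlus {I J : AddSubgroup O} {hI : ∀ a ∈ I, ∀ b ∈ I, a * b ∈ I}
    {hJ : ∀ a ∈ J, ∀ b ∈ J, a * b ∈ J} (hJI : ∀ a ∈ J, ∀ b ∈ I, a * b ∈ I)
    (hunit : ∀ a ∈ J, ∃ u ∈ onePlus J hJ, (u : O) = 1 + a) :
    (onePlus I hI).relIndex (onePlus J hJ) = I.relIndex J := by
  let e : onePlus J hJ ≃ J :=
    Equiv.ofBijective (fun u => ⟨((u : Oˣ) : O) - 1, u.2.1⟩) <| by
      constructor
      · intro u v huv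
        have : ((u : Oˣ) : O) - 1 = ((v : Oˣ) : O) - 1 := congrArg Subtype.val huv
        exact Subtype.ext (Units.ext (sub_left_injective this))
      · rintro ⟨a, ha⟩
        obtain ⟨u, hu, hua⟩ := hunit a ha
        exact ⟨⟨u, hu⟩, Subtype.ext (by simp [hua])⟩
  have hmul : ∀ u ∈ onePlus J hJ, ∀ b ∈ I, (u : O) * b ∈ I := fun u hu b hb => by
    have : (u : O) * b = (u - 1) * b + b := by noncomm_ring
    rw [this]
    exact I.add_mem (hJI _ hu.1 _ hb) hb
  rw [Subgroup.relIndex, AddSubgroup.relIndex, Subgroup.index, AddSubgroup.index]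
  refine Nat.card_congr (Quotient.congr e ?_)
  rintro ⟨u, hu⟩ ⟨v, hv⟩
  rw [QuotientGroup.leftRel_apply, QuotientAddGroup.leftRel_apply, Subgroup.mem_subgroupOf,
    AddSubgroup.mem_addSubgroupOf]
  change u⁻¹ * v ∈ onePlus I hI ↔ -((u : O) - 1) + (v - 1) ∈ I
  have h1 : -((u : O) - 1) + (v - 1) = v - u := by abel
  have key : ∀ a b : Oˣ, ((a⁻¹ * b : Oˣ) : O) - 1 = (a⁻¹ : Oˣ) * ((b : O) - a) := fun a b => by
    rw [mul_sub, Units.inv_mul, Units.val_mul]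
  have key' : ∀ a b : Oˣ, ((b : O) - a) = (a : O) * (((a⁻¹ * b : Oˣ) : O) - 1) := fun a b => by
    rw [key, ← mul_assoc, Units.mul_inv, one_mul]
  rw [h1]
  constructor
  · intro h
    rw [key']
    exact hmul _ hu _ h.1
  · intro h
    refine ⟨?_, ?_⟩
    · rw [key]
      exact hmul _ (inv_mem hu) _ h
    · rw [mul_inv_rev, inv_inv, key, ← neg_sub, mul_neg]
      exact I.neg_mem (hmul _ (inv_mem hv) _ h)

/-- Units of `O` surject onto those of `k` with kernel `1 + ker q`. Since `J` need not be stable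
under multiplication by `ker q`, the index of `1 + J` in `1 + ker q` is not read off directly: both
are compared with `1 + I` for a left ideal `I ⊆ J`, and the finite factor `[J : I]` cancels. -/
theorem index_onePlus {k : Type*} [Ring k] (q : O →+* k) [IsLocalHom q]
    (hq : Function.Surjective q) {I J : AddSubgroup O} (hJ : ∀ a ∈ J, ∀ b ∈ J, a * b ∈ J)
    (hI : ∀ a, ∀ b ∈ I, a * b ∈ I) (hIJ : I ≤ J) (hJq : ∀ a ∈ J, q a = 0)
    (hunit : ∀ a ∈ J, ∃ u ∈ onePlus J hJ, (u : O) = 1 + a) (hfin : I.relIndex J ≠ 0) :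
    (onePlus J hJ).index = Nat.card kˣ * J.relIndex (q : O →+ k).ker := by
  set m : AddSubgroup O := (q : O →+ k).ker with hm
  have hmem : ∀ a, a ∈ m ↔ q a = 0 := fun a => Iff.rfl
  have hmm : ∀ a ∈ m, ∀ b ∈ m, a * b ∈ m := fun a _ b hb => by
    rw [hmem] at hb ⊢
    rw [map_mul, hb, mul_zero]
  have hmu : ∀ a ∈ m, ∃ u ∈ onePlus m hmm, (u : O) = 1 + a := fun a ha => by
    rw [hmem] at ha
    have h1 : IsUnit (q (1 + a)) := by rw [map_add, ha, map_one, add_zero]; exact isUnit_one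
    obtain ⟨u, hu⟩ := isUnit_of_map_unit q _ h1
    have hqu : q u = 1 := by rw [hu, map_add, ha, map_one, add_zero]
    refine ⟨u, ⟨?_, ?_⟩, hu⟩
    · rw [hmem, map_sub, hqu, map_one, sub_self]
    · have : q ((u⁻¹ : Oˣ) : O) * q u = 1 := by rw [← map_mul, Units.inv_mul, map_one]
      rw [hqu, mul_one] at this
      rw [hmem, map_sub, this, map_one, sub_self]
  have hker : onePlus m hmm = (Units.map (q : O →* k)).ker := by
    ext u
    rw [mem_onePlus, MonoidHom.mem_ker, hmem, hmem, map_sub, map_sub, map_one, sub_eq_zero,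
      sub_eq_zero, Units.ext_iff]
    refine ⟨fun h => h.1, fun h => ⟨h, ?_⟩⟩
    have h' : q u = 1 := h
    have : q ((u⁻¹ : Oˣ) : O) * q u = 1 := by rw [← map_mul, Units.inv_mul, map_one]
    rwa [h', mul_one] at this
  have hrange : (Units.map (q : O →* k)).range = ⊤ := by
    rw [MonoidHom.range_eq_top]
    intro v
    obtain ⟨a, ha⟩ := hq v
    have h1 : IsUnit (q a) := ha ▸ v.isUnit
    obtain ⟨u, hu⟩ := isUnit_of_map_unit q _ h1
    exact ⟨u, Units.ext (by simp [hu, ha])⟩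
  have hindex : (onePlus m hmm).index = Nat.card kˣ := by
    rw [hker, Subgroup.index_ker, hrange, Subgroup.card_top]
  have hJm : J ≤ m := hJq
  have hII : ∀ a ∈ I, ∀ b ∈ I, a * b ∈ I := fun a _ => hI a
  have e1 := Subgroup.relIndex_mul_relIndex (onePlus I hII) (onePlus J hJ) (onePlus m hmm)
    (onePlus_mono hIJ) (onePlus_mono hJm)
  rw [relIndex_onePlus (fun a _ => hI a) hunit, relIndex_onePlus (fun a _ => hI a) hmu,
    ← AddSubgroup.relIndex_mul_relIndex I J m hIJ hJm] at e1
  have e2 := Nat.eq_of_mul_eq_mul_left (Nat.pos_of_ne_zero hfin) e1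
  rw [← Subgroup.relIndex_mul_index (onePlus_mono (hJ := hmm) hJm), hindex, e2, mul_comm]

end OnePlus

/-! ### The measure of a union of orbits covered by tubes -/

section Tubes

open MeasureTheory

/-- Each tube is `Γ`-stable, so its translates are indexed by `G ⧸ Γ`. The point `act g y` lies only
in translates of the tube of `cls y`, and only for the cosets `g a Γ` with `a ∈ A`, of which there
are `[A : A ∩ Γ]`. Integrating this constant multiplicity gives the formula. -/
theorem measure_union_orbits {G X Q : Type*} [Group G] [MeasurableSpace X] [Fintype Q]
    (μ : Measure X) (act : G → X → X) (act_one : ∀ a, act 1 a = a)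
    (act_mul : ∀ g h a, act (g * h) a = act g (act h a))
    (hact : ∀ g, MeasurePreserving (act g) μ μ) (Γ A : Subgroup G) (hΓ : Γ.index ≠ 0)
    (Y : Set X) (cls : X → Q) (tube : Q → Set X) (htm : ∀ q, MeasurableSet (tube q))
    (ht : ∀ q a, a ∈ tube q ↔ ∃ γ ∈ Γ, ∃ y ∈ Y, cls y = q ∧ a = act γ y)
    (huniq : ∀ g, ∀ y ∈ Y, ∀ y' ∈ Y, act g y = y' → y = y' ∧ g ∈ A)
    (hstab : ∀ g ∈ A, ∀ y ∈ Y, act g y = y) :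
    MeasurableSet {a | ∃ g, ∃ y ∈ Y, a = act g y} ∧
      μ {a | ∃ g, ∃ y ∈ Y, a = act g y} * Γ.relIndex A = Γ.index * ∑ q, μ (tube q) := by
  classical
  set S : Set X := {a | ∃ g, ∃ y ∈ Y, a = act g y} with hS
  have hfi : Γ.FiniteIndex := ⟨hΓ⟩
  have : Fintype (G ⧸ Γ) := Fintype.ofFinite _
  let T : (G ⧸ Γ) → Q → Set X := fun c q => act c.out⁻¹ ⁻¹' tube q
  have hinv : ∀ g a, act g⁻¹ (act g a) = a := fun g a => by rw [← act_mul, inv_mul_cancel, act_one]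
  have hinv' : ∀ g a, act g (act g⁻¹ a) = a := fun g a => by rw [← act_mul, mul_inv_cancel, act_one]
  have hTm : ∀ c q, MeasurableSet (T c q) := fun c q => (hact _).measurable (htm q)
  have hTμ : ∀ c q, μ (T c q) = μ (tube q) := fun c q =>
    (hact _).measure_preimage (htm q).nullMeasurableSet
  have hTS : ∀ c q, T c q ⊆ S := by
    intro c q a ha
    obtain ⟨γ, -, y, hy, -, h⟩ := (ht q _).1 ha
    exact ⟨c.out * γ, y, hy, by rw [act_mul, ← h, hinv']⟩
  -- membership of a point of an orbit in a translated tube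
  have hmem : ∀ g, ∀ y ∈ Y, ∀ c q, act g y ∈ T c q ↔
      q = cls y ∧ ∃ a ∈ A, c = (QuotientGroup.mk (g * a) : G ⧸ Γ) := by
    intro g y hy c q
    constructor
    · intro h
      obtain ⟨γ, hγ, y', hy', hq, h⟩ := (ht q _).1 h
      have h2 : act (γ⁻¹ * c.out⁻¹ * g) y = y' := by
        rw [act_mul, act_mul, h, hinv]
      obtain ⟨rfl, hA⟩ := huniq _ _ hy _ hy' h2
      refine ⟨hq.symm, (γ⁻¹ * c.out⁻¹ * g)⁻¹, inv_mem hA, ?_⟩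
      have : g * (γ⁻¹ * c.out⁻¹ * g)⁻¹ = c.out * γ := by group
      rw [this, QuotientGroup.mk_mul_of_mem _ hγ, QuotientGroup.out_eq']
    · rintro ⟨rfl, a, ha, rfl⟩
      refine (ht _ _).2 ⟨(QuotientGroup.mk (g * a) : G ⧸ Γ).out⁻¹ * (g * a), ?_, y, hy, rfl, ?_⟩
      · rw [← QuotientGroup.eq, QuotientGroup.out_eq']
      · rw [act_mul, act_mul, hstab a ha y hy]
  -- The translates cover each point of `S` with the same multiplicity `[A : A ∩ Γ]`: `a ↦ g a Γ`
  -- identifies `A / (A ∩ Γ)` with the set of cosets that occur.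
  have hcount : ∀ a, ∑ c : G ⧸ Γ, ∑ q, (T c q).indicator (fun _ => (1 : ENNReal)) a =
      S.indicator (fun _ => (Γ.relIndex A : ENNReal)) a := by
    intro a
    by_cases ha : a ∈ S
    · rw [Set.indicator_of_mem ha]
      obtain ⟨g, y, hy, rfl⟩ := ha
      have e : ∀ c : G ⧸ Γ, ∑ q, (T c q).indicator (fun _ => (1 : ENNReal)) (act g y) =
          if ∃ a ∈ A, c = (QuotientGroup.mk (g * a) : G ⧸ Γ) then 1 else 0 := by
        intro c
        rw [Finset.sum_eq_single (cls y)]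
        · simp only [Set.indicator_apply, hmem g y hy, true_and]
        · intro q _ hq
          rw [Set.indicator_of_notMem]
          rw [hmem g y hy]
          exact fun h => hq h.1
        · exact fun h => absurd (Finset.mem_univ _) h
      rw [Finset.sum_congr rfl fun c _ => e c, Finset.sum_boole, Subgroup.relIndex, Subgroup.index]
      congr 1
      rw [← Fintype.card_subtype, ← Nat.card_eq_fintype_card]
      refine (Nat.card_congr (Equiv.ofBijective
        (fun c : A ⧸ Γ.subgroupOf A => (⟨Quotient.liftOn' c
          (fun a => (QuotientGroup.mk (g * (a : G)) : G ⧸ Γ)) ?_, ?_⟩ :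
            {c : G ⧸ Γ // ∃ a ∈ A, c = (QuotientGroup.mk (g * a) : G ⧸ Γ)})) ⟨?_, ?_⟩)).symm
      · intro a b hab
        rw [QuotientGroup.leftRel_apply, Subgroup.mem_subgroupOf] at hab
        rw [QuotientGroup.eq]
        simpa [mul_assoc] using hab
      · induction c using Quotient.inductionOn' with
        | _ a => exact ⟨a, a.2, rfl⟩
      · intro c d hcd
        induction c using Quotient.inductionOn' with
        | _ a =>
        induction d using Quotient.inductionOn' with
        | _ b =>
        have h1 : (QuotientGroup.mk (g * (a : G)) : G ⧸ Γ) = QuotientGroup.mk (g * (b : G)) :=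
          congrArg Subtype.val hcd
        rw [QuotientGroup.eq] at h1
        refine Quotient.sound' ?_
        rw [QuotientGroup.leftRel_apply, Subgroup.mem_subgroupOf]
        simpa [mul_assoc] using h1
      · rintro ⟨c, a, ha, rfl⟩
        exact ⟨Quotient.mk'' ⟨a, ha⟩, rfl⟩
    · rw [Set.indicator_of_notMem ha]
      exact Finset.sum_eq_zero fun c _ => Finset.sum_eq_zero fun q _ =>
        Set.indicator_of_notMem (fun h => ha (hTS c q h)) _
  have hSU : S = ⋃ c : G ⧸ Γ, ⋃ q, T c q := by
    refine Set.Subset.antisymm ?_ (Set.iUnion_subset fun c => Set.iUnion_subset fun q => hTS c q)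
    rintro a ⟨g, y, hy, rfl⟩
    refine Set.mem_iUnion.2 ⟨QuotientGroup.mk g, Set.mem_iUnion.2 ⟨cls y, ?_⟩⟩
    exact (hmem g y hy _ _).2 ⟨rfl, 1, one_mem _, by rw [mul_one]⟩
  have hSm : MeasurableSet S := by
    rw [hSU]
    exact MeasurableSet.iUnion fun c => MeasurableSet.iUnion fun q => hTm c q
  refine ⟨hSm, ?_⟩
  have hint : ∫⁻ a, ∑ c : G ⧸ Γ, ∑ q, (T c q).indicator (fun _ => (1 : ENNReal)) a ∂μ =
      ∫⁻ a, S.indicator (fun _ => (Γ.relIndex A : ENNReal)) a ∂μ := by simp_rw [hcount]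
  rw [lintegral_indicator_const hSm, lintegral_finsetSum _ fun c _ =>
    Finset.measurable_fun_sum _ fun q _ => measurable_const.indicator (hTm c q)] at hint
  rw [mul_comm, ← hint, Subgroup.index, Nat.card_eq_fintype_card, ← Finset.card_univ,
    ← nsmul_eq_mul, ← Finset.sum_const]
  refine Finset.sum_congr rfl fun c _ => ?_
  rw [lintegral_finsetSum _ fun q _ => measurable_const.indicator (hTm c q)]
  refine Finset.sum_congr rfl fun q _ => ?_
  rw [lintegral_indicator_const (hTm c q), one_mul, hTμ]

end Tubes

/-! ### Conjugates of a small ball in a commutative subring -/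

section TubeLemma

open Topology

variable {S 𝓔 : Type*} [CommRing S] [Ring 𝓔] [Algebra S 𝓔] (π : S) {R : Submodule S 𝓔} {c N : ℕ}
  {y₀ : 𝓔}

/-- With `t = 1 + π ^ N u` and `y = y₀ + π ^ N z`, one has `t y t⁻¹ = y + π ^ N κ t⁻¹`, where `κ =
[u, y]` is also a commutator with `y₀`. Replacing `t⁻¹` by `1` costs a multiple of `π ^ (2 N)`,
which `h2` absorbs because `c ≤ N`. -/
theorem exists_commutator_of_conj (hN : c ≤ N)
    (h2 : ∀ e, ∃ u, ∃ z ∈ R, π ^ c • e = (u * y₀ - y₀ * u) + z)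
    (h3 : ∀ z ∈ R, ∀ u, ∃ u', u * (y₀ + π ^ N • z) - (y₀ + π ^ N • z) * u = u' * y₀ - y₀ * u')
    {z : 𝓔} (hz : z ∈ R) (t : 𝓔ˣ) (u : 𝓔) (ht : (t : 𝓔) = 1 + π ^ N • u) :
    ∃ u', ∃ z' ∈ R, (t : 𝓔) * (y₀ + π ^ N • z) * ((t⁻¹ : 𝓔ˣ) : 𝓔) =
      y₀ + π ^ N • ((u' * y₀ - y₀ * u') + z') := by
  obtain ⟨u₁, hu₁⟩ := h3 z hz u
  obtain ⟨u₂, z₂, hz₂, h⟩ := h2 ((u₁ * y₀ - y₀ * u₁) * u * ((t⁻¹ : 𝓔ˣ) : 𝓔))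
  have hN' : π ^ N = π ^ (N - c) * π ^ c := by rw [← pow_add, Nat.sub_add_cancel hN]
  refine ⟨u₁ - π ^ (N - c) • u₂, z - π ^ (N - c) • z₂, R.sub_mem hz (R.smul_mem _ hz₂), ?_⟩
  set y := y₀ + π ^ N • z with hy
  set κ := u₁ * y₀ - y₀ * u₁ with hκ
  have e1 : (t : 𝓔) * y = y * t + π ^ N • κ := by
    rw [← hu₁, ht]
    simp only [add_mul, mul_add, one_mul, mul_one, smul_mul_assoc, mul_smul_comm, smul_sub]
    abel
  have e2 : κ * ((t⁻¹ : 𝓔ˣ) : 𝓔) = κ - π ^ N • (κ * u * ((t⁻¹ : 𝓔ˣ) : 𝓔)) := by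
    rw [eq_sub_iff_add_eq, mul_assoc, ← mul_smul_comm, ← mul_add, ← smul_mul_assoc]
    nth_rewrite 1 [← one_mul ((t⁻¹ : 𝓔ˣ) : 𝓔)]
    rw [← add_mul, ← ht, Units.mul_inv, mul_one]
  rw [e1, add_mul, mul_assoc, Units.mul_inv, mul_one, smul_mul_assoc, e2, hN', mul_smul, mul_smul,
    mul_smul, h, ← mul_smul, ← mul_smul, ← hN', hy, add_assoc, ← smul_add]
  congr 2
  rw [hκ]
  simp only [sub_mul, mul_sub, smul_sub, smul_add, smul_mul_assoc, mul_smul_comm]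
  abel

/-- Newton-type iteration: conjugation by `1 + π ^ (N + n) u'` removes the commutator part of the
error, and `z'` is moved into the centre of the ball. What is left is divisible by `π ^ (2 (N +
n))`; splitting it with `h2` costs `π ^ c`, and since `c < N` at least one power of `π` is gained.
-/
theorem exists_conj_approx (hN : c < N) (hunit : ∀ u : 𝓔, IsUnit (1 + π • u))
    (h2 : ∀ z ∈ R, ∀ e, ∃ u, ∃ z' ∈ R,
      π ^ c • e = (u * (y₀ + π ^ N • z) - (y₀ + π ^ N • z) * u) + z')
    {B : 𝓔} (hB : ∃ u, ∃ z ∈ R, B = y₀ + π ^ N • ((u * y₀ - y₀ * u) + z)) (n : ℕ) :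
    ∃ t : 𝓔ˣ, ∃ u, (t : 𝓔) = 1 + π ^ N • u ∧ ∃ z ∈ R, ∃ u', ∃ z' ∈ R,
      B * t = t * ((y₀ + π ^ N • z) + π ^ (N + n) •
        ((u' * (y₀ + π ^ N • z) - (y₀ + π ^ N • z) * u') + z')) := by
  induction n with
  | zero =>
    obtain ⟨u, z, hz, rfl⟩ := hB
    exact ⟨1, 0, by simp, 0, R.zero_mem, u, z, hz, by simp⟩
  | succ n ih =>
    obtain ⟨t, u, ht, z, hz, u', z', hz', h⟩ := ih
    set y := y₀ + π ^ N • z with hy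
    set w := (u' * y - y * u') + z' with hw
    obtain ⟨s, hs⟩ : ∃ s : 𝓔ˣ, (s : 𝓔) = 1 + π ^ (N + n) • u' := by
      have := hunit (π ^ (N + n - 1) • u')
      rw [smul_smul, ← pow_succ', Nat.sub_add_cancel (by omega)] at this
      exact ⟨this.unit, rfl⟩
    have hz1 : z + π ^ n • z' ∈ R := R.add_mem hz (R.smul_mem _ hz')
    -- This is the exact second-order error after conjugation by `s`, split into a commutator with
    -- the new centre and an element of `R`.
    obtain ⟨u₂, z₂, hz₂, h'⟩ := h2 _ hz1 (((s⁻¹ : 𝓔ˣ) : 𝓔) * (w * u' - u' * z'))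
    have hy1 : y₀ + π ^ N • (z + π ^ n • z') = y + π ^ (N + n) • z' := by
      rw [hy, smul_add, smul_smul, ← pow_add, add_assoc]
    rw [hy1] at h'
    refine ⟨t * s, u + π ^ n • u' + π ^ (N + n) • (u * u'), ?_, _, hz1, π ^ (N + n - 1 - c) • u₂,
      π ^ (N + n - 1 - c) • z₂, R.smul_mem _ hz₂, ?_⟩
    · rw [Units.val_mul, ht, hs]
      simp only [mul_add, add_mul, mul_one, one_mul, smul_mul_assoc, mul_smul_comm, smul_add,
        smul_smul, ← pow_add]
      rw [show N + (N + n) = N + n + N by ring]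
      abel
    · have e1 : π ^ (N + (n + 1)) • ((π ^ (N + n - 1 - c) • u₂ * (y + π ^ (N + n) • z') -
          (y + π ^ (N + n) • z') * π ^ (N + n - 1 - c) • u₂) + π ^ (N + n - 1 - c) • z₂) =
          π ^ (N + n + (N + n)) • (((s⁻¹ : 𝓔ˣ) : 𝓔) * (w * u' - u' * z')) := by
        have e2 : π ^ (N + n + (N + n)) = π ^ (N + (n + 1)) * π ^ (N + n - 1 - c) * π ^ c := by
          rw [← pow_add, ← pow_add]; congr 1; omega
        rw [e2, mul_smul, h', mul_smul]
        simp only [smul_add, smul_sub, smul_mul_assoc, mul_smul_comm]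
      rw [hy1, e1, Units.val_mul, ← mul_assoc, h, mul_assoc, mul_assoc]
      congr 1
      have e3 : (s : 𝓔) * (π ^ (N + n + (N + n)) • (((s⁻¹ : 𝓔ˣ) : 𝓔) * (w * u' - u' * z'))) =
          π ^ (N + n + (N + n)) • (w * u' - u' * z') := by
        rw [mul_smul_comm, ← mul_assoc, Units.mul_inv, one_mul]
      rw [mul_add (s : 𝓔), e3, hs]
      rw [pow_add π (N + n)]
      generalize π ^ (N + n) = a
      have e4 : a • w = a • (u' * y) - a • (y * u') + a • z' := by rw [hw, smul_add, smul_sub]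
      simp only [add_mul, mul_add, one_mul, mul_one, smul_mul_assoc, mul_smul_comm, smul_sub,
        smul_add, mul_smul]
      rw [e4]
      abel

/-- One inclusion is the first-order computation of `exists_commutator_of_conj`. For the other,
successive approximation puts `B` in the closure of the set of conjugates, and this set is closed by
compactness. -/
theorem tube_eq [TopologicalSpace 𝓔] [IsTopologicalRing 𝓔] [ContinuousConstSMul S 𝓔]
    [CompactSpace 𝓔] [T2Space 𝓔]
    (hπ : ∀ U ∈ 𝓝 (0 : 𝓔), ∃ k, ∀ n ≥ k, ∀ e : 𝓔, π ^ n • e ∈ U)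
    (hR : IsClosed (R : Set 𝓔)) (hN : c < N) (hunit : ∀ u : 𝓔, IsUnit (1 + π • u))
    (h2 : ∀ z ∈ R, ∀ e, ∃ u, ∃ z' ∈ R,
      π ^ c • e = (u * (y₀ + π ^ N • z) - (y₀ + π ^ N • z) * u) + z')
    (h3 : ∀ z ∈ R, ∀ u, ∃ u', u * (y₀ + π ^ N • z) - (y₀ + π ^ N • z) * u = u' * y₀ - y₀ * u')
    (B : 𝓔) :
    (∃ u, ∃ z ∈ R, B = y₀ + π ^ N • ((u * y₀ - y₀ * u) + z)) ↔
      ∃ t : 𝓔ˣ, ∃ u, (t : 𝓔) = 1 + π ^ N • u ∧ ∃ z ∈ R,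
        B = (t : 𝓔) * (y₀ + π ^ N • z) * ((t⁻¹ : 𝓔ˣ) : 𝓔) := by
  have hunitN : ∀ u : 𝓔, IsUnit (1 + π ^ N • u) := fun u => by
    have := hunit (π ^ (N - 1) • u)
    rwa [smul_smul, ← pow_succ', Nat.sub_add_cancel (by omega)] at this
  constructor
  · intro hB
    -- The conjugation equation is written without inverses, so that `K` is closed; its first
    -- projection is closed because the other factors are compact.
    let K : Set (𝓔 × (𝓔 × 𝓔)) := {q | q.2.2 ∈ R ∧
      q.1 * (1 + π ^ N • q.2.1) = (1 + π ^ N • q.2.1) * (y₀ + π ^ N • q.2.2)}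
    have hK : IsClosed K := by
      refine IsClosed.inter (hR.preimage (by fun_prop)) (isClosed_eq (by fun_prop) (by fun_prop))
    have hK' : IsClosed (Prod.fst '' K) := isClosedMap_fst_of_compactSpace _ hK
    have hBK : B ∈ Prod.fst '' K := by
      rw [← hK'.closure_eq, mem_closure_iff_nhds]
      intro U hU
      have hU' : (fun d => B - d) ⁻¹' U ∈ 𝓝 (0 : 𝓔) := by
        refine ContinuousAt.preimage_mem_nhds (by fun_prop) ?_
        simpa using hU
      obtain ⟨k, hk⟩ := hπ _ hU'
      obtain ⟨t, u, ht, z, hz, u', z', hz', h⟩ := exists_conj_approx π hN hunit h2 hB k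
      set w := (u' * (y₀ + π ^ N • z) - (y₀ + π ^ N • z) * u') + z'
      refine ⟨B - π ^ (N + k) • (t * w * ((t⁻¹ : 𝓔ˣ) : 𝓔)), hk (N + k) (by omega) _,
        (_, (u, z)), ⟨hz, ?_⟩, rfl⟩
      change (B - π ^ (N + k) • (t * w * ((t⁻¹ : 𝓔ˣ) : 𝓔))) * (1 + π ^ N • u) =
        (1 + π ^ N • u) * (y₀ + π ^ N • z)
      rw [← ht, sub_mul, h, smul_mul_assoc, mul_assoc _ _ (t : 𝓔), Units.inv_mul, mul_one, mul_add,
        mul_smul_comm, add_sub_cancel_right]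
    obtain ⟨⟨_, u, z⟩, ⟨hz, h⟩, rfl⟩ := hBK
    refine ⟨(hunitN u).unit, u, rfl, z, hz, ?_⟩
    rw [Units.eq_mul_inv_iff_mul_eq]
    exact h
  · rintro ⟨t, u, ht, z, hz, rfl⟩
    refine exists_commutator_of_conj π hN.le ?_ h3 hz t u ht
    intro e
    simpa using h2 0 R.zero_mem e

end TubeLemma

/-! ### Commutators with a generator of a commutative algebra -/

section Commutator

open Polynomial Finset

/-- By the Leibniz rule `[u, a b] = [u, a] b + a [u, b]`; polynomials in `X` commute with `X`, so
they can be moved inside a commutator with `X`. -/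
theorem exists_commutator_of_mem_adjoin {S V : Type*} [CommRing S] [Ring V] [Algebra S V]
    (𝓐 : Subalgebra S V) {X : V} (hX : X ∈ 𝓐) {a : V} (ha : a ∈ Algebra.adjoin S {X}) :
    ∀ u ∈ 𝓐, ∃ u' ∈ 𝓐, u * a - a * u = u' * X - X * u' := by
  have hle : Algebra.adjoin S {X} ≤ 𝓐 := Algebra.adjoin_le (by simpa using hX)
  have hcomm : ∀ b ∈ Algebra.adjoin S {X}, b * X = X * b := fun b hb =>
    (Algebra.commute_of_mem_adjoin_self hb).eq.symm
  induction ha using Algebra.adjoin_induction with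
  | mem a ha => rw [Set.mem_singleton_iff.1 ha]; exact fun u hu => ⟨u, hu, rfl⟩
  | algebraMap c => exact fun u _ => ⟨0, 𝓐.zero_mem, by rw [Algebra.commutes]; simp⟩
  | add a b _ _ iha ihb =>
    intro u hu
    obtain ⟨u₁, h₁, e₁⟩ := iha u hu
    obtain ⟨u₂, h₂, e₂⟩ := ihb u hu
    refine ⟨u₁ + u₂, 𝓐.add_mem h₁ h₂, ?_⟩
    rw [mul_add, add_mul, add_sub_add_comm, e₁, e₂]
    noncomm_ring
  | mul a b ha hb iha ihb =>
    intro u hu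
    obtain ⟨u₁, h₁, e₁⟩ := iha u hu
    obtain ⟨u₂, h₂, e₂⟩ := ihb u hu
    refine ⟨u₁ * b + a * u₂, 𝓐.add_mem (𝓐.mul_mem h₁ (hle hb)) (𝓐.mul_mem (hle ha) h₂), ?_⟩
    calc u * (a * b) - a * b * u = (u * a - a * u) * b + a * (u * b - b * u) := by noncomm_ring
      _ = u₁ * (X * b) - X * u₁ * b + (a * u₂ * X - (a * X) * u₂) := by
        rw [e₁, e₂]; noncomm_ring
      _ = _ := by rw [← hcomm b hb, hcomm a ha]; noncomm_ring

/-- Nakayama: modulo `π` the elements `x` and `y` agree, so `S[x] = S[y] + π S[x]`. Hence `x` and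
`y` have the same commutators and the same centralizer. -/
theorem mem_adjoin_of_sub_mem_smul {S E : Type*} [CommRing S] [CommRing E] [Algebra S E] {π : S}
    (hπ : π ∈ (⊥ : Ideal S).jacobson) {x y z : E}
    (hfg : (Subalgebra.toSubmodule (Algebra.adjoin S {x})).FG)
    (hz : z ∈ Algebra.adjoin S {x}) (hy : y = x + π • z) : x ∈ Algebra.adjoin S {y} := by
  set R := Algebra.adjoin S {x} with hR
  have hyR : y ∈ R := hy ▸ R.add_mem (Algebra.self_mem_adjoin_singleton S x) (R.smul_mem hz π)
  have hle : Algebra.adjoin S {y} ≤ R := Algebra.adjoin_le (by simpa using hyR)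
  have key : ∀ a ∈ R, ∃ b ∈ Algebra.adjoin S {y}, ∃ c ∈ R, a = b + π • c := by
    intro a ha
    induction ha using Algebra.adjoin_induction with
    | mem a ha =>
      rw [Set.mem_singleton_iff.1 ha]
      exact ⟨y, Algebra.self_mem_adjoin_singleton S y, -z, R.neg_mem hz, by rw [hy]; simp⟩
    | algebraMap c =>
      exact ⟨_, Subalgebra.algebraMap_mem _ c, 0, R.zero_mem, by simp⟩
    | add a b _ _ iha ihb =>
      obtain ⟨a₁, h₁, a₂, h₂, rfl⟩ := iha
      obtain ⟨b₁, g₁, b₂, g₂, rfl⟩ := ihb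
      exact ⟨_, add_mem h₁ g₁, _, add_mem h₂ g₂, by rw [smul_add]; abel⟩
    | mul a b _ _ iha ihb =>
      obtain ⟨a₁, h₁, a₂, h₂, rfl⟩ := iha
      obtain ⟨b₁, g₁, b₂, g₂, rfl⟩ := ihb
      refine ⟨_, mul_mem h₁ g₁, a₁ * b₂ + a₂ * b₁ + π • (a₂ * b₂), ?_, ?_⟩
      · exact add_mem (add_mem (mul_mem (hle h₁) g₂) (mul_mem h₂ (hle g₁)))
          (R.smul_mem (mul_mem h₂ g₂) π)
      · simp only [mul_add, add_mul, smul_add, mul_smul_comm, smul_mul_assoc]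
        abel
  have hN : Subalgebra.toSubmodule R ≤ Subalgebra.toSubmodule (Algebra.adjoin S {y}) := by
    refine Submodule.le_of_le_smul_of_le_jacobson_bot (I := Ideal.span {π}) hfg
      (by simpa [Ideal.span_le] using hπ) ?_
    intro a ha
    obtain ⟨b, hb, c, hc, rfl⟩ := key a ha
    exact Submodule.add_mem_sup hb
      (Submodule.smul_mem_smul (Ideal.mem_span_singleton_self π) hc)
  exact hN (Algebra.self_mem_adjoin_singleton S x)

variable {S F E : Type*} [CommRing S] [Field F] [CommRing E] [Algebra S F] [Algebra F E]
  [Algebra S E] [IsScalarTower S F E]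

/-- The coefficients of the polynomial `Z / (X - x)`. -/
noncomputable def quotCoeff (x : E) (Z : S[X]) (k : ℕ) : E :=
  ((Z.map (algebraMap S E)) /ₘ (X - C x)).coeff k

/-- The linear map `w ↦ ∑ k, β k * w (x ^ k)`, where `Z / (X - x) = ∑ k, β k X ^ k`. -/
noncomputable def evalQuot (F : Type*) [Field F] [Algebra F E] (x : E) (Z : S[X]) :
    Module.End F E →ₗ[F] E :=
  ∑ k ∈ range Z.natDegree, (LinearMap.mulLeft F (quotCoeff x Z k)).comp
    (LinearMap.applyₗ (x ^ k))

theorem evalQuot_apply (x : E) (Z : S[X]) (w : Module.End F E) :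
    evalQuot F x Z w = ∑ k ∈ range Z.natDegree, quotCoeff x Z k * w (x ^ k) := by
  simp [evalQuot]

theorem lmul_apply_apply (a y : E) : Algebra.lmul F E a y = a * y := rfl

variable {x : E} {Z : S[X]}

theorem X_sub_C_mul_quot (hx : aeval x Z = 0) : (X - C x) * ((Z.map (algebraMap S E)) /ₘ (X - C x)) =
    Z.map (algebraMap S E) := by
  rw [mul_divByMonic_eq_iff_isRoot, IsRoot, eval_map_algebraMap, hx]

theorem quotCoeff_succ (hx : aeval x Z = 0) (k : ℕ) :
    quotCoeff x Z k = algebraMap S E (Z.coeff (k + 1)) + x * quotCoeff x Z (k + 1) := by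
  have := congrArg (fun f => coeff f (k + 1)) (X_sub_C_mul_quot hx)
  simp only [coeff_map, sub_mul, coeff_sub, coeff_X_mul, coeff_C_mul] at this
  rw [← this]
  simp [quotCoeff]

theorem mul_quotCoeff_zero (hx : aeval x Z = 0) : x * quotCoeff x Z 0 = - algebraMap S E (Z.coeff 0) := by
  have := congrArg (fun f => coeff f 0) (X_sub_C_mul_quot hx)
  simp only [coeff_map, sub_mul, coeff_sub, mul_coeff_zero, coeff_X_zero] at this
  rw [← this]
  simp [quotCoeff]

theorem quotCoeff_of_le {k : ℕ} (hk : Z.natDegree ≤ k) : quotCoeff x Z k = 0 := by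
  nontriviality E
  rcases Nat.eq_zero_or_pos k with rfl | hk0
  · rw [Nat.le_zero] at hk
    rw [quotCoeff, (divByMonic_eq_zero_iff (monic_X_sub_C x)).2, coeff_zero]
    rw [degree_X_sub_C]
    refine lt_of_le_of_lt (degree_map_le.trans degree_le_natDegree) ?_
    rw [hk]; simp
  · refine coeff_eq_zero_of_natDegree_lt ?_
    rw [natDegree_divByMonic _ (monic_X_sub_C x), natDegree_X_sub_C]
    have := natDegree_map_le (f := algebraMap S E) (p := Z)
    omega

theorem quotCoeff_mem_adjoin (hx : aeval x Z = 0) (k : ℕ) : quotCoeff x Z k ∈ Algebra.adjoin S {x} := by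
  obtain h | h := le_total Z.natDegree k
  · rw [quotCoeff_of_le h]; exact zero_mem _
  · induction h using Nat.decreasingInduction with
    | self => rw [quotCoeff_of_le le_rfl]; exact zero_mem _
    | of_succ k _ ih =>
      rw [quotCoeff_succ hx]
      exact add_mem (Subalgebra.algebraMap_mem _ _)
        (mul_mem (Algebra.self_mem_adjoin_singleton S x) ih)

theorem quotCoeff_last (hx : aeval x Z = 0) (hZ : Z.Monic) (h : 0 < Z.natDegree) :
    quotCoeff x Z (Z.natDegree - 1) = 1 := by
  rw [quotCoeff_succ hx, Nat.sub_add_cancel h, quotCoeff_of_le le_rfl, hZ.coeff_natDegree]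
  simp

/-- The recursion `β k = Z_(k+1) + x β (k+1)` makes the sum telescope to `u (Z(x)) = u 0`. -/
theorem evalQuot_commutator (hx : aeval x Z = 0) (u : Module.End F E) :
    evalQuot F x Z (u * Algebra.lmul F E x - Algebra.lmul F E x * u) = 0 := by
  set r := Z.natDegree with hr
  have h1 : evalQuot F x Z (u * Algebra.lmul F E x - Algebra.lmul F E x * u) =
      ∑ k ∈ range r, quotCoeff x Z k * u (x ^ (k + 1)) -
        ∑ k ∈ range r, x * quotCoeff x Z k * u (x ^ k) := by
    rw [evalQuot_apply, ← sum_sub_distrib]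
    refine sum_congr rfl fun k _ => ?_
    simp only [LinearMap.sub_apply, Module.End.mul_apply, lmul_apply_apply, pow_succ' x k]
    ring
  have h2 : ∑ k ∈ range r, x * quotCoeff x Z k * u (x ^ k) =
      ∑ k ∈ range r, x * quotCoeff x Z (k + 1) * u (x ^ (k + 1)) +
        x * quotCoeff x Z 0 * u (x ^ 0) := by
    rw [← sum_range_succ' (fun k => x * quotCoeff x Z k * u (x ^ k)), sum_range_succ,
      quotCoeff_of_le le_rfl, mul_zero, zero_mul, add_zero]
  have h3 : u (aeval x Z) = ∑ k ∈ range (r + 1), algebraMap S E (Z.coeff k) * u (x ^ k) := by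
    rw [aeval_eq_sum_range, map_sum]
    refine sum_congr rfl fun k _ => ?_
    rw [← Algebra.smul_def, ← IsScalarTower.algebraMap_smul F, map_smul,
      IsScalarTower.algebraMap_smul]
  rw [hx, map_zero, sum_range_succ'] at h3
  rw [h1, h2, mul_quotCoeff_zero hx, ← sub_sub, ← sum_sub_distrib, h3]
  rw [neg_mul, sub_neg_eq_add]
  congr 1
  refine sum_congr rfl fun k _ => ?_
  rw [quotCoeff_succ hx k]
  ring

/-- On a multiplication by `e` the sum is `Q(x) e` with `Q = Z / (X - x)`, and differentiating `Z =
(X - x) Q` at `x` gives `Q(x) = Z'(x)`. -/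
theorem evalQuot_lmul (hx : aeval x Z = 0) (e : E) :
    evalQuot F x Z (Algebra.lmul F E e) = aeval x (derivative Z) * e := by
  have h1 : aeval x (derivative Z) = eval x ((Z.map (algebraMap S E)) /ₘ (X - C x)) := by
    have := congrArg (fun f => eval x (derivative f)) (X_sub_C_mul_quot hx)
    simp only [derivative_mul, derivative_sub, derivative_X, derivative_C, sub_zero, one_mul,
      eval_add, eval_mul, eval_sub, eval_X, eval_C, sub_self, zero_mul, add_zero,
      derivative_map, eval_map_algebraMap] at this
    exact this.symm
  rw [h1, evalQuot_apply]
  have hn : natDegree ((Z.map (algebraMap S E)) /ₘ (X - C x)) ≤ Z.natDegree :=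
    natDegree_le_iff_coeff_eq_zero.2 fun k hk => quotCoeff_of_le hk.le
  have h2 := quotCoeff_of_le (x := x) (Z := Z) le_rfl
  rw [quotCoeff] at h2
  rw [eval_eq_sum_range' (Nat.lt_succ_of_le hn), sum_range_succ, h2, zero_mul, add_zero, sum_mul]
  refine sum_congr rfl fun k _ => ?_
  rw [lmul_apply_apply, quotCoeff]
  ring

/-- An endomorphism killed by `evalQuot` is a commutator with `x`, with integrality. -/
theorem exists_commutator_of_evalQuot_eq_zero (hx : aeval x Z = 0) (hZ : Z.Monic)
    {r : ℕ} (hr : Z.natDegree = r) (b : Module.Basis (Fin r) F E) (hb : ∀ k, b k = x ^ (k : ℕ)) {L : AddSubgroup E}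
    (hL : ∀ a ∈ L, x * a ∈ L) {w : Module.End F E} (hw : ∀ k < r, w (x ^ k) ∈ L)
    (hw0 : evalQuot F x Z w = 0) :
    ∃ u : Module.End F E, (∀ k < r, u (x ^ k) ∈ L) ∧
      w = u * Algebra.lmul F E x - Algebra.lmul F E x * u := by
  -- The values `u (x ^ k)` are forced by `w (x ^ k) = u (x ^ (k+1)) - x u (x ^ k)` once `u 1 = 0`
  -- is chosen. No division occurs, so they stay in `L`.
  let c : ℕ → E := fun k => Nat.rec 0 (fun k a => w (x ^ k) + x * a) k
  have c0 : c 0 = 0 := rfl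
  have cs : ∀ k, c (k + 1) = w (x ^ k) + x * c k := fun _ => rfl
  have hc : ∀ k ≤ r, c k ∈ L := by
    intro k hk
    induction k with
    | zero => exact L.zero_mem
    | succ k ih => exact L.add_mem (hw k hk) (hL _ (ih (by omega)))
  let u : Module.End F E := b.constr F fun k => c k
  have hu : ∀ k < r, u (x ^ k) = c k := fun k hk => by
    have := b.constr_basis F (fun k => c k) ⟨k, hk⟩
    rwa [hb] at this
  refine ⟨u, fun k hk => by rw [hu k hk]; exact hc k hk.le, ?_⟩
  -- By construction `d` vanishes on every basis vector except possibly `x ^ (r-1)`. As `β (r-1) =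
  -- 1`, `evalQuot` reads off that last value, which is therefore zero.
  set d := w - (u * Algebra.lmul F E x - Algebra.lmul F E x * u) with hd
  have hd0 : ∀ k, k + 1 < r → d (x ^ k) = 0 := by
    intro k hk
    have h1 : d (x ^ k) = w (x ^ k) - (u (x ^ (k + 1)) - x * u (x ^ k)) := by
      rw [pow_succ']; rfl
    rw [h1, hu k (by omega), hu _ hk, cs]
    ring
  have hψ : evalQuot F x Z d = 0 := by rw [hd, map_sub, hw0, evalQuot_commutator hx, sub_zero]
  have hd1 : d = 0 := by
    refine b.ext fun k => ?_
    rw [hb, LinearMap.zero_apply]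
    by_cases hk : (k : ℕ) + 1 < r
    · exact hd0 k hk
    · have hkr : (k : ℕ) = r - 1 := by have := k.2; omega
      have hpos : 0 < r := k.pos
      rw [evalQuot_apply, hr, ← Nat.sub_add_cancel hpos, sum_range_succ,
        sum_eq_zero fun j hj => by rw [hd0 j (by have := mem_range.1 hj; omega), mul_zero],
        zero_add] at hψ
      have hlast := quotCoeff_last hx hZ (hr ▸ hpos)
      rw [hr] at hlast
      change quotCoeff x Z (r - 1) * d (x ^ (r - 1)) = 0 at hψ
      rw [hlast, one_mul] at hψ
      rw [hkr, hψ]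
  rw [hd, sub_eq_zero] at hd1
  exact hd1

/-- Since `Z` is monic, `β (r-1) = 1`; the endomorphism sending `x ^ (r-1)` to `e` and the lower
powers to `0` therefore works. -/
theorem exists_evalQuot_eq (hx : aeval x Z = 0) (hZ : Z.Monic)
    {r : ℕ} (hr : Z.natDegree = r) (b : Module.Basis (Fin r) F E) (hb : ∀ k, b k = x ^ (k : ℕ)) (L : AddSubgroup E)
    {e : E} (he : e ∈ L) :
    ∃ w : Module.End F E, (∀ k < r, w (x ^ k) ∈ L) ∧ evalQuot F x Z w = e := by
  have hw : ∀ k < r, (b.constr F fun k : Fin r =>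
      if (k : ℕ) + 1 = r then e else 0) (x ^ k) =
      if k + 1 = r then e else 0 := fun k hk => by
    have := b.constr_basis F (fun k : Fin r =>
      if (k : ℕ) + 1 = r then e else 0) ⟨k, hk⟩
    rwa [hb] at this
  refine ⟨b.constr F fun k => if (k : ℕ) + 1 = r then e else 0, fun k hk => ?_, ?_⟩
  · rw [hw k hk]
    split_ifs
    exacts [he, L.zero_mem]
  · rw [evalQuot_apply, hr, sum_congr rfl fun k hk => by rw [hw k (mem_range.1 hk)]]
    rcases Nat.eq_zero_or_pos r with h0 | hpos
    · have : Subsingleton E := by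
        have h1 := hx
        rw [eq_one_of_monic_natDegree_zero hZ (hr.trans h0), map_one] at h1
        exact subsingleton_of_zero_eq_one h1.symm
      exact Subsingleton.elim _ _
    · rw [sum_eq_single (r - 1)]
      · have hlast := quotCoeff_last hx hZ (hr ▸ hpos)
        rw [hr] at hlast
        rw [hlast, if_pos (Nat.sub_add_cancel hpos), one_mul]
      · intro k _ hk
        rw [if_neg (by omega), mul_zero]
      · intro h
        exact absurd (mem_range.2 (by omega)) h

/-- Euler's formula for the coordinates of `Z' (x) * m` in the basis of the powers of `x`. -/
theorem repr_derivative_mul (hx : aeval x Z = 0) (hZ : Z.Monic)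
    {r : ℕ} (hr : Z.natDegree = r) (b : Module.Basis (Fin r) F E) (hb : ∀ k, b k = x ^ (k : ℕ))
    (hu : IsUnit (aeval x (derivative Z))) (m : E) (j : Fin r) :
    b.repr (aeval x (derivative Z) * m) j = Algebra.trace F E (quotCoeff x Z j * m) := by
  have : Module.Finite F E := Module.Finite.of_basis b
  set f := aeval x (derivative Z) * m with hf
  -- The rank-one map `w` has `evalQuot` equal to `β j`, so it is a commutator with `x` plus
  -- multiplication by `e`, where `Z'(x) e = β j`. Composing with multiplication by `f` and taking
  -- traces removes the commutator, since `f` commutes with `x`.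
  let w : Module.End F E := (b.coord j).smulRight 1
  have hw : ∀ a, w a = algebraMap F E (b.repr a j) := fun a => by
    rw [Algebra.algebraMap_eq_smul_one]; rfl
  have hψ : evalQuot F x Z w = quotCoeff x Z j := by
    rw [evalQuot_apply, hr, sum_range fun k => quotCoeff x Z k * w (x ^ k), sum_eq_single j]
    · rw [hw, ← hb, b.repr_self, Finsupp.single_eq_same, map_one, mul_one]
    · intro k _ hk
      rw [hw, ← hb, b.repr_self, Finsupp.single_eq_of_ne hk.symm, map_zero, mul_zero]
    · exact fun h => absurd (mem_univ _) h
  obtain ⟨e, he⟩ := hu.dvd (a := quotCoeff x Z (j : ℕ))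
  obtain ⟨u, -, h⟩ := exists_commutator_of_evalQuot_eq_zero hx hZ hr b hb (L := ⊤)
    (fun _ _ => AddSubgroup.mem_top _) (w := w - Algebra.lmul F E e)
    (fun _ _ => AddSubgroup.mem_top _) (by rw [map_sub, hψ, evalQuot_lmul hx, he, sub_self])
  have h1 : LinearMap.trace F E (w * Algebra.lmul F E f) = b.repr f j := by
    have : w * Algebra.lmul F E f =
        ((b.coord j).comp (Algebra.lmul F E f)).smulRight 1 := rfl
    rw [this, LinearMap.trace_smulRight]
    simp
  have h2 : LinearMap.trace F E ((u * Algebra.lmul F E x - Algebra.lmul F E x * u) *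
      Algebra.lmul F E f) = 0 := by
    rw [sub_mul, map_sub, mul_assoc, mul_assoc, LinearMap.trace_mul_comm F (Algebra.lmul F E x),
      mul_assoc, ← map_mul, ← map_mul, mul_comm x, sub_self]
  rw [← h1, ← sub_add_cancel w (Algebra.lmul F E e), h, add_mul, map_add, h2, zero_add, ← map_mul,
    Algebra.trace_apply, he, hf]
  congr 2
  ring

end Commutator

/-! ### Matrices over `ℤ_[p]` -/

section PadicMatrix

open Topology

variable {p : ℕ} [Fact p.Prime] {r : ℕ}

instance isLocalHom_mapMatrix_toZMod :
    IsLocalHom ((PadicInt.toZMod (p := p)).mapMatrix (m := Fin r)) := by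
  refine ⟨fun A hA => ?_⟩
  rw [Matrix.isUnit_iff_isUnit_det] at hA ⊢
  rw [← RingHom.map_det] at hA
  by_contra h
  have : A.det ∈ IsLocalRing.maximalIdeal ℤ_[p] := (IsLocalRing.mem_maximalIdeal _).2 h
  rw [← PadicInt.ker_toZMod, RingHom.mem_ker] at this
  rw [this] at hA
  exact not_isUnit_zero hA

theorem isUnit_one_add_smul_matrix (u : Matrix (Fin r) (Fin r) ℤ_[p]) :
    IsUnit (1 + (p : ℤ_[p]) • u) := by
  refine isUnit_of_map_unit (PadicInt.toZMod (p := p)).mapMatrix _ ?_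
  have : (PadicInt.toZMod (p := p)).mapMatrix (1 + (p : ℤ_[p]) • u) = 1 := by
    rw [map_add, map_one, add_eq_left]
    ext i j
    simp [map_mul]
  rw [this]
  exact isUnit_one

/-- The convergence `p ^ n e → 0` is uniform in `e` because the matrix space is compact. -/
theorem pow_smul_matrix_tendsto (U : Set (Matrix (Fin r) (Fin r) ℤ_[p])) (hU : U ∈ 𝓝 0) :
    ∃ k, ∀ n ≥ k, ∀ e : Matrix (Fin r) (Fin r) ℤ_[p], (p : ℤ_[p]) ^ n • e ∈ U := by
  have : CompactSpace (Matrix (Fin r) (Fin r) ℤ_[p]) :=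
    inferInstanceAs (CompactSpace (Fin r → Fin r → ℤ_[p]))
  have h1 : ∀ᶠ a in 𝓝 (0 : ℤ_[p]), ∀ e ∈ (Set.univ : Set (Matrix (Fin r) (Fin r) ℤ_[p])),
      a • e ∈ U := by
    refine isCompact_univ.eventually_forall_of_forall_eventually fun e _ => ?_
    have hc : Continuous fun z : ℤ_[p] × Matrix (Fin r) (Fin r) ℤ_[p] => z.1 • z.2 := by fun_prop
    refine hc.continuousAt.eventually_mem ?_
    simpa using hU
  have h2 : Filter.Tendsto (fun n : ℕ => (p : ℤ_[p]) ^ n) Filter.atTop (𝓝 0) := by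
    refine tendsto_pow_atTop_nhds_zero_of_norm_lt_one ?_
    rw [PadicInt.norm_p]
    exact inv_lt_one_of_one_lt₀ (by exact_mod_cast (Fact.out : p.Prime).one_lt)
  obtain ⟨k, hk⟩ := Filter.eventually_atTop.1 (h2.eventually h1)
  exact ⟨k, fun n hn e => hk n hn e trivial⟩

theorem map_toZMod_eq_zero_iff (B : Matrix (Fin r) (Fin r) ℤ_[p]) :
    (PadicInt.toZMod (p := p)).mapMatrix B = 0 ↔ ∃ u, B = (p : ℤ_[p]) • u := by
  constructor
  · intro h
    have h1 : ∀ i j, ∃ c, B i j = p * c := fun i j => by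
      have : PadicInt.toZMod (B i j) = 0 := congrFun (congrFun h i) j
      rw [← RingHom.mem_ker, PadicInt.ker_toZMod, PadicInt.maximalIdeal_eq_span_p] at this
      exact Ideal.mem_span_singleton.1 this
    choose c hc using h1
    exact ⟨Matrix.of c, by ext i j; simp [hc]⟩
  · rintro ⟨u, rfl⟩
    ext i j
    simp [map_mul]

theorem card_units_div_card_matrix :
    (Nat.card (Matrix (Fin r) (Fin r) (ZMod p))ˣ : ℝ) / Nat.card (Matrix (Fin r) (Fin r) (ZMod p)) =
      ∏ j ∈ Finset.Icc 1 r, (1 - ((p : ℝ) ^ j)⁻¹) := by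
  have hp : (p : ℝ) ≠ 0 := by exact_mod_cast (Fact.out : p.Prime).ne_zero
  have h1 := Matrix.card_GL_field (𝔽 := ZMod p) r
  rw [ZMod.card] at h1
  have h2 : Nat.card (Matrix (Fin r) (Fin r) (ZMod p)) = (p ^ r) ^ r := by
    change Nat.card (Fin r → Fin r → ZMod p) = _
    rw [Nat.card_fun, Nat.card_fun, Nat.card_eq_fintype_card, Nat.card_eq_fintype_card,
      Fintype.card_fin, ZMod.card]
  have h3 : (Nat.card (Matrix (Fin r) (Fin r) (ZMod p))ˣ : ℝ) =
      ∏ i ∈ Finset.range r, ((p : ℝ) ^ r - (p : ℝ) ^ i) := by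
    rw [show Nat.card (Matrix (Fin r) (Fin r) (ZMod p))ˣ = _ from h1, Nat.cast_prod,
      Finset.prod_range]
    refine Finset.prod_congr rfl fun i _ => ?_
    rw [Nat.cast_sub (Nat.pow_le_pow_right (Fact.out : p.Prime).pos i.2.le)]
    push_cast; rfl
  have h4 : ((p : ℝ) ^ r) ^ r = ∏ _i ∈ Finset.range r, (p : ℝ) ^ r := by
    rw [Finset.prod_const, Finset.card_range]
  rw [h2, h3, Nat.cast_pow, Nat.cast_pow, h4, ← Finset.prod_div_distrib, ← Finset.prod_range_reflect,
    ← Finset.Ico_add_one_right_eq_Icc, Finset.prod_Ico_eq_prod_range, Nat.add_sub_cancel]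
  refine Finset.prod_congr rfl fun i hi => ?_
  have hi' := Finset.mem_range.1 hi
  rw [sub_div, div_self (pow_ne_zero _ hp), add_comm 1 i]
  congr 1
  rw [div_eq_iff (pow_ne_zero _ hp), eq_comm, inv_mul_eq_iff_eq_mul₀ (pow_ne_zero _ hp), ← pow_add]
  congr 1
  omega

/-- The multiples of `p ^ n` have finite index. -/
theorem exists_ideal_matrix (n : ℕ) : ∃ I : AddSubgroup (Matrix (Fin r) (Fin r) ℤ_[p]),
    (∀ a, ∀ b ∈ I, a * b ∈ I) ∧ I.index ≠ 0 ∧ IsOpen (I : Set (Matrix (Fin r) (Fin r) ℤ_[p])) ∧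
      ∀ B, B ∈ I ↔ ∃ u, B = (p : ℤ_[p]) ^ n • u := by
  have hp : p ^ n ≠ 0 := pow_ne_zero _ (Fact.out : p.Prime).ne_zero
  have : NeZero (p ^ n) := ⟨hp⟩
  have hmem : ∀ B : Matrix (Fin r) (Fin r) ℤ_[p],
      (PadicInt.toZModPow (p := p) n).mapMatrix B = 0 ↔ ∃ u, B = (p : ℤ_[p]) ^ n • u := by
    intro B
    constructor
    · intro h
      have h1 : ∀ i j, ∃ c, B i j = (p : ℤ_[p]) ^ n * c := fun i j => by
        have : PadicInt.toZModPow n (B i j) = 0 := congrFun (congrFun h i) j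
        rw [← RingHom.mem_ker, PadicInt.ker_toZModPow] at this
        exact Ideal.mem_span_singleton.1 this
      choose c hc using h1
      exact ⟨Matrix.of c, by ext i j; simp [hc]⟩
    · rintro ⟨u, rfl⟩
      have h0 : PadicInt.toZModPow n ((p : ℤ_[p]) ^ n) = 0 := by
        rw [← RingHom.mem_ker, PadicInt.ker_toZModPow]
        exact Ideal.mem_span_singleton_self _
      ext i j
      simp only [RingHom.mapMatrix_apply, Matrix.map_apply, Matrix.smul_apply, smul_eq_mul, map_mul,
        h0, zero_mul, Matrix.zero_apply]
  let φ : Matrix (Fin r) (Fin r) ℤ_[p] →+ Matrix (Fin r) (Fin r) (ZMod (p ^ n)) :=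
    ((PadicInt.toZModPow (p := p) n).mapMatrix (m := Fin r)).toAddMonoidHom
  have hker : ∀ B, B ∈ φ.ker ↔ ∃ u, B = (p : ℤ_[p]) ^ n • u := hmem
  have hindex : φ.ker.index ≠ 0 := by
    rw [AddSubgroup.index_ker]
    have : Finite (Matrix (Fin r) (Fin r) (ZMod (p ^ n))) :=
      inferInstanceAs (Finite (Fin r → Fin r → ZMod (p ^ n)))
    exact Nat.card_pos.ne'
  refine ⟨φ.ker, fun a b hb => ?_, hindex, ?_, hker⟩
  · obtain ⟨u, rfl⟩ := (hker b).1 hb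
    exact (hker _).2 ⟨a * u, by rw [mul_smul_comm]⟩
  · have : CompactSpace (Matrix (Fin r) (Fin r) ℤ_[p]) :=
      inferInstanceAs (CompactSpace (Fin r → Fin r → ℤ_[p]))
    have h1 : IsClosed (φ.ker : Set (Matrix (Fin r) (Fin r) ℤ_[p])) := by
      have h2 : (φ.ker : Set (Matrix (Fin r) (Fin r) ℤ_[p])) =
          Set.range fun u : Matrix (Fin r) (Fin r) ℤ_[p] => (p : ℤ_[p]) ^ n • u := by
        ext B
        rw [SetLike.mem_coe, hker]
        exact exists_congr fun u => eq_comm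
      rw [h2]
      exact (isCompact_range (by fun_prop)).isClosed
    have : φ.ker.FiniteIndex := ⟨hindex⟩
    exact AddSubgroup.isOpen_of_isClosed_of_finiteIndex _ h1

end PadicMatrix

/-! ### Endomorphisms preserving a lattice -/

section Stabilizer

open Polynomial

variable {p : ℕ} [Fact p.Prime] {E : Type*} [CommRing E] [Algebra ℚ_[p] E] [Algebra ℤ_[p] E]
  [IsScalarTower ℤ_[p] ℚ_[p] E]

/-- The `ℚ_[p]`-linear endomorphisms of `E` that map a `ℤ_[p]`-submodule into itself. -/
def stab (M : Submodule ℤ_[p] E) : Subalgebra ℤ_[p] (Module.End ℚ_[p] E) where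
  carrier := {T | ∀ m ∈ M, T m ∈ M}
  mul_mem' hS hT := fun m hm => hS _ (hT m hm)
  add_mem' hS hT := fun m hm => M.add_mem (hS m hm) (hT m hm)
  algebraMap_mem' c := fun m hm => by
    rw [Module.algebraMap_end_apply]
    exact M.smul_mem c hm

/-- The endomorphism of `E` given by a matrix over `ℤ_[p]` and a basis of a lattice. -/
noncomputable def latticeEnd {M : Submodule ℤ_[p] E} [M.IsLattice ℚ_[p]] {r : ℕ}
    (b : Module.Basis (Fin r) ℤ_[p] M) :
    Matrix (Fin r) (Fin r) ℤ_[p] →ₐ[ℤ_[p]] Module.End ℚ_[p] E :=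
  ((Matrix.toLinAlgEquiv (b.extendOfIsLattice ℚ_[p])).toAlgHom.restrictScalars ℤ_[p]).comp
    (Algebra.ofId ℤ_[p] ℚ_[p]).mapMatrix

section

variable {M : Submodule ℤ_[p] E} [M.IsLattice ℚ_[p]] {r : ℕ} (b : Module.Basis (Fin r) ℤ_[p] M)

theorem latticeEnd_apply_basis (A : Matrix (Fin r) (Fin r) ℤ_[p]) (j : Fin r) :
    latticeEnd b A (b j : E) = ∑ i, A i j • (b i : E) := by
  have h := Matrix.toLinAlgEquiv_self (b.extendOfIsLattice ℚ_[p])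
    ((Algebra.ofId ℤ_[p] ℚ_[p]).mapMatrix A) j
  simp only [Module.Basis.extendOfIsLattice_apply] at h
  refine h.trans (Finset.sum_congr rfl fun i _ => ?_)
  exact IsScalarTower.algebraMap_smul ℚ_[p] (A i j) (b i : E)

theorem latticeEnd_injective : Function.Injective (latticeEnd b) := by
  intro A B h
  have h1 := (Matrix.toLinAlgEquiv (b.extendOfIsLattice ℚ_[p])).injective h
  ext i j
  have h2 := congrFun (congrFun h1 i) j
  exact Subtype.ext (show ((A i j : ℤ_[p]) : ℚ_[p]) = B i j from h2)

theorem mem_stab_iff_range (T : Module.End ℚ_[p] E) : T ∈ stab M ↔ ∃ A, latticeEnd b A = T := by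
  constructor
  · intro hT
    refine ⟨Matrix.of fun i j => b.repr ⟨T (b j), hT _ (b j).2⟩ i, ?_⟩
    refine (b.extendOfIsLattice ℚ_[p]).ext fun j => ?_
    rw [Module.Basis.extendOfIsLattice_apply, latticeEnd_apply_basis]
    have := congrArg (Subtype.val) (b.sum_repr ⟨T (b j), hT _ (b j).2⟩)
    simp only [AddSubmonoidClass.coe_finsetSum, Submodule.coe_smul] at this
    exact this
  · rintro ⟨A, rfl⟩ m hm
    have h1 := congrArg Subtype.val (b.sum_repr ⟨m, hm⟩)
    simp only [AddSubmonoidClass.coe_finsetSum, Submodule.coe_smul] at h1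
    rw [← h1, map_sum]
    refine M.sum_mem fun j _ => ?_
    rw [← IsScalarTower.algebraMap_smul ℚ_[p], map_smul, IsScalarTower.algebraMap_smul,
      latticeEnd_apply_basis]
    exact M.smul_mem _ (M.sum_mem fun i _ => M.smul_mem _ (b i).2)

end

theorem lmul_mem_stab {M : Submodule ℤ_[p] E} {a : E} (ha : ∀ m ∈ M, a * m ∈ M) :
    Algebra.lmul ℚ_[p] E a ∈ stab M := ha

theorem aeval_lmul (a : E) (f : ℤ_[p][X]) :
    aeval (Algebra.lmul ℚ_[p] E a) f = Algebra.lmul ℚ_[p] E (aeval a f) := by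
  have := aeval_algHom_apply ((Algebra.lmul ℚ_[p] E).restrictScalars ℤ_[p]) a f
  exact this

theorem lmul_mem_adjoin {a b : E} (hab : a ∈ Algebra.adjoin ℤ_[p] {b}) :
    Algebra.lmul ℚ_[p] E a ∈ Algebra.adjoin ℤ_[p] {Algebra.lmul ℚ_[p] E b} := by
  rw [Algebra.adjoin_singleton_eq_range_aeval] at hab ⊢
  obtain ⟨f, rfl⟩ := hab
  exact ⟨f, aeval_lmul b f⟩

theorem latticeEnd_actionMatrix {x : E} (M : latticeModules (p := p) x)
    [(M : Submodule ℤ_[p] E).IsLattice ℚ_[p]] {r : ℕ}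
    (b : Module.Basis (Fin r) ℤ_[p] (M : Submodule ℤ_[p] E)) :
    latticeEnd b (actionMatrix M b) = Algebra.lmul ℚ_[p] E x := by
  refine (b.extendOfIsLattice ℚ_[p]).ext fun j => ?_
  rw [Module.Basis.extendOfIsLattice_apply, latticeEnd_apply_basis]
  have := congrArg Subtype.val (b.sum_repr (((LinearMap.mulLeft ℤ_[p] x).restrict
    (fun m hm => M.2.1 x (Algebra.self_mem_adjoin_singleton _ x) m hm)) (b j)))
  simp only [AddSubmonoidClass.coe_finsetSum, Submodule.coe_smul] at this
  refine Eq.trans ?_ this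
  refine Finset.sum_congr rfl fun i _ => ?_
  rw [actionMatrix, LinearMap.toMatrix_apply]

/-- An endomorphism that commutes with a generator is a multiplication. -/
theorem eq_lmul_of_commute {x : E} (hx : Algebra.adjoin ℚ_[p] {x} = ⊤) {T : Module.End ℚ_[p] E}
    (hT : T * Algebra.lmul ℚ_[p] E x = Algebra.lmul ℚ_[p] E x * T) :
    T = Algebra.lmul ℚ_[p] E (T 1) := by
  have key : ∀ a : E, T * Algebra.lmul ℚ_[p] E a = Algebra.lmul ℚ_[p] E a * T := by
    intro a
    have ha : a ∈ Algebra.adjoin ℚ_[p] {x} := hx ▸ Algebra.mem_top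
    induction ha using Algebra.adjoin_induction with
    | mem a ha => rw [Set.mem_singleton_iff.1 ha]; exact hT
    | algebraMap c => rw [AlgHom.commutes]; exact (Algebra.commutes c T).symm
    | add a b _ _ ha hb => rw [map_add, mul_add, add_mul, ha, hb]
    | mul a b _ _ ha hb => rw [map_mul, ← mul_assoc, ha, mul_assoc, hb, mul_assoc]
  ext a
  have := congrArg (fun S : Module.End ℚ_[p] E => S 1) (key a)
  simp only [Module.End.mul_apply, lmul_apply_apply, mul_one] at this
  rw [this, lmul_apply_apply, mul_comm]

/-- The `ℤ_[p]`-module `ℤ_[p][x]`. -/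
noncomputable abbrev order (p : ℕ) [Fact p.Prime] {E : Type*} [CommRing E] [Algebra ℤ_[p] E] (x : E) :
    Submodule ℤ_[p] E :=
  Subalgebra.toSubmodule (Algebra.adjoin ℤ_[p] {x})

variable {x : E} {Z : ℤ_[p][X]} {r : ℕ}

theorem order_eq_span (hx : aeval x Z = 0) (hZ : Z.Monic) (hr : Z.natDegree = r) :
    order p x = Submodule.span ℤ_[p] (Set.range fun k : Fin r => x ^ (k : ℕ)) := by
  refine le_antisymm ?_ (Submodule.span_le.2 ?_)
  · intro a ha
    obtain ⟨f, rfl⟩ : ∃ f : ℤ_[p][X], aeval x f = a := by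
      have : a ∈ Algebra.adjoin ℤ_[p] {x} := ha
      rwa [Algebra.adjoin_singleton_eq_range_aeval] at this
    rw [← modByMonic_add_div f Z, map_add, map_mul, hx, zero_mul, add_zero]
    nontriviality E
    rcases eq_or_ne Z 1 with rfl | h1
    · rw [modByMonic_one, map_zero]; exact zero_mem _
    · rw [aeval_eq_sum_range' (lt_of_lt_of_eq (natDegree_modByMonic_lt f hZ h1) hr)]
      refine Submodule.sum_mem _ fun k hk => Submodule.smul_mem _ _ (Submodule.subset_span ?_)
      exact ⟨⟨k, Finset.mem_range.1 hk⟩, rfl⟩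
  · rintro _ ⟨k, rfl⟩
    exact (Algebra.adjoin ℤ_[p] {x}).pow_mem (Algebra.self_mem_adjoin_singleton _ x) k

theorem mem_stab_order_iff (hx : aeval x Z = 0) (hZ : Z.Monic) (hr : Z.natDegree = r)
    (w : Module.End ℚ_[p] E) : w ∈ stab (order p x) ↔ ∀ k < r, w (x ^ k) ∈ order p x := by
  constructor
  · intro h k _
    exact h _ ((Algebra.adjoin ℤ_[p] {x}).pow_mem (Algebra.self_mem_adjoin_singleton _ x) k)
  · intro h m hm
    rw [order_eq_span hx hZ hr] at hm
    induction hm using Submodule.span_induction with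
    | mem m hm => obtain ⟨k, rfl⟩ := hm; exact h k k.2
    | zero => rw [map_zero]; exact zero_mem _
    | add a b _ _ ha hb => rw [map_add]; exact add_mem ha hb
    | smul c a _ ha =>
      rw [← IsScalarTower.algebraMap_smul ℚ_[p], map_smul, IsScalarTower.algebraMap_smul]
      exact Submodule.smul_mem _ c ha

theorem order_isLattice (hx : aeval x Z = 0) (hZ : Z.Monic) (hr : Z.natDegree = r)
    (bE : Module.Basis (Fin r) ℚ_[p] E) (hb : ∀ k, bE k = x ^ (k : ℕ)) :
    (order p x).IsLattice ℚ_[p] where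
  fg := by
    rw [order_eq_span hx hZ hr]
    exact Submodule.fg_span (Set.finite_range _)
  span_eq_top := by
    rw [eq_top_iff, ← bE.span_eq]
    refine Submodule.span_mono ?_
    rintro _ ⟨k, rfl⟩
    rw [hb]
    exact (Algebra.adjoin ℤ_[p] {x}).pow_mem (Algebra.self_mem_adjoin_singleton _ x) k

theorem p_mem_jacobson : (p : ℤ_[p]) ∈ (⊥ : Ideal ℤ_[p]).jacobson := by
  rw [IsLocalRing.jacobson_eq_maximalIdeal _ bot_ne_top, PadicInt.maximalIdeal_eq_span_p]
  exact Ideal.mem_span_singleton_self _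

/-- The endomorphisms preserving `ℤ_[p][x]` that are the sum of a commutator with `x` and a
multiplication. -/
noncomputable def commSum (x : E) (Z : ℤ_[p][X]) : AddSubgroup (Module.End ℚ_[p] E) :=
  (stab (order p x)).toSubmodule.toAddSubgroup ⊓
    (((order p x).toAddSubgroup.map (AddMonoidHom.mulLeft (aeval x (derivative Z)))).comap
      (evalQuot ℚ_[p] x Z).toAddMonoidHom)

theorem mem_commSum {w : Module.End ℚ_[p] E} : w ∈ commSum x Z ↔
    w ∈ stab (order p x) ∧ ∃ e ∈ order p x, aeval x (derivative Z) * e = evalQuot ℚ_[p] x Z w :=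
  Iff.rfl

theorem evalQuot_mem_order (hx : aeval x Z = 0) {w : Module.End ℚ_[p] E}
    (hw : w ∈ stab (order p x)) : evalQuot ℚ_[p] x Z w ∈ order p x := by
  rw [evalQuot_apply]
  refine Submodule.sum_mem _ fun k _ => ?_
  exact (Algebra.adjoin ℤ_[p] {x}).mul_mem (quotCoeff_mem_adjoin hx k)
    (hw _ ((Algebra.adjoin ℤ_[p] {x}).pow_mem (Algebra.self_mem_adjoin_singleton _ x) k))

/-- `evalQuot` maps `End(R)` onto `R`, and `commSum` is the part of `End(R)` lying over `Z'(x) R`.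
-/
theorem relIndex_commSum (hx : aeval x Z = 0) (hZ : Z.Monic) (hr : Z.natDegree = r)
    (bE : Module.Basis (Fin r) ℚ_[p] E) (hb : ∀ k, bE k = x ^ (k : ℕ)) :
    (commSum x Z).relIndex (stab (order p x)).toSubmodule.toAddSubgroup =
      ((order p x).toAddSubgroup.map (AddMonoidHom.mulLeft (aeval x (derivative Z)))).relIndex
        (order p x).toAddSubgroup := by
  rw [commSum, AddSubgroup.inf_relIndex_left, AddSubgroup.relIndex_comap]
  congr 1
  ext e
  constructor
  · rintro ⟨w, hw, rfl⟩
    exact evalQuot_mem_order hx hw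
  · intro he
    obtain ⟨w, hw, h⟩ := exists_evalQuot_eq hx hZ hr bE hb (order p x).toAddSubgroup he
    exact ⟨w, (mem_stab_order_iff hx hZ hr w).2 hw, h⟩

/-- For `y = x` this is the description of the kernel of `evalQuot`. By Nakayama `ℤ_p[x] = ℤ_p[y]`,
so commutators with `x` and with `y` coincide, and every point `y` of the ball around `x` gives the
same lattice. -/
theorem mem_commSum_iff (hx : aeval x Z = 0) (hZ : Z.Monic) (hr : Z.natDegree = r)
    (bE : Module.Basis (Fin r) ℚ_[p] E) (hb : ∀ k, bE k = x ^ (k : ℕ)) {y z : E}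
    (hz : z ∈ order p x) (hy : y = x + (p : ℤ_[p]) • z) {w : Module.End ℚ_[p] E} :
    w ∈ commSum x Z ↔ ∃ u ∈ stab (order p x), ∃ e ∈ order p x,
      w = (u * Algebra.lmul ℚ_[p] E y - Algebra.lmul ℚ_[p] E y * u) + Algebra.lmul ℚ_[p] E e := by
  have hxR : x ∈ order p x := Algebra.self_mem_adjoin_singleton _ x
  have hyR : y ∈ order p x := hy ▸ add_mem hxR (Submodule.smul_mem _ _ hz)
  have hR : ∀ a ∈ order p x, Algebra.lmul ℚ_[p] E a ∈ stab (order p x) := fun a ha =>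
    lmul_mem_stab fun m hm => (Algebra.adjoin ℤ_[p] {x}).mul_mem ha hm
  have hxy : x ∈ Algebra.adjoin ℤ_[p] {y} :=
    mem_adjoin_of_sub_mem_smul p_mem_jacobson (order_isLattice hx hZ hr bE hb).fg hz hy
  rw [mem_commSum]
  constructor
  · rintro ⟨hw, e, he, h⟩
    have h0 : evalQuot ℚ_[p] x Z (w - Algebra.lmul ℚ_[p] E e) = 0 := by
      rw [map_sub, evalQuot_lmul hx, h, sub_self]
    obtain ⟨u, hu, h1⟩ := exists_commutator_of_evalQuot_eq_zero hx hZ hr bE hb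
      (L := (order p x).toAddSubgroup)
      (fun a ha => (Algebra.adjoin ℤ_[p] {x}).mul_mem hxR ha)
      ((mem_stab_order_iff hx hZ hr _).1 (sub_mem hw (hR e he))) h0
    obtain ⟨u', hu', h2⟩ := exists_commutator_of_mem_adjoin (stab (order p x)) (hR y hyR)
      (lmul_mem_adjoin hxy) u ((mem_stab_order_iff hx hZ hr u).2 hu)
    exact ⟨u', hu', e, he, by rw [← h2, ← h1, sub_add_cancel]⟩
  · rintro ⟨u, hu, e, he, rfl⟩
    obtain ⟨u', hu', h2⟩ := exists_commutator_of_mem_adjoin (stab (order p x)) (hR x hxR)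
      (lmul_mem_adjoin hyR) u hu
    refine ⟨add_mem (sub_mem (mul_mem hu (hR y hyR)) (mul_mem (hR y hyR) hu)) (hR e he), e, he, ?_⟩
    rw [map_add, h2, evalQuot_commutator hx, evalQuot_lmul hx, zero_add]

/-- The multiples by `p ^ N` of the endomorphisms preserving `ℤ_[p][x]`. -/
noncomputable def powStab (p : ℕ) [Fact p.Prime] {E : Type*} [CommRing E] [Algebra ℚ_[p] E] [Algebra ℤ_[p] E]
    [IsScalarTower ℤ_[p] ℚ_[p] E] (x : E) (N : ℕ) : AddSubgroup (Module.End ℚ_[p] E) :=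
  (stab (order p x)).toSubmodule.toAddSubgroup.map
    (DistribSMul.toAddMonoidHom _ ((p : ℤ_[p]) ^ N))

theorem powStab_mul_mem {N : ℕ} : ∀ a ∈ powStab p x N, ∀ b ∈ powStab p x N,
    a * b ∈ powStab p x N := by
  rintro _ ⟨u, hu, rfl⟩ _ ⟨v, hv, rfl⟩
  refine ⟨u * (p : ℤ_[p]) ^ N • v, (stab (order p x)).mul_mem hu ((stab (order p x)).smul_mem hv _), ?_⟩
  exact (smul_mul_assoc _ _ _).symm

theorem isUnit_one_add_stab {L : Submodule ℤ_[p] E} [L.IsLattice ℚ_[p]]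
    {u : Module.End ℚ_[p] E} (hu : u ∈ stab L) : ∃ t : (Module.End ℚ_[p] E)ˣ,
      (t : Module.End ℚ_[p] E) = 1 + (p : ℤ_[p]) • u ∧
      ((t⁻¹ : (Module.End ℚ_[p] E)ˣ) : Module.End ℚ_[p] E) ∈ stab L := by
  have := Module.IsTorsionFree.trans_faithfulSMul ℤ_[p] ℚ_[p] E
  let b := Module.finBasis ℤ_[p] L
  obtain ⟨A, rfl⟩ := (mem_stab_iff_range b u).1 hu
  obtain ⟨s, hs⟩ := isUnit_one_add_smul_matrix A
  refine ⟨Units.map (latticeEnd b : _ →* Module.End ℚ_[p] E) s, ?_, ?_⟩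
  · rw [Units.coe_map, hs]
    simp [map_add, map_one, map_smul]
  · exact (mem_stab_iff_range b _).2 ⟨_, rfl⟩

end Stabilizer

/-! ### Tubes around points close to `x` -/

section Tube

open Polynomial

variable {p : ℕ} [Fact p.Prime] {E : Type*} [CommRing E] [Algebra ℚ_[p] E] [Algebra ℤ_[p] E]
  [IsScalarTower ℤ_[p] ℚ_[p] E] {x : E} {Z : ℤ_[p][X]} {r : ℕ}

/-- The conjugates of a small ball around `y` in `ℤ_[p][x]` form a translate of a lattice. -/
theorem conj_ball_eq (hgen : Algebra.adjoin ℚ_[p] {x} = ⊤) (hx : aeval x Z = 0) (hZ : Z.Monic)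
    (hr : Z.natDegree = r) (bE : Module.Basis (Fin r) ℚ_[p] E) (hb : ∀ k, bE k = x ^ (k : ℕ))
    {c N : ℕ} (hc : ∀ e ∈ order p x, ∃ e' ∈ order p x,
      aeval x (derivative Z) * e' = (p : ℤ_[p]) ^ c • e) (hN : c < N) {y z : E}
    (hz : z ∈ order p x) (hy : y = x + (p : ℤ_[p]) • z) (B : Module.End ℚ_[p] E) :
    (∃ w ∈ commSum x Z, B = Algebra.lmul ℚ_[p] E y + (p : ℤ_[p]) ^ N • w) ↔
      ∃ t ∈ onePlus (powStab p x N) powStab_mul_mem, ∃ z' ∈ order p x,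
        B = (t : Module.End ℚ_[p] E) * Algebra.lmul ℚ_[p] E (y + (p : ℤ_[p]) ^ N • z') *
          ((t⁻¹ : (Module.End ℚ_[p] E)ˣ) : Module.End ℚ_[p] E) := by
  have := Module.IsTorsionFree.trans_faithfulSMul ℤ_[p] ℚ_[p] E
  have : (order p x).IsLattice ℚ_[p] := order_isLattice hx hZ hr bE hb
  obtain ⟨n, ⟨b⟩⟩ : ∃ n, Nonempty (Module.Basis (Fin n) ℤ_[p] (order p x)) :=
    ⟨_, ⟨Module.finBasis ℤ_[p] (order p x)⟩⟩
  let Φ := latticeEnd b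
  have hΦ : Function.Injective Φ := latticeEnd_injective b
  have hstab : ∀ T, T ∈ stab (order p x) ↔ ∃ A, Φ A = T := mem_stab_iff_range b
  let ρ : E →ₗ[ℤ_[p]] Module.End ℚ_[p] E :=
    ((Algebra.lmul ℚ_[p] E).restrictScalars ℤ_[p]).toLinearMap
  have hρ : ∀ a ∈ order p x, ρ a ∈ stab (order p x) := fun a ha =>
    lmul_mem_stab fun m hm => (Algebra.adjoin ℤ_[p] {x}).mul_mem ha hm
  have hxR : x ∈ order p x := Algebra.self_mem_adjoin_singleton _ x
  have h1R : (1 : E) ∈ order p x := (Algebra.adjoin ℤ_[p] {x}).one_mem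
  have hyR : y ∈ order p x := hy ▸ add_mem hxR (Submodule.smul_mem _ _ hz)
  have hxy : x ∈ Algebra.adjoin ℤ_[p] {y} :=
    mem_adjoin_of_sub_mem_smul p_mem_jacobson (order_isLattice hx hZ hr bE hb).fg hz hy
  obtain ⟨C, hC⟩ := (hstab _).1 (hρ x hxR)
  obtain ⟨y₀, hy₀⟩ := (hstab _).1 (hρ y hyR)
  let R' : Submodule ℤ_[p] (Matrix (Fin n) (Fin n) ℤ_[p]) := ((order p x).map ρ).comap Φ.toLinearMap
  have hR' : ∀ X, X ∈ R' ↔ ∃ e ∈ order p x, ρ e = Φ X := fun X => Iff.rfl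
  -- The image of `ℤ_p[x]` is the full centralizer of `x` in `End(ℤ_p[x])`, since a commuting `X` is
  -- multiplication by `X 1`. In particular it is closed.
  have hR'c : ∀ X, X ∈ R' ↔ X * C = C * X := by
    intro X
    rw [hR']
    constructor
    · rintro ⟨e, -, he⟩
      apply hΦ
      rw [map_mul, map_mul, ← he, hC]
      change Algebra.lmul ℚ_[p] E e * Algebra.lmul ℚ_[p] E x =
        Algebra.lmul ℚ_[p] E x * Algebra.lmul ℚ_[p] E e
      rw [← map_mul, ← map_mul, mul_comm]
    · intro h
      have h1 := congrArg Φ h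
      rw [map_mul, map_mul, hC] at h1
      exact ⟨Φ X 1, (hstab _).2 ⟨X, rfl⟩ 1 h1R, (eq_lmul_of_commute hgen h1).symm⟩
  have hcomp : CompactSpace (Matrix (Fin n) (Fin n) ℤ_[p]) :=
    inferInstanceAs (CompactSpace (Fin _ → Fin _ → ℤ_[p]))
  have hclosed : IsClosed (R' : Set (Matrix (Fin n) (Fin n) ℤ_[p])) := by
    have : (R' : Set (Matrix (Fin n) (Fin n) ℤ_[p])) = {X | X * C = C * X} := Set.ext hR'c
    rw [this]
    exact isClosed_eq (by fun_prop) (by fun_prop)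
  have hball : ∀ z' ∈ R', ∃ e ∈ order p x, ρ e = Φ z' ∧
      Φ (y₀ + (p : ℤ_[p]) ^ N • z') = Algebra.lmul ℚ_[p] E (y + (p : ℤ_[p]) ^ N • e) ∧
      ∃ e' ∈ order p x, y + (p : ℤ_[p]) ^ N • e = x + (p : ℤ_[p]) • e' := by
    intro z' hz'
    obtain ⟨e, he, h⟩ := (hR' z').1 hz'
    refine ⟨e, he, h, ?_, z + (p : ℤ_[p]) ^ (N - 1) • e, add_mem hz (Submodule.smul_mem _ _ he), ?_⟩
    · rw [map_add, map_smul, hy₀, ← h, ← map_smul, ← map_add]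
      rfl
    · rw [hy, smul_add, smul_smul, ← pow_succ', Nat.sub_add_cancel (by omega), add_assoc]
  -- The tube lemma applies because `p ^ c End(R)` lies in `commSum` (its `evalQuot` values lie in
  -- `Z'(x) R` by `hc`), and because every point of the ball generates the same order as `y`.
  have htube := tube_eq (p : ℤ_[p]) (R := R') (c := c) (N := N) (y₀ := y₀)
    (fun U hU => pow_smul_matrix_tendsto U hU) hclosed hN isUnit_one_add_smul_matrix
    (by
      intro z' hz' e
      obtain ⟨e₁, he₁, h₁, h₂, e₂, he₂, h₃⟩ := hball z' hz'
      have hw : Φ ((p : ℤ_[p]) ^ c • e) ∈ commSum x Z := by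
        have h4 : Φ e ∈ stab (order p x) := (hstab _).2 ⟨e, rfl⟩
        obtain ⟨e', he', h5⟩ := hc _ (evalQuot_mem_order hx h4)
        refine mem_commSum.2 ⟨(hstab _).2 ⟨_, rfl⟩, e', he', ?_⟩
        rw [h5, map_smul, ← IsScalarTower.algebraMap_smul ℚ_[p], ← map_smul,
          IsScalarTower.algebraMap_smul]
      obtain ⟨u, hu, e', he', h⟩ := (mem_commSum_iff hx hZ hr bE hb he₂ h₃).1 hw
      obtain ⟨u₀, rfl⟩ := (hstab u).1 hu
      obtain ⟨z₀, hz₀⟩ := (hstab _).1 (hρ e' he')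
      refine ⟨u₀, z₀, (hR' _).2 ⟨e', he', hz₀.symm⟩, hΦ ?_⟩
      rw [h, ← h₂, show Algebra.lmul ℚ_[p] E e' = Φ z₀ from hz₀.symm, map_add Φ (_ - _), map_sub,
        map_mul, map_mul])
    (by
      intro z' hz' u
      obtain ⟨e₁, he₁, h₁, h₂, e₂, he₂, h₃⟩ := hball z' hz'
      have hmem : y + (p : ℤ_[p]) ^ N • e₁ ∈ Algebra.adjoin ℤ_[p] {y} :=
        Algebra.adjoin_le (Set.singleton_subset_iff.2 hxy)
          (add_mem hyR (Submodule.smul_mem _ _ he₁))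
      obtain ⟨u', hu', h⟩ := exists_commutator_of_mem_adjoin (stab (order p x)) (hρ y hyR)
        (lmul_mem_adjoin hmem) (Φ u) ((hstab _).2 ⟨u, rfl⟩)
      obtain ⟨v, rfl⟩ := (hstab u').1 hu'
      refine ⟨v, hΦ ?_⟩
      rw [map_sub, map_sub, map_mul, map_mul, map_mul, map_mul, h₂, hy₀]
      exact h)
  constructor
  · rintro ⟨w, hw, rfl⟩
    obtain ⟨u, hu, e, he, rfl⟩ := (mem_commSum_iff hx hZ hr bE hb hz hy).1 hw
    obtain ⟨u₀, rfl⟩ := (hstab u).1 hu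
    obtain ⟨z₀, hz₀⟩ := (hstab _).1 (hρ e he)
    obtain ⟨t, v, ht, z', hz', h⟩ := (htube _).1 ⟨u₀, z₀, (hR' _).2 ⟨e, he, hz₀.symm⟩, rfl⟩
    obtain ⟨e₁, he₁, h₁, h₂, -⟩ := hball z' hz'
    refine ⟨Units.map (Φ : _ →* Module.End ℚ_[p] E) t, ⟨?_, ?_⟩, e₁, he₁, ?_⟩
    · refine ⟨Φ v, (hstab _).2 ⟨v, rfl⟩, ?_⟩
      change (p : ℤ_[p]) ^ N • Φ v = Φ t - 1
      rw [ht, map_add, map_one, add_sub_cancel_left, map_smul]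
    · refine ⟨Φ (-(v * ((t⁻¹ : (Matrix (Fin n) (Fin n) ℤ_[p])ˣ) : Matrix (Fin n) (Fin n) ℤ_[p]))), (hstab _).2 ⟨_, rfl⟩, ?_⟩
      change (p : ℤ_[p]) ^ N • Φ _ = Φ ((t⁻¹ : (Matrix (Fin n) (Fin n) ℤ_[p])ˣ) : Matrix (Fin n) (Fin n) ℤ_[p]) - 1
      rw [← map_one Φ, ← map_sub, ← map_smul, smul_neg, ← smul_mul_assoc,
        ← add_sub_cancel_left (1 : Matrix (Fin n) (Fin n) ℤ_[p]) ((p : ℤ_[p]) ^ N • v), ← ht, sub_mul,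
        Units.mul_inv, one_mul, neg_sub]
    · have h' := congrArg Φ h
      rw [map_mul, map_mul, h₂] at h'
      rw [← hz₀.trans (show ρ e = Algebra.lmul ℚ_[p] E e from rfl)]
      refine Eq.trans ?_ h'
      rw [map_add, map_smul, map_add, map_sub, map_mul, map_mul, hy₀]
      rfl
  · rintro ⟨t, ⟨⟨u, hu, h1⟩, ⟨u', hu', h1'⟩⟩, e, he, rfl⟩
    obtain ⟨v, rfl⟩ := (hstab u).1 hu
    obtain ⟨v', rfl⟩ := (hstab u').1 hu'
    obtain ⟨z₀, hz₀⟩ := (hstab _).1 (hρ e he)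
    have e1 : Φ (1 + (p : ℤ_[p]) ^ N • v) = t := by
      rw [map_add, map_one, map_smul]
      exact (add_comm _ _).trans (sub_eq_iff_eq_add.1 h1.symm).symm
    have e2 : Φ (1 + (p : ℤ_[p]) ^ N • v') = ((t⁻¹ : (Module.End ℚ_[p] E)ˣ) : Module.End ℚ_[p] E) := by
      rw [map_add, map_one, map_smul]
      exact (add_comm _ _).trans (sub_eq_iff_eq_add.1 h1'.symm).symm
    let t₀ : (Matrix (Fin n) (Fin n) ℤ_[p])ˣ :=
      ⟨1 + (p : ℤ_[p]) ^ N • v, 1 + (p : ℤ_[p]) ^ N • v',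
        hΦ (by rw [map_mul, e1, e2, Units.mul_inv, map_one]),
        hΦ (by rw [map_mul, e1, e2, Units.inv_mul, map_one])⟩
    have hz₀' : z₀ ∈ R' := (hR' _).2 ⟨e, he, hz₀.symm⟩
    obtain ⟨u₁, z₁, hz₁, h⟩ := (htube _).2 ⟨t₀, v, rfl, z₀, hz₀', rfl⟩
    obtain ⟨e₁, he₁, h₁⟩ := (hR' _).1 hz₁
    refine ⟨Φ (u₁ * y₀ - y₀ * u₁ + z₁), (mem_commSum_iff hx hZ hr bE hb hz hy).2
      ⟨Φ u₁, (hstab _).2 ⟨_, rfl⟩, e₁, he₁, ?_⟩, ?_⟩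
    · rw [map_add, map_sub, map_mul, map_mul, hy₀, ← h₁]; rfl
    · have h' := congrArg Φ h
      rw [map_mul, map_mul] at h'
      change Φ (1 + (p : ℤ_[p]) ^ N • v) * _ * Φ (1 + (p : ℤ_[p]) ^ N • v') = _ at h'
      rw [e1, e2, map_add, map_add, map_smul, map_smul, hy₀, hz₀, ← map_smul, ← map_add] at h'
      exact h'

end Tube

/-! ### Invariance of Haar measure and the index of congruence subgroups -/

section OrbitMeasure

open Polynomial MeasureTheory

variable {p : ℕ} [Fact p.Prime] {E : Type*} [CommRing E] [Algebra ℚ_[p] E] [Algebra ℤ_[p] E]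
  [IsScalarTower ℤ_[p] ℚ_[p] E] {x : E} {Z : ℤ_[p][X]} {r : ℕ}

theorem measurePreserving_conj [MeasurableSpace (Matrix (Fin r) (Fin r) ℤ_[p])]
    [BorelSpace (Matrix (Fin r) (Fin r) ℤ_[p])] (P : Measure (Matrix (Fin r) (Fin r) ℤ_[p]))
    [P.IsAddHaarMeasure] (g : GL (Fin r) ℤ_[p]) :
    MeasurePreserving (fun B => (g : Matrix (Fin r) (Fin r) ℤ_[p]) * B *
      ((g⁻¹ : GL (Fin r) ℤ_[p]) : Matrix (Fin r) (Fin r) ℤ_[p])) P P := by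
  have : CompactSpace (Matrix (Fin r) (Fin r) ℤ_[p]) :=
    inferInstanceAs (CompactSpace (Fin r → Fin r → ℤ_[p]))
  let f : Matrix (Fin r) (Fin r) ℤ_[p] →+ Matrix (Fin r) (Fin r) ℤ_[p] :=
    (AddMonoidHom.mulRight ((g⁻¹ : GL (Fin r) ℤ_[p]) : Matrix (Fin r) (Fin r) ℤ_[p])).comp
      (AddMonoidHom.mulLeft (g : Matrix (Fin r) (Fin r) ℤ_[p]))
  have hf : Continuous f := by
    change Continuous fun B => (g : Matrix (Fin r) (Fin r) ℤ_[p]) * B *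
      ((g⁻¹ : GL (Fin r) ℤ_[p]) : Matrix (Fin r) (Fin r) ℤ_[p])
    fun_prop
  have hs : Function.Surjective f := by
    intro B
    refine ⟨((g⁻¹ : GL (Fin r) ℤ_[p]) : Matrix (Fin r) (Fin r) ℤ_[p]) * B * g, ?_⟩
    change (g : Matrix (Fin r) (Fin r) ℤ_[p]) * (_ * B * g) * _ = B
    rw [mul_assoc _ B, Units.mul_inv_cancel_left, mul_assoc, Units.mul_inv, mul_one]
  exact f.measurePreserving hf hs rfl

theorem relIndex_smul_ne_zero (L : Submodule ℤ_[p] E) (hL : L.FG) (n : ℕ) :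
    (L.toAddSubgroup.map (DistribSMul.toAddMonoidHom E ((p : ℤ_[p]) ^ n))).relIndex
      L.toAddSubgroup ≠ 0 := by
  obtain ⟨k, f, rfl⟩ := (Submodule.fg_iff_exists_fin_linearMap ℤ_[p] E).1 hL
  have : NeZero (p ^ n) := ⟨pow_ne_zero _ (Fact.out : p.Prime).ne_zero⟩
  let φ : (Fin k → ℤ_[p]) →+ (Fin k → ZMod (p ^ n)) :=
    (PadicInt.toZModPow (p := p) n).toAddMonoidHom.compLeft (Fin k)
  have hφ : φ.ker.index ≠ 0 := by
    rw [AddSubgroup.index_ker]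
    exact Nat.card_pos.ne'
  have h1 : (LinearMap.range f).toAddSubgroup = f.toAddMonoidHom.range := rfl
  have h2 : ((LinearMap.range f).toAddSubgroup.map
      (DistribSMul.toAddMonoidHom E ((p : ℤ_[p]) ^ n))).relIndex (LinearMap.range f).toAddSubgroup =
      (((LinearMap.range f).toAddSubgroup.map
      (DistribSMul.toAddMonoidHom E ((p : ℤ_[p]) ^ n))).comap f.toAddMonoidHom).index := by
    rw [AddSubgroup.index_comap, h1]
  rw [h2]
  have hle : φ.ker ≤ ((LinearMap.range f).toAddSubgroup.map
      (DistribSMul.toAddMonoidHom E ((p : ℤ_[p]) ^ n))).comap f.toAddMonoidHom := by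
    intro v hv
    have h3 : ∀ i, ∃ c, v i = (p : ℤ_[p]) ^ n * c := fun i => by
      have : PadicInt.toZModPow n (v i) = 0 := congrFun hv i
      rw [← RingHom.mem_ker, PadicInt.ker_toZModPow] at this
      exact Ideal.mem_span_singleton.1 this
    choose w hw using h3
    refine ⟨f w, ⟨w, rfl⟩, ?_⟩
    change (p : ℤ_[p]) ^ n • f w = f v
    rw [← map_smul]
    congr 1
    ext i
    rw [Pi.smul_apply, smul_eq_mul, hw]
  exact fun h0 => hφ (by rw [← AddSubgroup.relIndex_mul_index hle, h0, mul_zero])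

/-- The action of invertible matrices on `E` given by a basis of a lattice. -/
noncomputable def latticeUnits {M : Submodule ℤ_[p] E} [M.IsLattice ℚ_[p]]
    (b : Module.Basis (Fin r) ℤ_[p] M) : GL (Fin r) ℤ_[p] →* (Module.End ℚ_[p] E)ˣ :=
  Units.map (latticeEnd b).toRingHom.toMonoidHom

/-- The preimage `J` of `p ^ N End(R)` lies in `p Mat_r(ℤ_p)`. Hence `1 + J` has index `|GL_r(𝔽_p)|
[p Mat_r(ℤ_p) : J]`, whereas `J` has index `|Mat_r(𝔽_p)| [p Mat_r(ℤ_p) : J]`; the ratio of the two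
is the product. -/
theorem index_comap_onePlus_powStab {M : Submodule ℤ_[p] E} [M.IsLattice ℚ_[p]]
    (b : Module.Basis (Fin r) ℤ_[p] M) {N m : ℕ} [(order p x).IsLattice ℚ_[p]] (hN : 0 < N)
    (hNM : ∀ u ∈ stab (order p x), ∃ v ∈ stab M, (p : ℤ_[p]) ^ N • u = (p : ℤ_[p]) • v)
    (hm : ∀ v ∈ stab M, (p : ℤ_[p]) ^ m • v ∈ stab (order p x)) :
    ((onePlus (powStab p x N) powStab_mul_mem).comap
      (latticeUnits b)).index ≠ 0 ∧
    (((onePlus (powStab p x N) powStab_mul_mem).comap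
      (latticeUnits b)).index : ℝ) =
      (∏ j ∈ Finset.Icc 1 r, (1 - ((p : ℝ) ^ j)⁻¹)) *
        ((powStab p x N).comap (latticeEnd b).toRingHom.toAddMonoidHom).index := by
  let Φ := latticeEnd b
  have hΦ : Function.Injective Φ := latticeEnd_injective b
  set J : AddSubgroup (Matrix (Fin r) (Fin r) ℤ_[p]) :=
    (powStab p x N).comap (latticeEnd b).toRingHom.toAddMonoidHom with hJdef
  have hJmem : ∀ a, a ∈ J ↔ ∃ u ∈ stab (order p x), (p : ℤ_[p]) ^ N • u = Φ a := fun a => Iff.rfl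
  have hJ : ∀ a ∈ J, ∀ b ∈ J, a * b ∈ J := fun a ha b hb => by
    change Φ (a * b) ∈ powStab p x N
    rw [map_mul]
    exact powStab_mul_mem _ ha _ hb
  obtain ⟨I, hI, hIfin, -, hImem⟩ := exists_ideal_matrix (p := p) (r := r) (N + m)
  have hIJ : I ≤ J := by
    intro a ha
    obtain ⟨u, rfl⟩ := (hImem a).1 ha
    refine (hJmem _).2 ⟨(p : ℤ_[p]) ^ m • Φ u, hm _ ((mem_stab_iff_range b _).2 ⟨u, rfl⟩), ?_⟩
    rw [map_smul, smul_smul, pow_add]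
  have hJp : ∀ a ∈ J, ∃ u, a = (p : ℤ_[p]) • u := by
    intro a ha
    obtain ⟨u, hu, h⟩ := (hJmem a).1 ha
    obtain ⟨v, hv, h'⟩ := hNM u hu
    obtain ⟨v, rfl⟩ := (mem_stab_iff_range b _).1 hv
    exact ⟨v, hΦ (by rw [← h, h', map_smul])⟩
  let q := (PadicInt.toZMod (p := p)).mapMatrix (m := Fin r)
  have hq : Function.Surjective q := by
    intro B
    choose f hf using fun i j => ZMod.ringHom_surjective (PadicInt.toZMod (p := p)) (B i j)
    exact ⟨Matrix.of f, by ext i j; exact hf i j⟩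
  have hJq : ∀ a ∈ J, q a = 0 := fun a ha => (map_toZMod_eq_zero_iff a).2 (hJp a ha)
  have hunit : ∀ a ∈ J, ∃ u ∈ onePlus J hJ, (u : Matrix (Fin r) (Fin r) ℤ_[p]) = 1 + a := by
    intro a ha
    obtain ⟨v, rfl⟩ := hJp a ha
    obtain ⟨s, hs⟩ := isUnit_one_add_smul_matrix v
    refine ⟨s, ⟨by rw [hs, add_sub_cancel_left]; exact ha, ?_⟩, hs⟩
    obtain ⟨u, hu, h⟩ := (hJmem _).1 ha
    obtain ⟨t, ht, ht'⟩ := isUnit_one_add_stab ((stab (order p x)).smul_mem hu ((p : ℤ_[p]) ^ (N - 1)))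
    rw [smul_smul, ← pow_succ', Nat.sub_add_cancel hN] at ht
    have hst : latticeUnits b s = t := by
      ext1
      rw [ht, h]
      change Φ s = _
      rw [hs, map_add, map_one]
    -- The inverse stays in the group because `(1 + p ^ N u)⁻¹ - 1 = -p ^ N u (1 + p ^ N u)⁻¹`, with
    -- the inverse again in `End(R)`.
    refine (hJmem _).2 ⟨-(u * ((t⁻¹ : (Module.End ℚ_[p] E)ˣ) : Module.End ℚ_[p] E)),
      neg_mem (mul_mem hu ht'), ?_⟩
    have e1 : Φ ((s⁻¹ : (Matrix (Fin r) (Fin r) ℤ_[p])ˣ) : Matrix (Fin r) (Fin r) ℤ_[p]) =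
        ((t⁻¹ : (Module.End ℚ_[p] E)ˣ) : Module.End ℚ_[p] E) := by
      rw [← hst]; rfl
    rw [map_sub, map_one, e1, smul_neg, ← smul_mul_assoc,
      ← add_sub_cancel_left (1 : Module.End ℚ_[p] E) ((p : ℤ_[p]) ^ N • u), ← ht, sub_mul,
      Units.mul_inv, one_mul, neg_sub]
  have hcomap : (onePlus (powStab p x N) powStab_mul_mem).comap
      (latticeUnits b) = onePlus J hJ := by
    ext u
    rw [Subgroup.mem_comap, mem_onePlus, mem_onePlus]
    have e1 : ∀ a, a - 1 ∈ J ↔ Φ a - 1 ∈ powStab p x N := fun a => by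
      rw [← map_one Φ, ← map_sub]; rfl
    rw [e1, e1]
    rfl
  have h1 := index_onePlus q hq hJ hI hIJ hJq hunit (fun h0 => hIfin (by
    rw [← AddSubgroup.relIndex_mul_index hIJ, h0, zero_mul]))
  have hle : J ≤ (q : Matrix (Fin r) (Fin r) ℤ_[p] →+ Matrix (Fin r) (Fin r) (ZMod p)).ker := hJq
  have h2 := AddSubgroup.relIndex_mul_index hle
  have hfinM : Finite (Matrix (Fin r) (Fin r) (ZMod p)) :=
    inferInstanceAs (Finite (Fin r → Fin r → ZMod p))
  have h3 : (q : Matrix (Fin r) (Fin r) ℤ_[p] →+ Matrix (Fin r) (Fin r) (ZMod p)).ker.index =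
      Nat.card (Matrix (Fin r) (Fin r) (ZMod p)) := by
    rw [AddSubgroup.index_ker, AddMonoidHom.range_eq_top.2 hq, AddSubgroup.card_top]
  rw [h3] at h2
  have h0 : (Nat.card (Matrix (Fin r) (Fin r) (ZMod p)) : ℝ) ≠ 0 := by
    exact_mod_cast Nat.card_pos.ne'
  have hJ0 : J.index ≠ 0 := fun h0 => hIfin (by
    rw [← AddSubgroup.relIndex_mul_index hIJ, h0, mul_zero])
  rw [hcomap, h1]
  constructor
  · refine mul_ne_zero Nat.card_pos.ne' fun h => hJ0 ?_
    rw [← h2, h, zero_mul]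
  · rw [← card_units_div_card_matrix, ← h2]
    push_cast
    field_simp

end OrbitMeasure

/-! ### The measure of the conjugation orbit -/

section OrbitMeasure

open Polynomial MeasureTheory

variable {p : ℕ} [Fact p.Prime] {E : Type*} [CommRing E] [Algebra ℚ_[p] E] [Algebra ℤ_[p] E]
  [IsScalarTower ℤ_[p] ℚ_[p] E] {x : E} {Z : ℤ_[p][X]} {r : ℕ}

theorem mem_autLattice {M : Submodule ℤ_[p] E} {T : (Module.End ℚ_[p] E)ˣ} :
    T ∈ autLattice x M ↔
      (T : Module.End ℚ_[p] E) * Algebra.lmul ℚ_[p] E x = Algebra.lmul ℚ_[p] E x * T ∧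
      (T : Module.End ℚ_[p] E) ∈ stab M ∧
      ((T⁻¹ : (Module.End ℚ_[p] E)ˣ) : Module.End ℚ_[p] E) ∈ stab M := by
  have h1 : ∀ y, (T : Module.End ℚ_[p] E) (((T⁻¹ : (Module.End ℚ_[p] E)ˣ) :
      Module.End ℚ_[p] E) y) = y := fun y => by
    rw [← Module.End.mul_apply, Units.mul_inv, Module.End.one_apply]
  have h2 : ∀ y, ((T⁻¹ : (Module.End ℚ_[p] E)ˣ) : Module.End ℚ_[p] E)
      ((T : Module.End ℚ_[p] E) y) = y := fun y => by
    rw [← Module.End.mul_apply, Units.inv_mul, Module.End.one_apply]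
  constructor
  · rintro ⟨h, h'⟩
    refine ⟨LinearMap.ext h, fun m hm => ?_, fun m hm => ?_⟩
    · have : (T : Module.End ℚ_[p] E) m ∈ (T : Module.End ℚ_[p] E) '' (M : Set E) := ⟨m, hm, rfl⟩
      rwa [h'] at this
    · rw [← SetLike.mem_coe, ← h'] at hm
      obtain ⟨m', hm', rfl⟩ := hm
      rw [h2]
      exact hm'
  · rintro ⟨h, h', h''⟩
    refine ⟨fun y => congrArg (fun S : Module.End ℚ_[p] E => S y) h, Set.Subset.antisymm ?_ ?_⟩
    · rintro _ ⟨m, hm, rfl⟩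
      exact h' m hm
    · exact fun m hm => ⟨_, h'' m hm, h1 m⟩

theorem mem_latticeUnits_range {M : Submodule ℤ_[p] E} [M.IsLattice ℚ_[p]]
    (b : Module.Basis (Fin r) ℤ_[p] M) {T : (Module.End ℚ_[p] E)ˣ}
    (h1 : (T : Module.End ℚ_[p] E) ∈ stab M)
    (h2 : ((T⁻¹ : (Module.End ℚ_[p] E)ˣ) : Module.End ℚ_[p] E) ∈ stab M) :
    ∃ t, latticeUnits b t = T := by
  obtain ⟨A, hA⟩ := (mem_stab_iff_range b _).1 h1
  obtain ⟨B, hB⟩ := (mem_stab_iff_range b _).1 h2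
  refine ⟨⟨A, B, latticeEnd_injective b ?_, latticeEnd_injective b ?_⟩, Units.ext hA⟩
  · rw [map_mul, hA, hB, Units.mul_inv, map_one]
  · rw [map_mul, hA, hB, Units.inv_mul, map_one]

/-- Orbit counting with `Γ = 1 + p ^ N End(R)` and one tube for each class of `L` modulo `p ^ N R`.
By `conj_ball_eq` every tube is a translate of `Λ = p ^ N commSum`, whose measure is the inverse of
its index. The hypothesis `huniq` says that the orbits of `x + L` meet it once and have stabilizer
in `A`. -/
theorem measure_conjOrbit (hgen : Algebra.adjoin ℚ_[p] {x} = ⊤) (hx : aeval x Z = 0) (hZ : Z.Monic)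
    (hr : Z.natDegree = r) (bE : Module.Basis (Fin r) ℚ_[p] E) (hb : ∀ k, bE k = x ^ (k : ℕ))
    {c N m : ℕ} (hc : ∀ e ∈ order p x, ∃ e' ∈ order p x,
      aeval x (derivative Z) * e' = (p : ℤ_[p]) ^ c • e) (hN : c < N)
    (M : latticeModules (p := p) x) (b : Module.Basis (Fin r) ℤ_[p] (M : Submodule ℤ_[p] E))
    (hNM : ∀ u ∈ stab (order p x), ∃ v ∈ stab (M : Submodule ℤ_[p] E),
      (p : ℤ_[p]) ^ N • u = (p : ℤ_[p]) • v)
    (hm : ∀ v ∈ stab (M : Submodule ℤ_[p] E), (p : ℤ_[p]) ^ m • v ∈ stab (order p x))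
    (L : AddSubgroup E) (hL : ∀ z ∈ L, ∃ z' ∈ order p x, z = (p : ℤ_[p]) • z')
    (hNL : ∀ z ∈ order p x, (p : ℤ_[p]) ^ N • z ∈ L)
    (huniq : ∀ g : (Module.End ℚ_[p] E)ˣ, ∀ z ∈ L, ∀ z' ∈ L,
      (g : Module.End ℚ_[p] E) * Algebra.lmul ℚ_[p] E (x + z) = Algebra.lmul ℚ_[p] E (x + z') * g →
        z = z' ∧ (g : Module.End ℚ_[p] E) * Algebra.lmul ℚ_[p] E x =
          Algebra.lmul ℚ_[p] E x * g)
    (F : Set ℤ_[p][X]) (hF : ∀ y, (∃ f ∈ F, aeval x f = y) ↔ y - x ∈ L)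
    [MeasurableSpace (Matrix (Fin r) (Fin r) ℤ_[p])] [BorelSpace (Matrix (Fin r) (Fin r) ℤ_[p])]
    (P : Measure (Matrix (Fin r) (Fin r) ℤ_[p])) [P.IsAddHaarMeasure] [IsProbabilityMeasure P] :
    MeasurableSet (conjOrbit (actionMatrix M b) F) ∧
      P.real (conjOrbit (actionMatrix M b) F) *
        (onePlus (powStab p x N) powStab_mul_mem).relIndex (autLattice x (M : Submodule ℤ_[p] E)) *
        ((order p x).toAddSubgroup.map (AddMonoidHom.mulLeft (aeval x (derivative Z)))).relIndex
          (order p x).toAddSubgroup =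
      (∏ j ∈ Finset.Icc 1 r, (1 - ((p : ℝ) ^ j)⁻¹)) *
        ((order p x).toAddSubgroup.map (DistribSMul.toAddMonoidHom E ((p : ℤ_[p]) ^ N))).relIndex L := by
  have : (M : Submodule ℤ_[p] E).IsLattice ℚ_[p] := M.2.2
  have : (order p x).IsLattice ℚ_[p] := order_isLattice hx hZ hr bE hb
  let Φ := latticeEnd b
  have hΦ : Function.Injective Φ := latticeEnd_injective b
  have hstab : ∀ T, T ∈ stab (M : Submodule ℤ_[p] E) ↔ ∃ A, Φ A = T := mem_stab_iff_range b
  have hΦA : Φ (actionMatrix M b) = Algebra.lmul ℚ_[p] E x := latticeEnd_actionMatrix M b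
  have hRM : ∀ a ∈ order p x, Algebra.lmul ℚ_[p] E a ∈ stab (M : Submodule ℤ_[p] E) := fun a ha =>
    lmul_mem_stab fun m hm => M.2.1 a ha m hm
  set Γ := onePlus (powStab p x N) powStab_mul_mem with hΓdef
  set A := autLattice x (M : Submodule ℤ_[p] E) with hA
  set W : AddSubgroup E :=
    (order p x).toAddSubgroup.map (DistribSMul.toAddMonoidHom E ((p : ℤ_[p]) ^ N)) with hW
  have hWmem : ∀ a, a ∈ W ↔ ∃ e ∈ order p x, (p : ℤ_[p]) ^ N • e = a := fun a => Iff.rfl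
  have hWL : W ≤ L := by
    rintro _ ⟨e, he, rfl⟩
    exact hNL e he
  have hLR : L ≤ (order p x).toAddSubgroup := by
    intro z hz
    obtain ⟨z', hz', rfl⟩ := hL z hz
    exact (order p x).smul_mem _ hz'
  have hxR : x ∈ order p x := Algebra.self_mem_adjoin_singleton _ x
  have hArange : A ≤ (latticeUnits b).range := fun T hT =>
    mem_latticeUnits_range b (mem_autLattice.1 hT).2.1 (mem_autLattice.1 hT).2.2
  have hpowM : ∀ a ∈ powStab p x N, a ∈ stab (M : Submodule ℤ_[p] E) := by
    rintro _ ⟨u, hu, rfl⟩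
    obtain ⟨v, hv, h⟩ := hNM u hu
    change (p : ℤ_[p]) ^ N • u ∈ _
    rw [h]
    exact (stab _).smul_mem hv _
  have hΓrange : ∀ T ∈ Γ, ∃ t, latticeUnits b t = T := fun T hT => by
    have h1 := add_mem (hpowM _ hT.1) (one_mem (stab (M : Submodule ℤ_[p] E)))
    have h2 := add_mem (hpowM _ hT.2) (one_mem (stab (M : Submodule ℤ_[p] E)))
    rw [sub_add_cancel] at h1 h2
    exact mem_latticeUnits_range b h1 h2
  -- the index of `Γ`
  obtain ⟨hΓ0, hΓ1⟩ := index_comap_onePlus_powStab (x := x) b (by omega) hNM hm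
  -- the tube lattice
  set J : AddSubgroup (Matrix (Fin r) (Fin r) ℤ_[p]) :=
    (powStab p x N).comap (latticeEnd b).toRingHom.toAddMonoidHom with hJ
  set Λ : AddSubgroup (Matrix (Fin r) (Fin r) ℤ_[p]) :=
    ((commSum x Z).map (DistribSMul.toAddMonoidHom _ ((p : ℤ_[p]) ^ N))).comap
      (latticeEnd b).toRingHom.toAddMonoidHom with hΛ
  have hΛmem : ∀ B, B ∈ Λ ↔ ∃ w ∈ commSum x Z, (p : ℤ_[p]) ^ N • w = Φ B := fun B => Iff.rfl
  have hΛJ : Λ ≤ J := AddSubgroup.comap_mono (AddSubgroup.map_mono inf_le_left)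
  have hΛrel : Λ.relIndex J =
      ((order p x).toAddSubgroup.map (AddMonoidHom.mulLeft (aeval x (derivative Z)))).relIndex
        (order p x).toAddSubgroup := by
    have h1 : J.map (latticeEnd b).toRingHom.toAddMonoidHom = powStab p x N := by
      refine AddSubgroup.map_comap_eq_self ?_
      intro a ha
      obtain ⟨B, hB⟩ := (hstab a).1 (hpowM a ha)
      exact ⟨B, hB⟩
    rw [hΛ, AddSubgroup.relIndex_comap, h1, powStab, ← relIndex_commSum hx hZ hr bE hb]
    refine AddSubgroup.relIndex_map_map_of_injective _ _ ?_
    intro u v huv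
    have h2 : (p : ℤ_[p]) ^ N • u = (p : ℤ_[p]) ^ N • v := huv
    have h3 : (p : ℚ_[p]) ^ N ≠ 0 :=
      pow_ne_zero _ (by exact_mod_cast (Fact.out : p.Prime).ne_zero)
    refine LinearMap.ext fun a => ?_
    have h4 := congrArg (fun S : Module.End ℚ_[p] E => S a) h2
    simp only [LinearMap.smul_apply] at h4
    rw [← IsScalarTower.algebraMap_smul ℚ_[p], ← IsScalarTower.algebraMap_smul ℚ_[p] _ (v a)] at h4
    have h5 : algebraMap ℤ_[p] ℚ_[p] ((p : ℤ_[p]) ^ N) = (p : ℚ_[p]) ^ N := by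
      rw [map_pow, map_natCast]
    rw [h5] at h4
    exact smul_right_injective E h3 h4
  -- The factor `p ^ m` carries `End(M)` into `End(R)`, and `p ^ c` then moves the `evalQuot` value
  -- into `Z'(x) R`. So `p ^ (N + c + m) Mat_r(ℤ_p) ⊆ Λ`, which makes `Λ` open of finite index.
  obtain ⟨I, -, hI0, hIo, hImem⟩ := exists_ideal_matrix (p := p) (r := r) (N + (c + m))
  have hIΛ : I ≤ Λ := by
    intro B hB
    obtain ⟨u, rfl⟩ := (hImem B).1 hB
    have hu : (p : ℤ_[p]) ^ m • Φ u ∈ stab (order p x) := hm _ ((hstab _).2 ⟨u, rfl⟩)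
    obtain ⟨e', he', h5⟩ := hc _ (evalQuot_mem_order hx hu)
    refine (hΛmem _).2 ⟨(p : ℤ_[p]) ^ c • (p : ℤ_[p]) ^ m • Φ u, mem_commSum.2
      ⟨(stab (order p x)).smul_mem hu _, e', he', ?_⟩, ?_⟩
    · rw [h5, ← IsScalarTower.algebraMap_smul ℚ_[p], ← map_smul, IsScalarTower.algebraMap_smul]
    · rw [map_smul, smul_smul, smul_smul, pow_add, pow_add, mul_assoc]
  have hΛ0 : Λ.index ≠ 0 := fun h0 => hI0 (by
    rw [← AddSubgroup.relIndex_mul_index hIΛ, h0, mul_zero])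
  have hΛo : IsOpen (Λ : Set (Matrix (Fin r) (Fin r) ℤ_[p])) := AddSubgroup.isOpen_mono hIΛ hIo
  have hΛmeas : MeasurableSet (Λ : Set (Matrix (Fin r) (Fin r) ℤ_[p])) := hΛo.measurableSet
  have hΛfi : Λ.FiniteIndex := ⟨hΛ0⟩
  have hPΛ : (Λ.index : ENNReal) * P (Λ : Set _) = 1 := by
    rw [AddSubgroup.index_mul_measure Λ hΛmeas P, measure_univ]
  -- the balls
  have hLfin : (W.addSubgroupOf L).index ≠ 0 := fun h0 =>
    relIndex_smul_ne_zero (order p x) (Submodule.IsLattice.fg (M := order p x)) N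
      (by rw [← AddSubgroup.relIndex_mul_relIndex W L _ hWL hLR, AddSubgroup.relIndex, h0, zero_mul])
  have hQfi : (W.addSubgroupOf L).FiniteIndex := ⟨hLfin⟩
  let Q := L ⧸ W.addSubgroupOf L
  have : Fintype Q := Fintype.ofFinite _
  have hpre : ∀ z ∈ L, ∃ B, Φ B = Algebra.lmul ℚ_[p] E (x + z) := fun z hz =>
    (hstab _).1 (hRM _ (add_mem hxR (hLR hz)))
  let Y : Set (Matrix (Fin r) (Fin r) ℤ_[p]) := {B | ∃ z ∈ L, Φ B = Algebra.lmul ℚ_[p] E (x + z)}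
  classical
  -- A matrix of multiplication by `x + z` recovers `z` by evaluation at `1`; the default value `0`
  -- is taken only outside `Y`.
  let cls : Matrix (Fin r) (Fin r) ℤ_[p] → Q := fun B =>
    if h : Φ B 1 - x ∈ L then QuotientAddGroup.mk ⟨_, h⟩ else 0
  have hcls : ∀ B, ∀ z, ∀ hz : z ∈ L, Φ B = Algebra.lmul ℚ_[p] E (x + z) →
      cls B = QuotientAddGroup.mk ⟨z, hz⟩ := by
    intro B z hz h
    have h1 : Φ B 1 - x = z := by rw [h, lmul_apply_apply, mul_one, add_sub_cancel_left]
    have h2 : Φ B 1 - x ∈ L := h1 ▸ hz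
    change (if h : Φ B 1 - x ∈ L then (QuotientAddGroup.mk ⟨_, h⟩ : Q) else 0) = _
    rw [dif_pos h2]
    congr 1
    exact Subtype.ext h1
  let tube : Q → Set (Matrix (Fin r) (Fin r) ℤ_[p]) := fun q =>
    {B | ∃ w ∈ commSum x Z, Φ B = Algebra.lmul ℚ_[p] E (x + (q.out : L)) + (p : ℤ_[p]) ^ N • w}
  have htube : ∀ q, ∃ y, tube q = (fun B => -y + B) ⁻¹' Λ := by
    intro q
    obtain ⟨y, hy⟩ := hpre _ (q.out : L).2
    refine ⟨y, Set.ext fun B => ?_⟩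
    rw [Set.mem_preimage, SetLike.mem_coe, hΛmem, map_add, map_neg, hy]
    refine exists_congr fun w => and_congr_right fun _ => ?_
    rw [eq_neg_add_iff_add_eq, eq_comm]
  have htm : ∀ q, MeasurableSet (tube q) := fun q => by
    obtain ⟨y, hy⟩ := htube q
    rw [hy]
    exact (hΛo.preimage (by fun_prop)).measurableSet
  have htμ : ∀ q, P (tube q) = P (Λ : Set _) := fun q => by
    obtain ⟨y, hy⟩ := htube q
    rw [hy, measure_preimage_add]
  obtain ⟨hSm, hS⟩ := measure_union_orbits P
    (fun (g : GL (Fin r) ℤ_[p]) B => (g : Matrix (Fin r) (Fin r) ℤ_[p]) * B *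
      ((g⁻¹ : GL (Fin r) ℤ_[p]) : Matrix (Fin r) (Fin r) ℤ_[p]))
    (fun a => by simp) (fun g h a => by simp [mul_assoc]) (measurePreserving_conj P)
    (Γ.comap (latticeUnits b)) (A.comap (latticeUnits b)) hΓ0 Y cls tube htm
    (by
      intro q a
      obtain ⟨z₀, hz₀, hz₀'⟩ := hL _ (q.out : L).2
      refine (conj_ball_eq hgen hx hZ hr bE hb hc hN hz₀
        (show x + ((q.out : L) : E) = x + (p : ℤ_[p]) • z₀ by rw [hz₀']) (Φ a)).trans ?_
      constructor
      · rintro ⟨t, ht, z', hz', h⟩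
        obtain ⟨t, rfl⟩ := hΓrange t ht
        have hz1 : ((q.out : L) : E) + (p : ℤ_[p]) ^ N • z' ∈ L := L.add_mem (q.out : L).2 (hNL _ hz')
        obtain ⟨y, hy⟩ := hpre _ hz1
        refine ⟨t, ht, y, ⟨_, hz1, hy⟩, ?_, hΦ ?_⟩
        · rw [hcls y _ hz1 hy]
          conv_rhs => rw [← QuotientAddGroup.out_eq' q]
          refine QuotientAddGroup.eq.2 ?_
          rw [AddSubgroup.mem_addSubgroupOf]
          refine (hWmem _).2 ⟨-z', neg_mem hz', ?_⟩
          simp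
        · rw [h, map_mul, map_mul, hy, add_assoc]
          rfl
      · rintro ⟨t, ht, y, ⟨z, hz, hy⟩, hq, rfl⟩
        rw [hcls y z hz hy] at hq
        conv_rhs at hq => rw [← QuotientAddGroup.out_eq' q]
        have h1 := QuotientAddGroup.eq.1 hq
        rw [AddSubgroup.mem_addSubgroupOf] at h1
        obtain ⟨e, he, h2⟩ := (hWmem _).1 h1
        refine ⟨latticeUnits b t, ht, -e, neg_mem he, ?_⟩
        have h3 : x + ((q.out : L) : E) + (p : ℤ_[p]) ^ N • -e = x + z := by
          rw [smul_neg, h2]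
          simp
        rw [h3, map_mul, map_mul, hy]
        rfl)
    (by
      rintro g y ⟨z, hz, hy⟩ y' ⟨z', hz', hy'⟩ h
      have h1 : (g : Matrix (Fin r) (Fin r) ℤ_[p]) * y = y' * g := by
        rw [← h, mul_assoc, Units.inv_mul, mul_one]
      have h2 := congrArg Φ h1
      rw [map_mul, map_mul, hy, hy'] at h2
      obtain ⟨h3, h4⟩ := huniq (latticeUnits b g) z hz z' hz' h2
      refine ⟨hΦ (by rw [hy, hy', h3]), mem_autLattice.2 ⟨h4, (hstab _).2 ⟨_, rfl⟩,
        (hstab _).2 ⟨((g⁻¹ : GL (Fin r) ℤ_[p]) : Matrix (Fin r) (Fin r) ℤ_[p]), rfl⟩⟩⟩)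
    (by
      rintro g hg y ⟨z, hz, hy⟩
      have h1 := eq_lmul_of_commute hgen (mem_autLattice.1 hg).1
      have h2 : Φ ((g : Matrix (Fin r) (Fin r) ℤ_[p]) * y) = Φ (y * g) := by
        rw [map_mul, map_mul, hy]
        change ((latticeUnits b g : (Module.End ℚ_[p] E)ˣ) : Module.End ℚ_[p] E) * _ =
          _ * ((latticeUnits b g : (Module.End ℚ_[p] E)ˣ) : Module.End ℚ_[p] E)
        rw [h1, ← map_mul, ← map_mul, mul_comm]
      change (g : Matrix (Fin r) (Fin r) ℤ_[p]) * y * _ = y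
      rw [hΦ h2, mul_assoc, Units.mul_inv, mul_one])
  have hSeq : conjOrbit (actionMatrix M b) F = {a | ∃ g : GL (Fin r) ℤ_[p], ∃ y ∈ Y,
      a = (g : Matrix (Fin r) (Fin r) ℤ_[p]) * y *
        ((g⁻¹ : GL (Fin r) ℤ_[p]) : Matrix (Fin r) (Fin r) ℤ_[p])} := by
    have hev : ∀ f : ℤ_[p][X], Φ (aeval (actionMatrix M b) f) =
        Algebra.lmul ℚ_[p] E (aeval x f) := fun f => by
      rw [← aeval_lmul, ← hΦA, aeval_algHom_apply]
    ext B
    refine exists_congr fun T => ⟨?_, ?_⟩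
    · rintro ⟨f, hf, h⟩
      exact ⟨_, ⟨aeval x f - x, (hF _).1 ⟨f, hf, rfl⟩, by rw [hev, add_sub_cancel]⟩, h⟩
    · rintro ⟨y, ⟨z, hz, hy⟩, h⟩
      obtain ⟨f, hf, hfz⟩ := (hF (x + z)).2 (by rwa [add_sub_cancel_left])
      refine ⟨f, hf, ?_⟩
      rw [h]
      congr 2
      exact hΦ (by rw [hev, hy, hfz])
  rw [← hSeq] at hSm hS
  refine ⟨hSm, ?_⟩
  have hrel : (Γ.comap (latticeUnits b)).relIndex (A.comap (latticeUnits b)) = Γ.relIndex A := by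
    rw [Subgroup.relIndex_comap, Subgroup.map_comap_eq_self hArange]
  have hcard : Fintype.card Q = W.relIndex L := by
    rw [AddSubgroup.relIndex, AddSubgroup.index, Nat.card_eq_fintype_card]
  rw [hrel, Finset.sum_congr rfl fun q _ => htμ q, Finset.sum_const, Finset.card_univ, hcard,
    nsmul_eq_mul] at hS
  have hS' := congrArg ENNReal.toReal hS
  have hPΛ' := congrArg ENNReal.toReal hPΛ
  simp only [ENNReal.toReal_mul, ENNReal.toReal_natCast, ENNReal.toReal_one] at hS' hPΛ'
  rw [← hΛrel, Measure.real, hS', hΓ1]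
  have h5 : ((Λ.relIndex J : ℕ) : ℝ) * J.index = Λ.index := by
    exact_mod_cast AddSubgroup.relIndex_mul_index hΛJ
  rw [← h5] at hPΛ'
  linear_combination (∏ j ∈ Finset.Icc 1 r, (1 - ((p : ℝ) ^ j)⁻¹)) * (W.relIndex L : ℝ) * hPΛ'

end OrbitMeasure

/-! ### The valuation of a finite extension of `ℚ_[p]` -/

section LocalField

variable {p : ℕ} [Fact p.Prime] {K : Type*} [Field K] [Algebra ℚ_[p] K]

theorem val_zero : val (p := p) (0 : K) = ⊤ := if_pos rfl

theorem val_of_ne_zero {y : K} (hy : y ≠ 0) :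
    val (p := p) y = ((-Real.logb p (spectralNorm ℚ_[p] K y) : ℝ) : WithTop ℝ) := if_neg hy

theorem val_ne_top {y : K} (hy : y ≠ 0) : val (p := p) y ≠ ⊤ := by
  rw [val_of_ne_zero hy]
  exact WithTop.coe_ne_top

theorem val_one : val (p := p) (1 : K) = 0 := by
  rw [val_of_ne_zero one_ne_zero, spectralNorm_one, Real.logb_one, neg_zero]
  rfl

theorem val_algebraMap (c : ℚ_[p]) :
    val (p := p) (algebraMap ℚ_[p] K c) = val (p := p) c := by
  rcases eq_or_ne c 0 with rfl | hc
  · rw [map_zero, val_zero, val_zero]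
  · rw [val_of_ne_zero hc, val_of_ne_zero ((map_ne_zero _).2 hc), spectralNorm_extends]
    have := spectralNorm_extends (K := ℚ_[p]) (L := ℚ_[p]) c
    rw [Algebra.algebraMap_self_apply] at this
    rw [this]

variable [FiniteDimensional ℚ_[p] K]

theorem spectralNorm_pos {y : K} (hy : y ≠ 0) : 0 < spectralNorm ℚ_[p] K y :=
  spectralNorm_zero_lt hy (Algebra.IsAlgebraic.isAlgebraic y)

theorem val_mul (y z : K) : val (p := p) (y * z) = val (p := p) y + val (p := p) z := by
  rcases eq_or_ne y 0 with rfl | hy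
  · rw [zero_mul, val_zero, WithTop.top_add]
  rcases eq_or_ne z 0 with rfl | hz
  · rw [mul_zero, val_zero, WithTop.add_top]
  have h := spectralAlgNorm_mul (K := ℚ_[p]) (L := K) y z
  simp only [spectralAlgNorm_def] at h
  rw [val_of_ne_zero hy, val_of_ne_zero hz, val_of_ne_zero (mul_ne_zero hy hz), h,
    Real.logb_mul (spectralNorm_pos hy).ne' (spectralNorm_pos hz).ne', neg_add, WithTop.coe_add]

theorem val_pow (y : K) (n : ℕ) : val (p := p) (y ^ n) = n • val (p := p) y := by
  induction n with
  | zero => rw [pow_zero, zero_nsmul, val_one]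
  | succ n ih => rw [pow_succ, val_mul, ih, succ_nsmul]

variable [Algebra ℤ_[p] K] [IsScalarTower ℤ_[p] ℚ_[p] K]

theorem val_nonneg_iff (y : K) : 0 ≤ val (p := p) y ↔ IsIntegral ℤ_[p] y := by
  rw [isIntegral_iff_spectralNorm_le_one]
  rcases eq_or_ne y 0 with rfl | hy
  · rw [val_zero, spectralNorm_zero]
    simp
  · have hp : (1 : ℝ) < p := by exact_mod_cast (Fact.out : p.Prime).one_lt
    rw [val_of_ne_zero hy, ← WithTop.coe_zero, WithTop.coe_le_coe, Left.nonneg_neg_iff,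
      Real.logb_nonpos_iff hp (spectralNorm_pos hy)]

theorem val_unit {y : K} (u : (integralClosure ℤ_[p] K)ˣ) (hu : ((u : integralClosure ℤ_[p] K) : K) = y) :
    val (p := p) y = 0 := by
  have h1 := (val_nonneg_iff (p := p) _).2 (u : integralClosure ℤ_[p] K).2
  have h2 := (val_nonneg_iff (p := p) _).2 ((u⁻¹ : (integralClosure ℤ_[p] K)ˣ) : integralClosure ℤ_[p] K).2
  have h3 : val (p := p) (((u : integralClosure ℤ_[p] K) : K) *
      (((u⁻¹ : (integralClosure ℤ_[p] K)ˣ) : integralClosure ℤ_[p] K) : K)) = 0 := by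
    rw [← MulMemClass.coe_mul, Units.mul_inv, OneMemClass.coe_one, val_one]
  rw [val_mul] at h3
  rw [← hu]
  refine le_antisymm ?_ h1
  calc _ ≤ _ := le_add_of_nonneg_right h2
    _ = 0 := h3

theorem val_pos_iff (y : K) : 0 < val (p := p) y ↔
    ∃ a ∈ IsLocalRing.maximalIdeal (integralClosure ℤ_[p] K), (a : K) = y := by
  constructor
  · intro h
    refine ⟨⟨y, (val_nonneg_iff y).1 h.le⟩, ?_, rfl⟩
    rw [IsLocalRing.mem_maximalIdeal, mem_nonunits_iff]
    rintro ⟨u, hu⟩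
    exact h.ne' (val_unit u (congrArg Subtype.val hu))
  · rintro ⟨a, ha, rfl⟩
    refine lt_of_le_of_ne ((val_nonneg_iff _).2 a.2) fun h => ?_
    have h0 : (a : K) ≠ 0 := fun h0 => by
      rw [h0, val_zero] at h
      exact WithTop.zero_ne_top h
    have h1 : val (p := p) ((a : K)⁻¹) = 0 := by
      have h2 := val_mul (p := p) (a : K) (a : K)⁻¹
      rw [mul_inv_cancel₀ h0, val_one, ← h, zero_add] at h2
      exact h2.symm
    have h3 := (val_nonneg_iff (p := p) (a : K)⁻¹).1 h1.ge
    exact ha (IsUnit.of_mul_eq_one (⟨(a : K)⁻¹, h3⟩ : integralClosure ℤ_[p] K)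
        (Subtype.ext (mul_inv_cancel₀ h0)))

variable (p K)

theorem integralClosure_finite : Module.Finite ℤ_[p] (integralClosure ℤ_[p] K) :=
  IsIntegralClosure.finite ℤ_[p] ℚ_[p] K _

theorem integralClosure_isTorsionFree : Module.IsTorsionFree ℤ_[p] (integralClosure ℤ_[p] K) := by
  have := Module.IsTorsionFree.trans_faithfulSMul ℤ_[p] ℚ_[p] K
  exact IsIntegralClosure.isTorsionFree ℤ_[p] K

theorem isDiscreteValuationRing_integralClosure :
    IsDiscreteValuationRing (integralClosure ℤ_[p] K) := by
  have h1 : IsDedekindDomain (integralClosure ℤ_[p] K) :=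
    integralClosure.isDedekindDomain ℤ_[p] ℚ_[p] K
  have hnf : ¬ IsField (integralClosure ℤ_[p] K) := by
    intro h
    have := integralClosure_isTorsionFree p K
    have h2 := isField_of_isIntegral_of_isField (R := ℤ_[p]) (FaithfulSMul.algebraMap_injective _ _) h
    exact IsDiscreteValuationRing.not_isField ℤ_[p] h2
  exact ((IsDiscreteValuationRing.TFAE _ hnf).out 0 2).mpr h1

theorem maximalIdeal_pow_ramIndex : 0 < ramIndex p K ∧
    IsLocalRing.maximalIdeal (integralClosure ℤ_[p] K) ^ ramIndex p K =
      Ideal.span {(p : integralClosure ℤ_[p] K)} := by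
  have := integralClosure_finite p K
  have := integralClosure_isTorsionFree p K
  have := isDiscreteValuationRing_integralClosure p K
  set m := IsLocalRing.maximalIdeal (integralClosure ℤ_[p] K) with hm
  have hlo : m.LiesOver (IsLocalRing.maximalIdeal ℤ_[p]) :=
    ⟨(IsLocalRing.eq_maximalIdeal (Ideal.isMaximal_comap_of_isIntegral_of_isMaximal m)).symm⟩
  have h0 : (IsLocalRing.maximalIdeal ℤ_[p]).map (algebraMap ℤ_[p] (integralClosure ℤ_[p] K)) =
      Ideal.span {(p : integralClosure ℤ_[p] K)} := by
    rw [PadicInt.maximalIdeal_eq_span_p, Ideal.map_span, Set.image_singleton, map_natCast]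
  have h1 : (IsLocalRing.maximalIdeal ℤ_[p]).map (algebraMap ℤ_[p] (integralClosure ℤ_[p] K)) ≠ ⊥ :=
    Ideal.map_ne_bot_of_ne_bot (IsDiscreteValuationRing.not_a_field _)
  refine ⟨Ideal.ramificationIdx_pos _ _, ?_⟩
  rw [ramIndex, Ideal.IsDedekindDomain.ramificationIdx_eq_multiplicity _ m h1, ← h0]
  obtain ⟨ϖ, hϖ⟩ := IsDiscreteValuationRing.exists_irreducible (integralClosure ℤ_[p] K)
  obtain ⟨n, hn⟩ := IsDiscreteValuationRing.ideal_eq_span_pow_irreducible h1 hϖ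
  have hn' : Ideal.map (algebraMap ℤ_[p] (integralClosure ℤ_[p] K)) (IsLocalRing.maximalIdeal ℤ_[p]) = m ^ n := by
    rw [hn, hm, hϖ.maximalIdeal_eq, Ideal.span_singleton_pow]
  rw [hn', multiplicity_pow_self]
  · exact IsDiscreteValuationRing.not_a_field _
  · rw [Ideal.isUnit_iff]
    exact Ideal.IsPrime.ne_top'

/-- The residue field has `p ^ f` elements and `e f = [K : ℚ_p]`; this form avoids mentioning `f`.
-/
theorem card_residueField_pow :
    (Nat.card (IsLocalRing.ResidueField (integralClosure ℤ_[p] K))) ^ ramIndex p K =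
      p ^ Module.finrank ℚ_[p] K := by
  have := integralClosure_finite p K
  have := integralClosure_isTorsionFree p K
  have := isDiscreteValuationRing_integralClosure p K
  set m := IsLocalRing.maximalIdeal (integralClosure ℤ_[p] K) with hm
  have hlo : m.LiesOver (IsLocalRing.maximalIdeal ℤ_[p]) :=
    ⟨(IsLocalRing.eq_maximalIdeal (Ideal.isMaximal_comap_of_isIntegral_of_isMaximal m)).symm⟩
  have hbot := IsDiscreteValuationRing.not_a_field ℤ_[p]
  have : IsFractionRing (integralClosure ℤ_[p] K) K :=
    IsIntegralClosure.isFractionRing_of_finite_extension ℤ_[p] ℚ_[p] K _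
  have h1 := Ideal.cardQuot_pow_inertiaDeg (IsLocalRing.maximalIdeal ℤ_[p]) m
  have h2 : (IsLocalRing.maximalIdeal ℤ_[p]).cardQuot = p :=
    (Nat.card_congr PadicInt.residueField.toEquiv).trans (Nat.card_zmod p)
  have h3 := Ideal.ramificationIdx_mul_inertiaDeg_of_isLocalRing (integralClosure ℤ_[p] K)
    ℚ_[p] K hbot
  rw [Ideal.ramificationIdx'_eq_ramificationIdx _ _ hbot, Ideal.inertiaDeg'_eq_inertiaDeg] at h3
  rw [h2] at h1
  rw [← h3, mul_comm, pow_mul, h1]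
  rfl

theorem card_residueField_pos :
    0 < Nat.card (IsLocalRing.ResidueField (integralClosure ℤ_[p] K)) := by
  refine Nat.pos_of_ne_zero fun h => ?_
  have h1 := card_residueField_pow p K
  rw [h, zero_pow (maximalIdeal_pow_ramIndex p K).1.ne'] at h1
  exact pow_ne_zero _ (Fact.out : p.Prime).ne_zero h1.symm

theorem index_maximalIdeal_pow (n : ℕ) :
    (IsLocalRing.maximalIdeal (integralClosure ℤ_[p] K) ^ n).toAddSubgroup.index =
      Nat.card (IsLocalRing.ResidueField (integralClosure ℤ_[p] K)) ^ n := by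
  have := isDiscreteValuationRing_integralClosure p K
  exact cardQuot_pow_of_prime (IsDiscreteValuationRing.not_a_field _)

variable {K}

/-- A uniformizer `ϖ` has valuation `1 / e`, because `ϖ ^ e` is `p` up to a unit; the elements of
valuation at least `n / e` are then the integral multiples of `ϖ ^ n`. -/
theorem natCast_div_ramIndex_le_val_iff (n : ℕ) (y : K) :
    (((n : ℝ) / ramIndex p K : ℝ) : WithTop ℝ) ≤ val (p := p) y ↔
      ∃ a ∈ IsLocalRing.maximalIdeal (integralClosure ℤ_[p] K) ^ n, (a : K) = y := by
  have := isDiscreteValuationRing_integralClosure p K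
  obtain ⟨he, hpe⟩ := maximalIdeal_pow_ramIndex p K
  obtain ⟨ϖ, hϖ⟩ := IsDiscreteValuationRing.exists_irreducible (integralClosure ℤ_[p] K)
  have hϖ0 : (ϖ : K) ≠ 0 := fun h => hϖ.ne_zero (Subtype.ext h)
  rw [hϖ.maximalIdeal_eq, Ideal.span_singleton_pow] at hpe
  obtain ⟨u, hu⟩ := Ideal.span_singleton_eq_span_singleton.1 hpe
  have h1 : val (p := p) ((ϖ : K) ^ ramIndex p K) + 0 = 1 := by
    have h2 := congrArg (fun a : integralClosure ℤ_[p] K => val (p := p) (a : K)) hu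
    simp only [MulMemClass.coe_mul, SubmonoidClass.coe_pow, val_mul, val_unit u rfl] at h2
    rw [h2]
    have h3 : (((p : ℕ) : integralClosure ℤ_[p] K) : K) = algebraMap ℚ_[p] K p := by
      rw [map_natCast]
      rfl
    have hp : (1 : ℝ) < p := by exact_mod_cast (Fact.out : p.Prime).one_lt
    rw [h3, val_of_ne_zero, spectralNorm_extends, Padic.norm_p, Real.logb_inv, neg_neg,
      Real.logb_self_eq_one hp]
    · rfl
    · rw [map_ne_zero]
      exact_mod_cast (Fact.out : p.Prime).ne_zero
  rw [add_zero, val_pow] at h1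
  have h4 : val (p := p) (ϖ : K) = ((1 / ramIndex p K : ℝ) : WithTop ℝ) := by
    lift val (p := p) (ϖ : K) to ℝ using val_ne_top hϖ0 with v hv
    have h5 : ramIndex p K • v = 1 := by exact_mod_cast h1
    rw [nsmul_eq_mul] at h5
    rw [WithTop.coe_eq_coe, eq_div_iff (by exact_mod_cast he.ne'), mul_comm, h5]
  have h5 : val (p := p) ((ϖ : K) ^ n) = (((n : ℝ) / ramIndex p K : ℝ) : WithTop ℝ) := by
    rw [val_pow, h4, ← WithTop.coe_nsmul, nsmul_eq_mul, mul_one_div]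
  have h6 : y = (ϖ : K) ^ n * (y / (ϖ : K) ^ n) := (mul_div_cancel₀ _ (pow_ne_zero _ hϖ0)).symm
  rw [← h5, hϖ.maximalIdeal_eq, Ideal.span_singleton_pow]
  constructor
  · intro h
    have h7 : 0 ≤ val (p := p) (y / (ϖ : K) ^ n) := by
      rw [h6, val_mul, h5] at h
      exact (WithTop.add_le_add_iff_left WithTop.coe_ne_top).1 ((add_zero _).trans_le h)
    exact ⟨ϖ ^ n * ⟨_, (val_nonneg_iff _).1 h7⟩,
      Ideal.mul_mem_right _ _ (Ideal.mem_span_singleton_self _), h6.symm⟩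
  · rintro ⟨a, ha, rfl⟩
    obtain ⟨c, rfl⟩ := Ideal.mem_span_singleton.1 ha
    rw [MulMemClass.coe_mul, val_mul, SubmonoidClass.coe_pow]
    exact le_add_of_nonneg_right ((val_nonneg_iff _).2 c.2)

end LocalField

/-! ### Products of local fields -/

section Product

theorem isIntegral_pi_iff {R ι : Type*} [CommRing R] [Fintype ι] {A : ι → Type*} [∀ i, CommRing (A i)]
    [∀ i, Algebra R (A i)] {z : ∀ i, A i} : IsIntegral R z ↔ ∀ i, IsIntegral R (z i) := by
  classical
  constructor
  · exact fun h i => h.map (Pi.evalAlgHom R A i)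
  · intro h
    refine ⟨∏ i, minpoly R (z i), Polynomial.monic_prod_of_monic _ _ fun i _ => minpoly.monic (h i), ?_⟩
    funext i
    change Polynomial.aeval z _ i = 0
    have h1 := Polynomial.aeval_algHom_apply (Pi.evalAlgHom R A i) z (∏ i, minpoly R (z i))
    change Polynomial.aeval (z i) _ = Polynomial.aeval z _ i at h1
    rw [← h1, map_prod]
    exact Finset.prod_eq_zero (Finset.mem_univ i) (minpoly.aeval R (z i))

theorem addSubgroup_index_pi {ι : Type*} [Fintype ι] {G : ι → Type*} [∀ i, AddGroup (G i)]
    (H : ∀ i, AddSubgroup (G i)) :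
    (AddSubgroup.pi Set.univ H).index = ∏ i, (H i).index := by
  simp_rw [AddSubgroup.index, ← Nat.card_pi]
  refine Nat.card_congr
    ((Quotient.congrRight (fun x y ↦ ?_)).trans (Setoid.piQuotientEquiv _).symm)
  rw [QuotientAddGroup.leftRel_pi]

variable (p : ℕ) [Fact p.Prime] {ι : Type*} (K : ι → Type*) [∀ i, Field (K i)]
  [∀ i, Algebra ℚ_[p] (K i)] [∀ i, FiniteDimensional ℚ_[p] (K i)]
  [∀ i, Algebra ℤ_[p] (K i)] [∀ i, IsScalarTower ℤ_[p] ℚ_[p] (K i)]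

/-- The inclusion of the product of the rings of integers. -/
noncomputable def piIntegers : (∀ i, integralClosure ℤ_[p] (K i)) →+* (∀ i, K i) :=
  RingHom.pi fun i => ((integralClosure ℤ_[p] (K i)).val : _ →+* K i).comp (Pi.evalRingHom _ i)

theorem piIntegers_injective : Function.Injective (piIntegers p K) := fun _ _ h =>
  funext fun i => Subtype.ext (congrFun h i)

/-- The product of the `n i`-th powers of the maximal ideals. -/
noncomputable def maxPow (n : ι → ℕ) : AddSubgroup (∀ i, K i) :=
  (AddSubgroup.pi Set.univ fun i =>
    (IsLocalRing.maximalIdeal (integralClosure ℤ_[p] (K i)) ^ n i).toAddSubgroup).map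
    (piIntegers p K).toAddMonoidHom

variable {p K}

theorem mem_maxPow {n : ι → ℕ} {z : ∀ i, K i} : z ∈ maxPow p K n ↔
    ∀ i, ∃ a ∈ IsLocalRing.maximalIdeal (integralClosure ℤ_[p] (K i)) ^ n i, (a : K i) = z i := by
  constructor
  · rintro ⟨a, ha, rfl⟩ i
    exact ⟨a i, ha i (Set.mem_univ i), rfl⟩
  · intro h
    choose a ha h using h
    exact ⟨a, fun i _ => ha i, funext h⟩

theorem mem_maxPow_zero [Fintype ι] {z : ∀ i, K i} : z ∈ maxPow p K 0 ↔ IsIntegral ℤ_[p] z := by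
  rw [mem_maxPow, isIntegral_pi_iff]
  refine forall_congr' fun i => ?_
  rw [Pi.zero_apply, pow_zero, Ideal.one_eq_top]
  exact ⟨fun ⟨a, _, h⟩ => h ▸ a.2, fun h => ⟨⟨_, h⟩, trivial, rfl⟩⟩

theorem mem_maxPow_one {z : ∀ i, K i} : z ∈ maxPow p K 1 ↔ ∀ i, 0 < val (p := p) (z i) := by
  rw [mem_maxPow]
  refine forall_congr' fun i => ?_
  rw [Pi.one_apply, pow_one, val_pos_iff]

theorem mul_mem_maxPow [Fintype ι] {n : ι → ℕ} {a z : ∀ i, K i} (ha : IsIntegral ℤ_[p] a)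
    (hz : z ∈ maxPow p K n) : a * z ∈ maxPow p K n := by
  rw [mem_maxPow] at hz ⊢
  intro i
  obtain ⟨b, hb, h⟩ := hz i
  exact ⟨⟨a i, isIntegral_pi_iff.1 ha i⟩ * b, Ideal.mul_mem_left _ _ hb, by rw [Pi.mul_apply, ← h]; rfl⟩

theorem maxPow_le_zero (n : ι → ℕ) : maxPow p K n ≤ maxPow p K 0 :=
  AddSubgroup.map_mono fun a _ i _ => by
    change a i ∈ IsLocalRing.maximalIdeal (integralClosure ℤ_[p] (K i)) ^ 0
    rw [pow_zero, Ideal.one_eq_top]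
    trivial

theorem relIndex_maxPow [Fintype ι] (n : ι → ℕ) : (maxPow p K n).relIndex (maxPow p K 0) =
    ∏ i, Nat.card (IsLocalRing.ResidueField (integralClosure ℤ_[p] (K i))) ^ n i := by
  have h : (AddSubgroup.pi Set.univ fun i =>
      (IsLocalRing.maximalIdeal (integralClosure ℤ_[p] (K i)) ^ (0 : ι → ℕ) i).toAddSubgroup) = ⊤ := by
    refine eq_top_iff.2 fun a _ i _ => ?_
    change a i ∈ IsLocalRing.maximalIdeal (integralClosure ℤ_[p] (K i)) ^ 0
    rw [pow_zero, Ideal.one_eq_top]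
    trivial
  rw [maxPow, maxPow, h, AddSubgroup.relIndex_map_map_of_injective _ _ (piIntegers_injective p K),
    AddSubgroup.relIndex_top_right, addSubgroup_index_pi]
  exact Finset.prod_congr rfl fun i _ => index_maximalIdeal_pow p (K i) (n i)

theorem val_natCast_self {L : Type*} [Field L] [Algebra ℚ_[p] L] : val (p := p) (p : L) = 1 := by
  have hp : (1 : ℝ) < p := by exact_mod_cast (Fact.out : p.Prime).one_lt
  have h : (p : L) = algebraMap ℚ_[p] L p := (map_natCast _ _).symm
  rw [h, val_algebraMap, val_of_ne_zero (by exact_mod_cast (Fact.out : p.Prime).ne_zero)]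
  have h1 := spectralNorm_extends (K := ℚ_[p]) (L := ℚ_[p]) p
  rw [Algebra.algebraMap_self_apply] at h1
  rw [h1, Padic.norm_p, Real.logb_inv, neg_neg, Real.logb_self_eq_one hp]
  rfl

theorem natCast_smul_apply (w : ∀ i, K i) (i : ι) : ((p : ℤ_[p]) • w) i = (p : K i) * w i := by
  rw [Pi.smul_apply, Algebra.smul_def, map_natCast]

/-- Membership in the radical is expressed by powers and integrality alone. In this form it passes
through algebra homomorphisms and says that multiplication is nilpotent modulo `p`. -/
theorem mem_maxPow_one_iff [Fintype ι] {z : ∀ i, K i} : z ∈ maxPow p K 1 ↔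
    ∃ k : ℕ, ∃ w, IsIntegral ℤ_[p] w ∧ z ^ k = (p : ℤ_[p]) • w := by
  constructor
  · intro h
    rw [mem_maxPow] at h
    choose a ha h using h
    have h1 : ∀ i, ∃ c : integralClosure ℤ_[p] (K i), a i ^ (∑ j, ramIndex p (K j)) = p * c := by
      intro i
      rw [← dvd_def, ← Ideal.mem_span_singleton, ← (maximalIdeal_pow_ramIndex p (K i)).2]
      refine Ideal.pow_le_pow_right (Finset.single_le_sum (f := fun j => ramIndex p (K j))
        (fun _ _ => Nat.zero_le _) (Finset.mem_univ i)) (Ideal.pow_mem_pow ?_ _)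
      simpa using ha i
    choose c hc using h1
    -- The sum of the ramification indices serves as an exponent common to all factors.
    refine ⟨∑ j, ramIndex p (K j), fun i => c i, isIntegral_pi_iff.2 fun i => (c i).2, ?_⟩
    funext i
    rw [natCast_smul_apply, Pi.pow_apply, ← h i]
    exact congrArg Subtype.val (hc i)
  · rintro ⟨k, w, hw, h⟩
    rw [mem_maxPow_one]
    intro i
    have h1 := congrArg (val (p := p)) (congrFun h i)
    rw [natCast_smul_apply, Pi.pow_apply, val_pow, val_mul, val_natCast_self] at h1
    have h2 := (val_nonneg_iff (p := p) _).2 (isIntegral_pi_iff.1 hw i)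
    by_contra h3
    have h4 : k • val (p := p) (z i) ≤ 0 := nsmul_nonpos (not_lt.1 h3) k
    rw [h1] at h4
    have h5 : (1 : WithTop ℝ) ≤ 0 := (le_add_of_nonneg_right h2).trans h4
    exact absurd h5 (not_le.2 zero_lt_one)

variable (p K)

theorem integers_fg [Fintype ι] : (Subalgebra.toSubmodule (integralClosure ℤ_[p] (∀ i, K i))).FG := by
  have := fun i => integralClosure_finite p (K i)
  let f : (∀ i, integralClosure ℤ_[p] (K i)) →ₗ[ℤ_[p]] (∀ i, K i) :=
    LinearMap.pi fun i => (integralClosure ℤ_[p] (K i)).val.toLinearMap ∘ₗ LinearMap.proj i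
  have h : Subalgebra.toSubmodule (integralClosure ℤ_[p] (∀ i, K i)) = LinearMap.range f := by
    ext z
    refine Iff.trans (isIntegral_pi_iff (z := z)) ?_
    constructor
    · exact fun h => ⟨fun i => ⟨z i, h i⟩, rfl⟩
    · rintro ⟨a, rfl⟩ i
      exact (a i).2
  rw [h, LinearMap.range_eq_map]
  exact Module.Finite.fg_top.map f

end Product

/-! ### Traces of elements of the radical -/

section Units

variable {p : ℕ} [Fact p.Prime] {ι : Type*} [Fintype ι] {K : ι → Type*} [∀ i, Field (K i)]
  [∀ i, Algebra ℚ_[p] (K i)] [∀ i, FiniteDimensional ℚ_[p] (K i)]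
  [∀ i, Algebra ℤ_[p] (K i)] [∀ i, IsScalarTower ℤ_[p] ℚ_[p] (K i)] {x : ∀ i, K i}

theorem order_le_integers (hx : IsIntegral ℤ_[p] x) :
    order p x ≤ Subalgebra.toSubmodule (integralClosure ℤ_[p] (∀ i, K i)) :=
  Subalgebra.toSubmodule.monotone (adjoin_le_integralClosure hx)

theorem integers_isLattice (hx : IsIntegral ℤ_[p] x) [h : (order p x).IsLattice ℚ_[p]] :
    (Subalgebra.toSubmodule (integralClosure ℤ_[p] (∀ i, K i))).IsLattice ℚ_[p] where
  fg := integers_fg p K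
  span_eq_top := eq_top_iff.2 (h.span_eq_top ▸ Submodule.span_mono (order_le_integers hx))

/-- Some power of `z` lies in `p 𝒪`, so the matrix of `z` on the lattice `𝒪` is nilpotent modulo `p`
and its trace vanishes modulo `p`. -/
theorem exists_trace_eq (hx : IsIntegral ℤ_[p] x) [(order p x).IsLattice ℚ_[p]]
    {z : ∀ i, K i} (hz : z ∈ maxPow p K 1) :
    ∃ c : ℤ_[p], Algebra.trace ℚ_[p] (∀ i, K i) z = algebraMap ℤ_[p] ℚ_[p] (p * c) := by
  have := integers_isLattice hx
  set O := Subalgebra.toSubmodule (integralClosure ℤ_[p] (∀ i, K i)) with hO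
  have := Module.IsTorsionFree.trans_faithfulSMul ℤ_[p] ℚ_[p] (∀ i, K i)
  let b := Module.finBasis ℤ_[p] O
  have hl : ∀ a : ∀ i, K i, IsIntegral ℤ_[p] a → ∃ A, latticeEnd b A = Algebra.lmul ℚ_[p] _ a :=
    fun a ha => (mem_stab_iff_range b _).1 (lmul_mem_stab fun m hm =>
      (integralClosure ℤ_[p] (∀ i, K i)).mul_mem ha hm)
  obtain ⟨k, w, hw, hk⟩ := mem_maxPow_one_iff.1 hz
  obtain ⟨A, hA⟩ := hl z (mem_maxPow_zero.1 (maxPow_le_zero _ hz))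
  obtain ⟨B, hB⟩ := hl w hw
  have h1 : A ^ k = (p : ℤ_[p]) • B := latticeEnd_injective b (by
    rw [map_pow, map_smul, hA, hB, ← map_pow, hk, ← IsScalarTower.algebraMap_smul ℚ_[p], map_smul,
      IsScalarTower.algebraMap_smul])
  have h2 : Algebra.trace ℚ_[p] (∀ i, K i) z = algebraMap ℤ_[p] ℚ_[p] A.trace := by
    change LinearMap.trace _ _ (Algebra.lmul ℚ_[p] _ z) = _
    rw [← hA, LinearMap.trace_eq_matrix_trace ℚ_[p] (b.extendOfIsLattice ℚ_[p])]
    refine (congrArg Matrix.trace (LinearMap.toMatrix_toLin (b.extendOfIsLattice ℚ_[p])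
      (b.extendOfIsLattice ℚ_[p]) ((Algebra.ofId ℤ_[p] ℚ_[p]).mapMatrix A))).trans ?_
    exact (AddMonoidHom.map_trace (algebraMap ℤ_[p] ℚ_[p]) A).symm
  have h3 : IsNilpotent (PadicInt.toZMod A.trace) := by
    rw [AddMonoidHom.map_trace (PadicInt.toZMod (p := p)) A]
    refine Matrix.isNilpotent_trace_of_isNilpotent ⟨k, ?_⟩
    have h4 := map_pow (PadicInt.toZMod (p := p)).mapMatrix A k
    rw [h1] at h4
    refine h4.symm.trans (Matrix.ext fun i j => ?_)
    change PadicInt.toZMod ((p : ℤ_[p]) * B i j) = 0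
    rw [map_mul, map_natCast, CharP.cast_eq_zero, zero_mul]
  have h4 := h3.eq_zero
  have h5 : A.trace ∈ RingHom.ker (PadicInt.toZMod (p := p)) := h4
  rw [PadicInt.ker_toZMod, PadicInt.maximalIdeal_eq_span_p, Ideal.mem_span_singleton] at h5
  obtain ⟨c, hc⟩ := h5
  exact ⟨c, by rw [h2, hc]⟩

end Units

/-! ### Commensurability of lattices -/

section Commensurable

variable {p : ℕ} [Fact p.Prime] {E : Type*} [CommRing E] [Algebra ℚ_[p] E]
  [Algebra ℤ_[p] E] [IsScalarTower ℤ_[p] ℚ_[p] E]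

theorem exists_pow_mul_eq_algebraMap (c : ℚ_[p]) :
    ∃ k : ℕ, ∃ a : ℤ_[p], (p : ℚ_[p]) ^ k * c = algebraMap ℤ_[p] ℚ_[p] a := by
  obtain ⟨k, hk⟩ := pow_unbounded_of_one_lt ‖c‖
    (show (1 : ℝ) < p by exact_mod_cast (Fact.out : p.Prime).one_lt)
  refine ⟨k, ⟨(p : ℚ_[p]) ^ k * c, ?_⟩, rfl⟩
  have hp : (0 : ℝ) < (p : ℝ) ^ k := pow_pos (by exact_mod_cast (Fact.out : p.Prime).pos) k
  rw [norm_mul, norm_pow, Padic.norm_p, inv_pow, inv_mul_le_iff₀ hp, mul_one]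
  exact hk.le

theorem exists_pow_smul_mem {L : Submodule ℤ_[p] E}
    (hL : Submodule.span ℚ_[p] (L : Set E) = ⊤) (m : E) : ∃ k : ℕ, (p : ℤ_[p]) ^ k • m ∈ L := by
  have hm : m ∈ Submodule.span ℚ_[p] (L : Set E) := hL ▸ Submodule.mem_top
  induction hm using Submodule.span_induction with
  | mem m hm => exact ⟨0, by rwa [pow_zero, one_smul]⟩
  | zero => exact ⟨0, by rw [smul_zero]; exact zero_mem _⟩
  | add a b _ _ ha hb =>
    obtain ⟨k, hk⟩ := ha
    obtain ⟨l, hl⟩ := hb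
    refine ⟨k + l, ?_⟩
    rw [smul_add]
    refine L.add_mem ?_ ?_
    · rw [add_comm, pow_add, mul_smul]; exact L.smul_mem _ hk
    · rw [pow_add, mul_smul]; exact L.smul_mem _ hl
  | smul c a _ ha =>
    obtain ⟨k, hk⟩ := ha
    obtain ⟨l, d, hd⟩ := exists_pow_mul_eq_algebraMap c
    refine ⟨l + k, ?_⟩
    have h : (p : ℤ_[p]) ^ (l + k) • c • a = d • (p : ℤ_[p]) ^ k • a := by
      simp only [← IsScalarTower.algebraMap_smul ℚ_[p] (_ : ℤ_[p]) (_ : E), smul_smul, ← hd,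
        map_pow, map_natCast]
      congr 1
      ring
    rw [h]
    exact L.smul_mem _ hk

theorem exists_pow_smul_le {L M : Submodule ℤ_[p] E}
    (hL : Submodule.span ℚ_[p] (L : Set E) = ⊤) (hM : M.FG) :
    ∃ k : ℕ, ∀ m ∈ M, (p : ℤ_[p]) ^ k • m ∈ L := by
  classical
  obtain ⟨S, rfl⟩ := hM
  choose k hk using exists_pow_smul_mem hL
  refine ⟨∑ m ∈ S, k m, fun m hm => ?_⟩
  induction hm using Submodule.span_induction with
  | mem m hm =>
    rw [← Finset.sum_erase_add _ _ hm, pow_add, mul_smul]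
    exact L.smul_mem _ (hk m)
  | zero => rw [smul_zero]; exact zero_mem _
  | add a b _ _ ha hb => rw [smul_add]; exact L.add_mem ha hb
  | smul c a _ ha => rw [smul_comm]; exact L.smul_mem _ ha

theorem lmul_mem_powStab_iff {x a : E} {N : ℕ} : Algebra.lmul ℚ_[p] E a ∈ powStab p x N ↔
    a ∈ (order p x).toAddSubgroup.map (DistribSMul.toAddMonoidHom E ((p : ℤ_[p]) ^ N)) := by
  constructor
  · rintro ⟨w, hw, h⟩
    refine ⟨w 1, hw 1 (Algebra.adjoin ℤ_[p] {x}).one_mem, ?_⟩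
    have h1 := congrArg (fun T : Module.End ℚ_[p] E => T 1) h
    rw [lmul_apply_apply, mul_one] at h1
    exact h1
  · rintro ⟨e, he, rfl⟩
    refine ⟨Algebra.lmul ℚ_[p] E e, fun m hm => (Algebra.adjoin ℤ_[p] {x}).mul_mem he hm, ?_⟩
    change (p : ℤ_[p]) ^ N • _ = Algebra.lmul ℚ_[p] E ((p : ℤ_[p]) ^ N • e)
    rw [← IsScalarTower.algebraMap_smul ℚ_[p], ← IsScalarTower.algebraMap_smul ℚ_[p] _ e, map_smul]

end Commensurable

/-! ### The index of a congruence subgroup in the units of `𝒪_E` -/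

section UnitIndex

variable {p : ℕ} [Fact p.Prime] {ι : Type*} [Fintype ι] {K : ι → Type*} [∀ i, Field (K i)]
  [∀ i, Algebra ℚ_[p] (K i)] [∀ i, FiniteDimensional ℚ_[p] (K i)]
  [∀ i, Algebra ℤ_[p] (K i)] [∀ i, IsScalarTower ℤ_[p] ℚ_[p] (K i)] {x : ∀ i, K i}

variable (p K) in
/-- The projection of the ring of integers of a product to a factor. -/
noncomputable def integersProj (i : ι) :
    integralClosure ℤ_[p] (∀ i, K i) →ₐ[ℤ_[p]] integralClosure ℤ_[p] (K i) :=
  ((Pi.evalAlgHom ℤ_[p] K i).comp (integralClosure ℤ_[p] (∀ i, K i)).val).codRestrict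
    (integralClosure ℤ_[p] (K i)) fun a => isIntegral_pi_iff.1 a.2 i

variable (p K) in
/-- The reduction of the ring of integers of a product modulo its radical. -/
noncomputable def piResidue : integralClosure ℤ_[p] (∀ i, K i) →+*
    ∀ i, IsLocalRing.ResidueField (integralClosure ℤ_[p] (K i)) :=
  RingHom.pi fun i => (IsLocalRing.residue _).comp (integersProj p K i : _ →+* _)

instance : IsLocalHom (piResidue p K) where
  map_nonunit a ha := by
    have h1 : ∀ i, IsUnit (integersProj p K i a) := fun i => by
      have h2 : IsUnit (IsLocalRing.residue _ (integersProj p K i a)) :=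
        ha.map (Pi.evalRingHom (fun i => IsLocalRing.ResidueField (integralClosure ℤ_[p] (K i))) i)
      exact isUnit_of_map_unit _ _ h2
    choose c hc using fun i => (h1 i).exists_right_inv
    refine IsUnit.of_mul_eq_one (⟨fun i => c i, isIntegral_pi_iff.2 fun i => (c i).2⟩ :
      integralClosure ℤ_[p] (∀ i, K i)) (Subtype.ext (funext fun i => ?_))
    exact congrArg Subtype.val (hc i)

theorem piResidue_surjective : Function.Surjective (piResidue p K) := by
  intro b
  choose a ha using fun i => IsLocalRing.residue_surjective (b i)
  exact ⟨⟨fun i => a i, isIntegral_pi_iff.2 fun i => (a i).2⟩, funext ha⟩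

theorem piResidue_eq_zero_iff (a : integralClosure ℤ_[p] (∀ i, K i)) :
    piResidue p K a = 0 ↔ (a : ∀ i, K i) ∈ maxPow p K 1 := by
  rw [mem_maxPow, funext_iff]
  refine forall_congr' fun i => ?_
  rw [Pi.one_apply, pow_one]
  refine (IsLocalRing.residue_eq_zero_iff (integersProj p K i a)).trans ?_
  exact ⟨fun h => ⟨_, h, rfl⟩, fun ⟨b, hb, h⟩ => (Subtype.ext h : b = integersProj p K i a) ▸ hb⟩

theorem smul_pow_mem_maxPow_one (hx : IsIntegral ℤ_[p] x) {N : ℕ} (hN : 0 < N) :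
    (order p x).toAddSubgroup.map (DistribSMul.toAddMonoidHom _ ((p : ℤ_[p]) ^ N)) ≤
      maxPow p K 1 := by
  rintro _ ⟨e, he, rfl⟩
  refine mem_maxPow_one_iff.2 ⟨1, (p : ℤ_[p]) ^ (N - 1) • e,
    (integralClosure ℤ_[p] (∀ i, K i)).smul_mem (order_le_integers hx he) _, ?_⟩
  rw [pow_one, smul_smul, ← pow_succ', Nat.sub_add_cancel hN]
  rfl

/-- This is `index_onePlus` for the reduction of `𝒪` onto the product of the residue fields, with
kernel the radical and `J = p ^ N R`. -/
theorem relIndex_onePlus_integerUnits (hx : IsIntegral ℤ_[p] x) [hl : (order p x).IsLattice ℚ_[p]]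
    {N : ℕ} (hN : 0 < N) :
    (onePlus (powStab p x N) powStab_mul_mem).relIndex (integerUnits p (∀ i, K i)) =
      (∏ i, (Nat.card (IsLocalRing.ResidueField (integralClosure ℤ_[p] (K i))) - 1)) *
        ((order p x).toAddSubgroup.map
          (DistribSMul.toAddMonoidHom _ ((p : ℤ_[p]) ^ N))).relIndex (maxPow p K 1) := by
  set O := integralClosure ℤ_[p] (∀ i, K i) with hO
  set W : AddSubgroup (∀ i, K i) :=
    (order p x).toAddSubgroup.map (DistribSMul.toAddMonoidHom _ ((p : ℤ_[p]) ^ N)) with hW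
  let J : AddSubgroup O := W.comap (O.val : O →+ ∀ i, K i)
  have hJ : ∀ a ∈ J, ∀ b ∈ J, a * b ∈ J := by
    rintro a ⟨e, he, h⟩ b ⟨e', he', h'⟩
    refine ⟨e * (p : ℤ_[p]) ^ N • e', (Algebra.adjoin ℤ_[p] {x}).mul_mem he
      ((order p x).smul_mem _ he'), ?_⟩
    change _ = (a : ∀ i, K i) * b
    rw [← show _ = (a : ∀ i, K i) from h, ← show _ = (b : ∀ i, K i) from h']
    exact (smul_mul_assoc _ _ _).symm
  obtain ⟨c, hc⟩ := exists_pow_smul_le hl.span_eq_top (integers_fg p K)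
  -- As `p ^ c 𝒪 ⊆ R`, the ideal `p ^ (N + c) 𝒪` lies in `p ^ N R`; it is the auxiliary ideal needed
  -- by `index_onePlus`.
  let I : AddSubgroup O := ((Subalgebra.toSubmodule O).toAddSubgroup.map
    (DistribSMul.toAddMonoidHom _ ((p : ℤ_[p]) ^ (N + c)))).comap (O.val : O →+ ∀ i, K i)
  have hIJ : I ≤ J := by
    rintro a ⟨e, he, h⟩
    refine ⟨_, hc e he, ?_⟩
    rw [← h]
    change (p : ℤ_[p]) ^ N • (p : ℤ_[p]) ^ c • e = (p : ℤ_[p]) ^ (N + c) • e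
    rw [pow_add, mul_smul]
  have hmap : (⊤ : AddSubgroup O).map (O.val : O →+ ∀ i, K i) =
      (Subalgebra.toSubmodule O).toAddSubgroup := by
    ext z
    exact ⟨fun ⟨a, _, h⟩ => h ▸ a.2, fun h => ⟨⟨z, h⟩, trivial, rfl⟩⟩
  have hI0 : I.index ≠ 0 := by
    rw [← AddSubgroup.relIndex_top_right, AddSubgroup.relIndex_comap, hmap]
    exact relIndex_smul_ne_zero _ (integers_fg p K) _
  have hker : ((piResidue p K : O →+ ∀ i, IsLocalRing.ResidueField (integralClosure ℤ_[p] (K i))).ker).map (O.val : O →+ ∀ i, K i) = maxPow p K 1 := by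
    ext z
    constructor
    · rintro ⟨a, ha, rfl⟩
      exact (piResidue_eq_zero_iff a).1 ha
    · intro h
      exact ⟨⟨z, mem_maxPow_zero.1 (maxPow_le_zero _ h)⟩, (piResidue_eq_zero_iff _).2 h, rfl⟩
  have h1 := index_onePlus (piResidue p K) piResidue_surjective (I := I) (J := J) hJ
    (by
      rintro a b ⟨e, he, h⟩
      refine ⟨(a : ∀ i, K i) * e, O.mul_mem a.2 he, ?_⟩
      change _ = (a : ∀ i, K i) * b
      rw [← show _ = (b : ∀ i, K i) from h]
      exact (mul_smul_comm _ _ _).symm)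
    hIJ (fun a ha => (piResidue_eq_zero_iff a).2 (smul_pow_mem_maxPow_one hx hN ha))
    (by
      rintro a ⟨e, he, h⟩
      have hu : (p : ℤ_[p]) ^ (N - 1) • Algebra.lmul ℚ_[p] _ e ∈ stab (order p x) :=
        (stab (order p x)).smul_mem
          (fun m hm => (Algebra.adjoin ℤ_[p] {x}).mul_mem he hm) _
      obtain ⟨t, ht, ht'⟩ := isUnit_one_add_stab hu
      have h2 : (t : Module.End ℚ_[p] (∀ i, K i)) = Algebra.lmul ℚ_[p] _ (1 + (a : ∀ i, K i)) := by
        rw [ht, smul_smul, ← pow_succ', Nat.sub_add_cancel hN, map_add, map_one,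
          ← show _ = (a : ∀ i, K i) from h]
        congr 1
        change _ = Algebra.lmul ℚ_[p] _ ((p : ℤ_[p]) ^ N • e)
        rw [← IsScalarTower.algebraMap_smul ℚ_[p], ← IsScalarTower.algebraMap_smul ℚ_[p] _ e, map_smul]
      set w : ∀ i, K i := ((t⁻¹ : (Module.End ℚ_[p] (∀ i, K i))ˣ) : Module.End ℚ_[p] (∀ i, K i)) 1
        with hw
      have hwR : w ∈ order p x := ht' 1 (Algebra.adjoin ℤ_[p] {x}).one_mem
      have h3 : (1 + (a : ∀ i, K i)) * w = 1 := by
        have h4 := congrArg (fun T : Module.End ℚ_[p] (∀ i, K i) => T 1) (t.mul_inv)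
        rw [h2] at h4
        exact h4
      have h5 : w - 1 = (p : ℤ_[p]) ^ N • -(e * w) := by
        have h6 : (a : ∀ i, K i) = (p : ℤ_[p]) ^ N • e := h.symm
        rw [h6, add_mul, one_mul, smul_mul_assoc] at h3
        rw [smul_neg, ← h3]
        abel
      let wO : O := ⟨w, order_le_integers hx hwR⟩
      have h7 : (1 + a) * wO = 1 := Subtype.ext h3
      refine ⟨⟨1 + a, wO, h7, by rw [mul_comm, h7]⟩, ⟨?_, ?_⟩, rfl⟩
      · change 1 + a - 1 ∈ J
        rw [add_sub_cancel_left]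
        exact ⟨e, he, h⟩
      · exact ⟨-(e * w), neg_mem ((Algebra.adjoin ℤ_[p] {x}).mul_mem he hwR), h5.symm⟩)
    (fun h0 => hI0 (by rw [← AddSubgroup.relIndex_mul_index hIJ, h0, zero_mul]))
  rw [AddSubgroup.relIndex_comap, hker] at h1
  have h8 : Nat.card (∀ i, IsLocalRing.ResidueField (integralClosure ℤ_[p] (K i)))ˣ =
      ∏ i, (Nat.card (IsLocalRing.ResidueField (integralClosure ℤ_[p] (K i))) - 1) := by
    rw [Nat.card_congr MulEquiv.piUnits.toEquiv, Nat.card_pi]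
    exact Finset.prod_congr rfl fun i _ => Nat.card_units _
  rw [integerUnits, ← Subgroup.index_comap, ← h8, ← h1]
  have h9 : ∀ v : Oˣ, Algebra.lmul ℚ_[p] _ ((v : O) : ∀ i, K i) - 1 ∈ powStab p x N ↔
      (v : O) - 1 ∈ J := fun v => by
    have h10 := lmul_mem_powStab_iff (p := p) (x := x) (N := N) (a := ((v : O) : ∀ i, K i) - 1)
    rw [map_sub, map_one] at h10
    exact h10
  congr 1
  ext u
  exact and_congr (h9 u) (h9 u⁻¹)

end UnitIndex

/-! ### The polynomial `Z`, its discriminant and the size of `L` -/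

section Generator

open Polynomial

variable {p : ℕ} [Fact p.Prime] {ι : Type*} [Fintype ι] {K : ι → Type*} [∀ i, Field (K i)]
  [∀ i, Algebra ℚ_[p] (K i)] [∀ i, FiniteDimensional ℚ_[p] (K i)]
  [∀ i, Algebra ℤ_[p] (K i)] [∀ i, IsScalarTower ℤ_[p] ℚ_[p] (K i)] {x : ∀ i, K i}
  {Z : ℤ_[p][X]} {r : ℕ}

theorem aeval_pi_apply {R κ : Type*} [CommRing R] {A : κ → Type*} [∀ i, CommRing (A i)]
    [∀ i, Algebra R (A i)] (z : ∀ i, A i) (f : R[X]) (i : κ) : aeval z f i = aeval (z i) f :=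
  (aeval_algHom_apply (Pi.evalAlgHom R A i) z f).symm

theorem exists_monic_map_eq_polyZ (hx : IsIntegral ℤ_[p] x) : ∃ Z : ℤ_[p][X], Z.Monic ∧
    Z.map (algebraMap ℤ_[p] ℚ_[p]) = polyZ p x ∧ aeval x Z = 0 := by
  have h := isIntegral_pi_iff.1 hx
  refine ⟨∏ i, minpoly ℤ_[p] (x i), monic_prod_of_monic _ _ fun i _ => minpoly.monic (h i), ?_, ?_⟩
  · rw [polyZ, Polynomial.map_prod]
    exact Finset.prod_congr rfl fun i _ =>
      (minpoly.isIntegrallyClosed_eq_field_fractions' ℚ_[p] (h i)).symm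
  · funext i
    rw [aeval_pi_apply, map_prod]
    exact Finset.prod_eq_zero (Finset.mem_univ i) (minpoly.aeval ℤ_[p] (x i))

theorem adjoin_apply_eq_top (hgen : Algebra.adjoin ℚ_[p] {x} = ⊤) (i : ι) :
    Algebra.adjoin ℚ_[p] {x i} = ⊤ := by
  have h := congrArg (Subalgebra.map (Pi.evalAlgHom ℚ_[p] K i)) hgen
  rw [AlgHom.map_adjoin_singleton, Algebra.map_top] at h
  refine h.trans ((AlgHom.range_eq_top _).2 ?_)
  exact Function.surjective_eval i

theorem natDegree_polyZ (hgen : Algebra.adjoin ℚ_[p] {x} = ⊤) :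
    (polyZ p x).natDegree = ∑ i, Module.finrank ℚ_[p] (K i) := by
  rw [polyZ, natDegree_prod_of_monic _ _ fun i _ => minpoly.monic (Algebra.IsIntegral.isIntegral _)]
  refine Finset.sum_congr rfl fun i _ => (Field.primitive_element_iff_minpoly_natDegree_eq _ _).1 ?_
  refine IntermediateField.toSubalgebra_injective (top_le_iff.1 ?_)
  rw [← adjoin_apply_eq_top hgen i]
  exact IntermediateField.algebra_adjoin_le_adjoin _ _

theorem exists_basis_pow {F E : Type*} [Field F] [CommRing E] [Algebra F E] {x : E} {Z : F[X]}
    {r : ℕ} (hgen : Algebra.adjoin F {x} = ⊤) (hZ : Z.Monic) (hx : aeval x Z = 0)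
    (hr : Z.natDegree = r) (hE : Module.finrank F E = r) :
    ∃ b : Module.Basis (Fin r) F E, ∀ k, b k = x ^ (k : ℕ) := by
  classical
  refine ⟨basisOfTopLeSpanOfCardEqFinrank (fun k : Fin r => x ^ (k : ℕ)) ?_
    (by rw [Fintype.card_fin, hE]), fun k => by rw [coe_basisOfTopLeSpanOfCardEqFinrank]⟩
  rw [← Algebra.top_toSubmodule, ← hgen, ← Submodule.span_range_natDegree_eq_adjoin hZ hx, hr]
  refine Submodule.span_mono ?_
  intro y hy
  rw [Finset.mem_coe, Finset.mem_image] at hy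
  obtain ⟨k, hk, rfl⟩ := hy
  exact ⟨⟨k, Finset.mem_range.1 hk⟩, rfl⟩

theorem val_neg_one_pow_mul (n : ℕ) (c : ℚ_[p]) : val (p := p) ((-1) ^ n * c) = val (p := p) c := by
  have h : val (p := p) (-c) = val (p := p) c := by
    rcases eq_or_ne c 0 with rfl | hc
    · rw [neg_zero]
    · rw [val_of_ne_zero hc, val_of_ne_zero (neg_ne_zero.2 hc),
        spectralNorm_neg (Algebra.IsAlgebraic.isAlgebraic c)]
  rcases neg_one_pow_eq_or ℚ_[p] n with h1 | h1 <;> rw [h1]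
  · rw [one_mul]
  · rw [neg_one_mul, h]

/-- The Bézout relation `Z f + Z' g = Res(Z, Z')` evaluated at `x` leaves `Z'(x) g(x)`, and for
monic `Z` the resultant is the discriminant up to sign. -/
theorem exists_derivative_mul_eq (hx : aeval x Z = 0) (hZ : Z.Monic) (hr : 0 < Z.natDegree) :
    ∃ D : ℤ_[p], ∃ β ∈ order p x, aeval x (derivative Z) * β = algebraMap ℤ_[p] _ D ∧
      val (p := p) (algebraMap ℤ_[p] ℚ_[p] D) =
        val (p := p) (Z.map (algebraMap ℤ_[p] ℚ_[p])).discr := by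
  refine ⟨resultant Z (derivative Z) Z.natDegree (Z.natDegree - 1), ?_⟩
  obtain ⟨f, g, -, -, h⟩ := exists_mul_add_mul_eq_C_resultant (m := Z.natDegree)
    (n := Z.natDegree - 1) Z (derivative Z) le_rfl (natDegree_derivative_le Z) (Or.inl hr.ne')
  refine ⟨aeval x g, ?_, ?_, ?_⟩
  · change aeval x g ∈ Algebra.adjoin ℤ_[p] {x}
    rw [Algebra.adjoin_singleton_eq_range_aeval]
    exact ⟨g, rfl⟩
  · have h1 := congrArg (aeval x) h
    rwa [map_add, map_mul, hx, zero_mul, zero_add, map_mul, aeval_C] at h1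
  · have hd : (Z.map (algebraMap ℤ_[p] ℚ_[p])).natDegree = Z.natDegree := hZ.natDegree_map _
    have h1 := resultant_deriv (f := Z.map (algebraMap ℤ_[p] ℚ_[p]))
      (natDegree_pos_iff_degree_pos.1 (hd ▸ hr))
    rw [hd, derivative_map, resultant_map_map, (hZ.map _).leadingCoeff, mul_one] at h1
    rw [h1, val_neg_one_pow_mul]

/-- From `Z'(x) β = D` with `β` integral, `val (Z'(x_i)) ≤ val D`. For `r ≥ 2` this gives `val z_i >
r val D - val (Z'(x_i)) ≥ val D`; for `r = 1` the derivative is `1`. So `z / D` lies in the radical.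
-/
theorem exists_discriminant_bound (hx : aeval x Z = 0) (hZ : Z.Monic)
    (hZp : Z.map (algebraMap ℤ_[p] ℚ_[p]) = polyZ p x) (hr : Z.natDegree = r)
    (hxint : IsIntegral ℤ_[p] x)
    (hK : r = ∑ i, Module.finrank ℚ_[p] (K i)) {s : ι → ℝ}
    (hs : ∀ i, r • val (p := p) (polyZ p x).discr < ((s i : ℝ) : WithTop ℝ)) :
    ∃ D : ℤ_[p], D ≠ 0 ∧ (∃ β ∈ order p x, aeval x (derivative Z) * β = algebraMap ℤ_[p] _ D) ∧
      ∀ z : ∀ i, K i, (∀ i, ((s i : ℝ) : WithTop ℝ) ≤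
        val (p := p) (z i) + val (p := p) (aeval x (derivative Z) i)) →
        ∃ m ∈ maxPow p K 1, z = D • m := by
  cases isEmpty_or_nonempty ι with
  | inl hι =>
    refine ⟨1, one_ne_zero, ⟨1, (Algebra.adjoin ℤ_[p] {x}).one_mem, Subsingleton.elim _ _⟩,
      fun z _ => ⟨0, zero_mem _, Subsingleton.elim _ _⟩⟩
  | inr hι =>
    obtain ⟨i₀⟩ := hι
    have hr0 : 0 < r := by
      rw [hK]
      exact Finset.sum_pos (fun i _ => Module.finrank_pos) ⟨i₀, Finset.mem_univ _⟩
    obtain ⟨D, β, hβ, hD, hval⟩ := exists_derivative_mul_eq hx hZ (hr ▸ hr0)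
    rw [hZp] at hval
    -- A zero discriminant has valuation `⊤`, and as `r > 0` the strict bound `hs` excludes it.
    have hD0 : D ≠ 0 := by
      rintro rfl
      have h := hs i₀
      rw [← hval, map_zero, val_zero, ← Nat.sub_add_cancel hr0, succ_nsmul, WithTop.add_top] at h
      exact not_top_lt h
    refine ⟨D, hD0, ⟨β, hβ, hD⟩, fun z hz => ?_⟩
    have hDq : algebraMap ℤ_[p] ℚ_[p] D ≠ 0 := by
      rw [Ne, FaithfulSMul.algebraMap_eq_zero_iff]
      exact hD0
    have hDK : ∀ i, algebraMap ℤ_[p] (K i) D ≠ 0 := fun i => by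
      rw [IsScalarTower.algebraMap_apply ℤ_[p] ℚ_[p], Ne, map_eq_zero]
      exact hDq
    have hvalK : ∀ i, val (p := p) (algebraMap ℤ_[p] (K i) D) = val (p := p) (polyZ p x).discr :=
      fun i => by rw [IsScalarTower.algebraMap_apply ℤ_[p] ℚ_[p], val_algebraMap, hval]
    refine ⟨fun i => z i / algebraMap ℤ_[p] (K i) D, mem_maxPow_one.2 fun i => ?_, funext fun i => ?_⟩
    · set u := aeval x (derivative Z) with hu
      have hDi : u i * β i = algebraMap ℤ_[p] (K i) D := congrFun hD i
      have hu0 : u i ≠ 0 := fun h => hDK i (by rw [← hDi, h, zero_mul])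
      rcases eq_or_ne (z i) 0 with hz0 | hz0
      · rw [hz0, zero_div, val_zero]
        exact WithTop.top_pos
      have hm0 : z i / algebraMap ℤ_[p] (K i) D ≠ 0 := div_ne_zero hz0 (hDK i)
      have h1 : val (p := p) (z i) = val (p := p) (z i / algebraMap ℤ_[p] (K i) D) +
          val (p := p) (algebraMap ℤ_[p] (K i) D) := by
        rw [← val_mul, div_mul_cancel₀ _ (hDK i)]
      have h2 : val (p := p) (u i) ≤ val (p := p) (algebraMap ℤ_[p] (K i) D) := by
        rw [← hDi, val_mul]
        exact le_add_of_nonneg_right ((val_nonneg_iff _).2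
          (isIntegral_pi_iff.1 (order_le_integers hxint hβ) i))
      have h3 : 0 ≤ val (p := p) (algebraMap ℤ_[p] (K i) D) :=
        (val_nonneg_iff _).2 isIntegral_algebraMap
      have h4 : r = 1 → val (p := p) (u i) = 0 := fun h => by
        rw [hu, (hZ.eq_X_add_C (hr.trans h)), derivative_add, derivative_X, derivative_C, add_zero,
          map_one, Pi.one_apply, val_one]
      have h5 := hs i
      have h6 := hz i
      rw [← hvalK i] at h5
      rw [h1] at h6
      lift val (p := p) (z i / algebraMap ℤ_[p] (K i) D) to ℝ using val_ne_top hm0 with a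
      lift val (p := p) (algebraMap ℤ_[p] (K i) D) to ℝ using val_ne_top (hDK i) with d
      lift val (p := p) (u i) to ℝ using val_ne_top hu0 with v
      norm_cast at h2 h3 h4 h5 h6 ⊢
      rw [nsmul_eq_mul] at h5
      rcases Nat.lt_or_ge 1 r with h7 | h7
      · have h8 : (2 : ℝ) ≤ r := by exact_mod_cast h7
        nlinarith
      · have h8 : r = 1 := le_antisymm h7 hr0
        rw [h8, Nat.cast_one] at h5
        have := h4 h8
        linarith
    · rw [Pi.smul_apply, Algebra.smul_def, mul_div_cancel₀ _ (hDK i)]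

end Generator

/-! ### Points of `x + L` in distinct orbits -/

section Rigidity

open Polynomial

/-- As `y` generates `E`, conjugation by `g` carries every multiplication to a multiplication; the
induced map on `E` inherits the ring structure because multiplication operators are faithful. -/
theorem exists_algHom_of_conj {F E : Type*} [Field F] [CommRing E] [Algebra F E] {y y' : E}
    (hy : Algebra.adjoin F {y} = ⊤) (g : (Module.End F E)ˣ)
    (h : (g : Module.End F E) * Algebra.lmul F E y = Algebra.lmul F E y' * g) :
    ∃ σ : E →ₐ[F] E, ∀ a, (g : Module.End F E) * Algebra.lmul F E a = Algebra.lmul F E (σ a) * g := by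
  have hinj : ∀ a b, Algebra.lmul F E a * (g : Module.End F E) = Algebra.lmul F E b * g → a = b :=
    fun a b hab => Algebra.lmul_injective ((Units.mul_left_inj g).1 hab)
  have key : ∀ a, ∃ a', (g : Module.End F E) * Algebra.lmul F E a = Algebra.lmul F E a' * g := by
    intro a
    have ha : a ∈ Algebra.adjoin F {y} := hy ▸ Algebra.mem_top
    induction ha using Algebra.adjoin_induction with
    | mem a ha => rw [Set.mem_singleton_iff.1 ha]; exact ⟨_, h⟩
    | algebraMap c =>
      exact ⟨algebraMap F E c, by rw [AlgHom.commutes]; exact (Algebra.commutes c _).symm⟩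
    | add a b _ _ ha hb =>
      obtain ⟨a', ha⟩ := ha
      obtain ⟨b', hb⟩ := hb
      exact ⟨a' + b', by rw [map_add, map_add, mul_add, add_mul, ha, hb]⟩
    | mul a b _ _ ha hb =>
      obtain ⟨a', ha⟩ := ha
      obtain ⟨b', hb⟩ := hb
      exact ⟨a' * b', by rw [map_mul, map_mul, ← mul_assoc, ha, mul_assoc, hb, mul_assoc]⟩
  choose σ hσ using key
  let τ : E →+* E :=
    { toFun := σ
      map_one' := hinj _ _ (by rw [← hσ, map_one, mul_one, one_mul])
      map_mul' := fun a b => hinj _ _ (by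
        rw [← hσ, map_mul, map_mul, ← mul_assoc, hσ, mul_assoc, hσ, mul_assoc])
      map_zero' := hinj _ _ (by rw [← hσ, map_zero, mul_zero, zero_mul])
      map_add' := fun a b => hinj _ _ (by
        rw [← hσ, map_add, map_add, mul_add, add_mul, hσ, hσ]) }
  refine ⟨{ τ with commutes' := fun c => hinj _ _ ?_ }, hσ⟩
  refine (hσ _).symm.trans ?_
  rw [AlgHom.commutes]
  exact (Algebra.commutes c _).symm

variable {p : ℕ} [Fact p.Prime] {ι : Type*} [Fintype ι] {K : ι → Type*} [∀ i, Field (K i)]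
  [∀ i, Algebra ℚ_[p] (K i)] [∀ i, FiniteDimensional ℚ_[p] (K i)]
  [∀ i, Algebra ℤ_[p] (K i)] [∀ i, IsScalarTower ℤ_[p] ℚ_[p] (K i)] {x : ∀ i, K i}
  {Z : ℤ_[p][X]}

/-- Taylor's formula is taken inside the integral closure, so that the quadratic coefficient is
integral. -/
theorem exists_aeval_add_eq {A E : Type*} [CommRing A] [CommRing E] [Algebra A E] {x w : E}
    (hx : IsIntegral A x) (hw : IsIntegral A w) (f : A[X]) : ∃ c, IsIntegral A c ∧
      aeval (x + w) f = aeval x f + aeval x (derivative f) * w + c * w ^ 2 := by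
  let O := integralClosure A E
  obtain ⟨c, hc⟩ := (f.map (algebraMap A O)).binomExpansion ⟨x, hx⟩ ⟨w, hw⟩
  refine ⟨c, c.2, ?_⟩
  have h : ∀ (h : A[X]) (a : O), (((h.map (algebraMap A O)).eval a : O) : E) = aeval (a : E) h :=
    fun h a => by
      rw [eval_map_algebraMap]
      exact (aeval_algHom_apply O.val a h).symm
  have h1 := congrArg (Subtype.val) hc
  rw [derivative_map] at h1
  rw [h] at h1
  simp only [AddMemClass.coe_add, MulMemClass.coe_mul, SubmonoidClass.coe_pow, h] at h1
  exact h1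

theorem map_mem_maxPow_one (σ : (∀ i, K i) →ₐ[ℚ_[p]] (∀ i, K i)) {m : ∀ i, K i}
    (hm : m ∈ maxPow p K 1) : σ m ∈ maxPow p K 1 := by
  obtain ⟨k, w, hw, h⟩ := mem_maxPow_one_iff.1 hm
  refine mem_maxPow_one_iff.2 ⟨k, σ w, hw.map (σ.restrictScalars ℤ_[p]), ?_⟩
  rw [← map_pow, h]
  exact map_smul (σ.restrictScalars ℤ_[p]) _ _

theorem eq_zero_of_mul_one_add {w ν : ∀ i, K i} (hν : ν ∈ maxPow p K 1) (h : w * (1 + ν) = 0) :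
    w = 0 := by
  funext i
  refine (mul_eq_zero.1 (congrFun h i)).resolve_right fun h1 => ?_
  have h2 : ν i = -1 := eq_neg_of_add_eq_zero_right h1
  have h3 := mem_maxPow_one.1 hν i
  have h4 : val (p := p) (ν i ^ 2) = 0 := by rw [h2, neg_one_sq, val_one]
  rw [val_pow] at h4
  exact (nsmul_pos h3 two_ne_zero).ne' h4

/-- Conjugation induces `σ : E → E` with `σ(x) = x + D μ`, where `μ` is in the radical. Both `x` and
`σ(x)` are roots of `Z`; Taylor's formula multiplied by `β` becomes `D ^ 2 μ (1 + c β μ) = 0`, and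
`1 + c β μ` is nonzero in each factor. Hence `μ = 0`, and `g` commutes with `x`. -/
theorem eq_of_conj (hgen : Algebra.adjoin ℚ_[p] {x} = ⊤) (hxint : IsIntegral ℤ_[p] x)
    (hx : aeval x Z = 0) (hfg : (order p x).FG) {D : ℤ_[p]} (hD0 : D ≠ 0) {β : ∀ i, K i}
    (hβ : IsIntegral ℤ_[p] β) (hD : aeval x (derivative Z) * β = algebraMap ℤ_[p] _ D)
    {z z' : ∀ i, K i} (hz : ∃ m ∈ maxPow p K 1, z = D • m) (hz' : ∃ m ∈ maxPow p K 1, z' = D • m)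
    (hzp : ∃ e ∈ order p x, z = (p : ℤ_[p]) • e) (g : (Module.End ℚ_[p] (∀ i, K i))ˣ)
    (h : (g : Module.End ℚ_[p] (∀ i, K i)) * Algebra.lmul ℚ_[p] _ (x + z) =
      Algebra.lmul ℚ_[p] _ (x + z') * g) :
    z = z' ∧ (g : Module.End ℚ_[p] (∀ i, K i)) * Algebra.lmul ℚ_[p] _ x =
      Algebra.lmul ℚ_[p] _ x * g := by
  obtain ⟨e, he, hze⟩ := hzp
  -- The point `x + z` is still a generator by Nakayama, since `z ∈ p ℤ_p[x]`.
  have hy : Algebra.adjoin ℚ_[p] {x + z} = ⊤ := by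
    rw [← top_le_iff, ← hgen]
    refine Algebra.adjoin_le (Set.singleton_subset_iff.2 ?_)
    have h1 : x ∈ Algebra.adjoin ℤ_[p] {x + z} :=
      mem_adjoin_of_sub_mem_smul p_mem_jacobson hfg he (by rw [hze])
    have h2 : Algebra.adjoin ℤ_[p] {x + z} ≤
        (Algebra.adjoin ℚ_[p] {x + z}).restrictScalars ℤ_[p] :=
      Algebra.adjoin_le Algebra.subset_adjoin
    exact h2 h1
  obtain ⟨σ, hσ⟩ := exists_algHom_of_conj hy g h
  have hσy : σ (x + z) = x + z' :=
    Algebra.lmul_injective ((Units.mul_left_inj g).1 ((hσ _).symm.trans h))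
  obtain ⟨m, hm, rfl⟩ := hz
  obtain ⟨m', hm', rfl⟩ := hz'
  set μ := m' - σ m with hμ
  have hμm : μ ∈ maxPow p K 1 := sub_mem hm' (map_mem_maxPow_one σ hm)
  have hw : σ x = x + D • μ := by
    have h1 : σ (D • m) = D • σ m := map_smul (σ.restrictScalars ℤ_[p]) _ _
    rw [map_add, h1] at hσy
    rw [hμ, smul_sub, ← add_sub_assoc, ← hσy, add_sub_cancel_right]
  obtain ⟨c, hc, h1⟩ := exists_aeval_add_eq hxint
    (((mem_maxPow_zero.1 (maxPow_le_zero _ hμm)).smul D)) Z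
  have h2 : aeval (σ x) Z = 0 := by
    have h3 := aeval_algHom_apply (σ.restrictScalars ℤ_[p]) x Z
    rw [hx, map_zero] at h3
    exact h3
  rw [← hw, h2, hx, zero_add] at h1
  have h3 : (D • (D • (μ * (1 + c * β * μ))) : ∀ i, K i) = 0 := by
    have h4 := congrArg (· * β) h1
    simp only [zero_mul, add_mul, Algebra.smul_def] at h4
    simp only [Algebra.smul_def]
    rw [← hD] at h4 ⊢
    rw [h4]
    ring
  have hDinj : ∀ a : ∀ i, K i, D • a = 0 → a = 0 := fun a ha => by
    have := Module.IsTorsionFree.trans_faithfulSMul ℤ_[p] ℚ_[p] (∀ i, K i)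
    exact (smul_eq_zero.1 ha).resolve_left hD0
  have h5 := eq_zero_of_mul_one_add (mul_mem_maxPow (hc.mul hβ) hμm) (hDinj _ (hDinj _ h3))
  rw [h5, smul_zero, add_zero] at hw
  have h6 := hσ x
  rw [hw] at h6
  have h7 := eq_lmul_of_commute hgen h6
  refine ⟨?_, h6⟩
  have h8 : Algebra.lmul ℚ_[p] _ (x + D • m) * (g : Module.End ℚ_[p] (∀ i, K i)) =
      Algebra.lmul ℚ_[p] _ (x + D • m') * g := by
    rw [← h, h7, ← map_mul, ← map_mul, mul_comm]
  exact add_left_cancel (Algebra.lmul_injective ((Units.mul_left_inj g).1 h8))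

end Rigidity

/-! ### `Aut(M)` inside the units of `𝒪_E` -/

section Automorphisms

variable {p : ℕ} [Fact p.Prime] {E : Type*} [CommRing E] [Algebra ℚ_[p] E] [Algebra ℤ_[p] E]
  [IsScalarTower ℤ_[p] ℚ_[p] E] {x : E}

theorem isIntegral_of_lmul_mem_stab {M : Submodule ℤ_[p] E} [M.IsLattice ℚ_[p]] {a : E}
    (ha : Algebra.lmul ℚ_[p] E a ∈ stab M) : IsIntegral ℤ_[p] a := by
  have := Module.IsTorsionFree.trans_faithfulSMul ℤ_[p] ℚ_[p] E
  obtain ⟨A, hA⟩ := (mem_stab_iff_range (Module.finBasis ℤ_[p] M) _).1 ha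
  have h : IsIntegral ℤ_[p] A := Algebra.IsIntegral.isIntegral A
  have h1 := h.map (latticeEnd (Module.finBasis ℤ_[p] M))
  rw [hA] at h1
  exact (isIntegral_algHom_iff ((Algebra.lmul ℚ_[p] E).restrictScalars ℤ_[p])
    Algebra.lmul_injective).1 h1

/-- A map commuting with the generator `x` is a multiplication; since it and its inverse preserve a
lattice, both multipliers are integral. -/
theorem autLattice_le_integerUnits (hgen : Algebra.adjoin ℚ_[p] {x} = ⊤) {M : Submodule ℤ_[p] E}
    [M.IsLattice ℚ_[p]] : autLattice x M ≤ integerUnits p E := by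
  intro T hT
  obtain ⟨h1, h2, h3⟩ := mem_autLattice.1 hT
  have h1' := (mem_autLattice.1 (inv_mem hT)).1
  have e1 := eq_lmul_of_commute hgen h1
  have e2 := eq_lmul_of_commute hgen h1'
  rw [e1] at h2
  rw [e2] at h3
  set a := (T : Module.End ℚ_[p] E) 1 with ha
  set b := ((T⁻¹ : (Module.End ℚ_[p] E)ˣ) : Module.End ℚ_[p] E) 1 with hb
  have hab : a * b = 1 := Algebra.lmul_injective (R := ℚ_[p]) (by
    rw [map_mul, ← e1, ← e2, Units.mul_inv, map_one])
  let aO : integralClosure ℤ_[p] E := ⟨a, isIntegral_of_lmul_mem_stab h2⟩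
  let bO : integralClosure ℤ_[p] E := ⟨b, isIntegral_of_lmul_mem_stab h3⟩
  have h4 : aO * bO = 1 := Subtype.ext hab
  exact ⟨⟨aO, bO, h4, by rw [mul_comm, h4]⟩, Units.ext e1.symm⟩

/-- A unit congruent to `1` modulo `p ^ N R`, together with its inverse, lies in `R`, and `R` acts
on `M`. -/
theorem onePlus_inf_integerUnits_le {N : ℕ} {M : Submodule ℤ_[p] E}
    (hM : ∀ a ∈ order p x, ∀ m ∈ M, a * m ∈ M) :
    onePlus (powStab p x N) powStab_mul_mem ⊓ integerUnits p E ≤ autLattice x M := by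
  rintro T ⟨⟨h1, h2⟩, u, rfl⟩
  have key : ∀ v : E, Algebra.lmul ℚ_[p] E v - 1 ∈ powStab p x N →
      Algebra.lmul ℚ_[p] E v ∈ stab M := by
    intro v hv
    have h3 : Algebra.lmul ℚ_[p] E (v - 1) ∈ powStab p x N := by rwa [map_sub, map_one]
    obtain ⟨e, he, h4⟩ := lmul_mem_powStab_iff.1 h3
    refine lmul_mem_stab fun m hm => hM v ?_ m hm
    have h5 : v = (p : ℤ_[p]) ^ N • e + 1 := by rw [← sub_eq_iff_eq_add, ← h4]; rfl
    rw [h5]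
    exact add_mem ((order p x).smul_mem _ he) (Algebra.adjoin ℤ_[p] {x}).one_mem
  refine mem_autLattice.2 ⟨?_, key _ h1, key _ h2⟩
  change Algebra.lmul ℚ_[p] E _ * _ = _
  rw [← map_mul, mul_comm, map_mul]
  rfl

theorem relIndex_mul_relIndex_of_inf_le {G : Type*} [Group G] {H A U : Subgroup G} (hA : H ⊓ U ≤ A)
    (hU : A ≤ U) : H.relIndex A * A.relIndex U = H.relIndex U := by
  have h1 : H ⊓ A = H ⊓ U := le_antisymm (inf_le_inf_left _ hU) (le_inf inf_le_left hA)
  rw [← Subgroup.inf_relIndex_right H A, ← Subgroup.inf_relIndex_right H U, h1]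
  exact Subgroup.relIndex_mul_relIndex _ _ _ hA hU

end Automorphisms

/-! ### Lattice indices and the values of the polynomials in `F_Z` -/

section Final

open Polynomial

variable {p : ℕ} [Fact p.Prime] {ι : Type*} [Fintype ι] {K : ι → Type*} [∀ i, Field (K i)]
  [∀ i, Algebra ℚ_[p] (K i)] [∀ i, FiniteDimensional ℚ_[p] (K i)]
  [∀ i, Algebra ℤ_[p] (K i)] [∀ i, IsScalarTower ℤ_[p] ℚ_[p] (K i)] {x : ∀ i, K i}
  {Z : ℤ_[p][X]} {r : ℕ}

theorem mem_maxPow_iff_val {n : ι → ℕ} {z : ∀ i, K i} : z ∈ maxPow p K n ↔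
    ∀ i, (((n i : ℝ) / ramIndex p (K i) : ℝ) : WithTop ℝ) ≤ val (p := p) (z i) := by
  rw [mem_maxPow]
  exact forall_congr' fun i => (natCast_div_ramIndex_le_val_iff p (n i) (z i)).symm

theorem order_le_maxPow_zero (hx : IsIntegral ℤ_[p] x) :
    (order p x).toAddSubgroup ≤ maxPow p K 0 := fun _ ha =>
  mem_maxPow_zero.2 (order_le_integers hx ha)

theorem relIndex_order_ne_zero (hx : IsIntegral ℤ_[p] x) [hl : (order p x).IsLattice ℚ_[p]] :
    (order p x).toAddSubgroup.relIndex (maxPow p K 0) ≠ 0 := by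
  obtain ⟨c, hc⟩ := exists_pow_smul_le hl.span_eq_top (integers_fg p K)
  have h0 : maxPow p K 0 = (Subalgebra.toSubmodule (integralClosure ℤ_[p] (∀ i, K i))).toAddSubgroup :=
    AddSubgroup.ext fun _ => mem_maxPow_zero
  have h1 := relIndex_smul_ne_zero _ (integers_fg p K) c
  rw [← AddSubgroup.relIndex_mul_relIndex _ (order p x).toAddSubgroup _ ?_ ?_] at h1
  · rw [h0]
    exact right_ne_zero_of_mul h1
  · rintro _ ⟨e, he, rfl⟩
    exact hc e he
  · exact order_le_integers hx

/-- Computing `[𝒪 : u R]` through `R` and through `u 𝒪` gives `[𝒪 : R] [R : u R] = [𝒪 : u 𝒪] [u 𝒪 :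
u R]`, and multiplication by `u` identifies `[u 𝒪 : u R]` with `[𝒪 : R]`. -/
theorem relIndex_map_mulLeft (hx : IsIntegral ℤ_[p] x) [(order p x).IsLattice ℚ_[p]]
    {u : ∀ i, K i} (hu : u ∈ order p x) (hu' : IsUnit u) :
    ((order p x).toAddSubgroup.map (AddMonoidHom.mulLeft u)).relIndex (order p x).toAddSubgroup =
      ((maxPow p K 0).map (AddMonoidHom.mulLeft u)).relIndex (maxPow p K 0) := by
  have hinj : Function.Injective (AddMonoidHom.mulLeft u) := fun _ _ h => hu'.mul_left_cancel h
  have h1 := AddSubgroup.relIndex_mul_relIndex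
    ((order p x).toAddSubgroup.map (AddMonoidHom.mulLeft u)) _ _
    (AddSubgroup.map_mono (order_le_maxPow_zero (p := p) hx))
    (show (maxPow p K 0).map (AddMonoidHom.mulLeft u) ≤ maxPow p K 0 by
      rintro _ ⟨a, ha, rfl⟩
      exact mul_mem_maxPow (order_le_integers hx hu) ha)
  have h2 := AddSubgroup.relIndex_mul_relIndex
    ((order p x).toAddSubgroup.map (AddMonoidHom.mulLeft u)) (order p x).toAddSubgroup _
    (by
      rintro _ ⟨a, ha, rfl⟩
      exact (Algebra.adjoin ℤ_[p] {x}).mul_mem hu ha)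
    (order_le_maxPow_zero (p := p) hx)
  rw [AddSubgroup.relIndex_map_map_of_injective _ _ hinj] at h1
  rw [← h1, mul_comm] at h2
  exact mul_left_cancel₀ (relIndex_order_ne_zero hx) h2

/-- By Euler's formula the coordinates of `Z'(x) m` are the traces of `β j m`. These products lie in
the radical, so every coordinate is divisible by `p`. -/
theorem exists_eq_smul_of_derivative_mul (hx : aeval x Z = 0) (hZ : Z.Monic) (hr : Z.natDegree = r)
    (hxint : IsIntegral ℤ_[p] x) [(order p x).IsLattice ℚ_[p]]
    (bE : Module.Basis (Fin r) ℚ_[p] (∀ i, K i)) (hb : ∀ k, bE k = x ^ (k : ℕ))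
    (hu : IsUnit (aeval x (derivative Z))) {m : ∀ i, K i} (hm : m ∈ maxPow p K 1) :
    ∃ e ∈ order p x, aeval x (derivative Z) * m = (p : ℤ_[p]) • e := by
  choose c hc using fun j => exists_trace_eq hxint (mul_mem_maxPow
    (adjoin_le_integralClosure hxint (quotCoeff_mem_adjoin hx j)) hm)
  refine ⟨∑ j : Fin r, c j • x ^ (j : ℕ), Submodule.sum_mem _ fun j _ => Submodule.smul_mem _ _
    ((Algebra.adjoin ℤ_[p] {x}).pow_mem (Algebra.self_mem_adjoin_singleton _ x) j), ?_⟩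
  rw [← bE.sum_repr (aeval x (derivative Z) * m), Finset.smul_sum]
  refine Finset.sum_congr rfl fun j _ => ?_
  rw [repr_derivative_mul hx hZ hr bE hb hu, hc, hb, IsScalarTower.algebraMap_smul, mul_smul]

theorem exists_mul_eq_pow_smul {u β : ∀ i, K i} (hβ : β ∈ order p x) {D : ℤ_[p]} (hD0 : D ≠ 0)
    (hD : u * β = algebraMap ℤ_[p] _ D) :
    ∃ c : ℕ, ∀ e ∈ order p x, ∃ e' ∈ order p x, u * e' = (p : ℤ_[p]) ^ c • e := by
  refine ⟨D.valuation, fun e he => ⟨((PadicInt.unitCoeff hD0)⁻¹ : ℤ_[p]ˣ) • (β * e), ?_, ?_⟩⟩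
  · exact (order p x).smul_mem _ ((Algebra.adjoin ℤ_[p] {x}).mul_mem hβ he)
  · rw [mul_smul_comm, ← mul_assoc, hD, ← Algebra.smul_def, Units.smul_def, smul_smul]
    congr 1
    rw [Units.inv_mul_eq_iff_eq_mul]
    exact PadicInt.unitCoeff_spec hD0

/-- The composite `p ^ b u p ^ a` maps `M` to `L`, then `L` to `L`, then `L` to `M`. -/
theorem exists_smul_stab_eq {L M : Submodule ℤ_[p] (∀ i, K i)} {a b N : ℕ}
    (ha : ∀ m ∈ M, (p : ℤ_[p]) ^ a • m ∈ L) (hb : ∀ m ∈ L, (p : ℤ_[p]) ^ b • m ∈ M)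
    (hN : a + b ≤ N) {u : Module.End ℚ_[p] (∀ i, K i)} (hu : u ∈ stab L) :
    (p : ℤ_[p]) ^ N • u ∈ stab M := by
  intro m hm
  obtain ⟨k, rfl⟩ := Nat.exists_eq_add_of_le hN
  have h : ((p : ℤ_[p]) ^ (a + b + k) • u) m =
      (p : ℤ_[p]) ^ k • (p : ℤ_[p]) ^ b • u ((p : ℤ_[p]) ^ a • m) := by
    have h1 := map_smul (u.restrictScalars ℤ_[p]) ((p : ℤ_[p]) ^ a) m
    simp only [LinearMap.restrictScalars_apply] at h1
    rw [h1, LinearMap.smul_apply, smul_smul, smul_smul]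
    congr 1
    ring
  rw [h]
  exact M.smul_mem _ (hb _ (hu _ (ha m hm)))

theorem pow_smul_mem_maxPow {n : ι → ℕ} {N : ℕ} (hN : ∀ i, n i ≤ N) {z : ∀ i, K i}
    (hz : IsIntegral ℤ_[p] z) : (p : ℤ_[p]) ^ N • z ∈ maxPow p K n := by
  rw [mem_maxPow_iff_val]
  intro i
  rw [Pi.smul_apply, Algebra.smul_def, map_pow, map_natCast, val_mul, val_pow, val_natCast_self]
  refine le_trans ?_ (le_add_of_nonneg_right ((val_nonneg_iff _).2 (isIntegral_pi_iff.1 hz i)))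
  have he : (1 : ℝ) ≤ ramIndex p (K i) := by exact_mod_cast (maximalIdeal_pow_ramIndex p (K i)).1
  have h1 : ((n i : ℝ) / ramIndex p (K i)) ≤ N :=
    (div_le_self (Nat.cast_nonneg _) he).trans (by exact_mod_cast hN i)
  calc (((n i : ℝ) / ramIndex p (K i) : ℝ) : WithTop ℝ) ≤ ((N : ℝ) : WithTop ℝ) := by exact_mod_cast h1
    _ = N • (1 : WithTop ℝ) := by
      rw [← WithTop.coe_one, ← WithTop.coe_nsmul, nsmul_eq_mul, mul_one]

/-- Adding the valuations turns the condition on `f` into `Z'(x) (f(x) - x) ∈ ∏ 𝔪_i ^ n_i`.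
Conversely `L ⊆ R` makes `y` the value of some polynomial, and reduction modulo the monic `Z` meets
the degree bound. -/
theorem exists_mem_polyF_iff (hx : aeval x Z = 0) (hZ : Z.Monic) (hr : Z.natDegree = r)
    (hZp : Z.map (algebraMap ℤ_[p] ℚ_[p]) = polyZ p x) {n : ι → ℕ} {s : ι → ℝ}
    (hs : ∀ i, s i = n i / ramIndex p (K i))
    (hL : ∀ z, aeval x (derivative Z) * z ∈ maxPow p K n → z ∈ order p x) (y : ∀ i, K i) :
    (∃ f ∈ polyF (p := p) r x s, aeval x f = y) ↔
      y - x ∈ (maxPow p K n).comap (AddMonoidHom.mulLeft (aeval x (derivative Z))) := by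
  have hcond : ∀ f : ℤ_[p][X], (∀ i, ((s i : ℝ) : WithTop ℝ) ≤
      val (p := p) (aeval (x i) f - x i) + val (p := p) (aeval (x i) (derivative (polyZ p x)))) ↔
      aeval x (derivative Z) * (aeval x f - x) ∈ maxPow p K n := fun f => by
    rw [mem_maxPow_iff_val]
    refine forall_congr' fun i => ?_
    rw [Pi.mul_apply, val_mul, Pi.sub_apply, aeval_pi_apply, aeval_pi_apply, hs i, add_comm,
      ← hZp, derivative_map, aeval_map_algebraMap]
  constructor
  · rintro ⟨f, hf, rfl⟩
    exact (hcond f).1 hf.2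
  · intro h
    have h1 : y ∈ order p x := by
      rw [← sub_add_cancel y x]
      exact add_mem (hL _ h) (Algebra.self_mem_adjoin_singleton _ x)
    obtain ⟨f, rfl⟩ : ∃ f : ℤ_[p][X], aeval x f = y := by
      have : y ∈ Algebra.adjoin ℤ_[p] {x} := h1
      rwa [Algebra.adjoin_singleton_eq_range_aeval] at this
    have h2 : aeval x (f %ₘ Z) = aeval x f := aeval_modByMonic_eq_self_of_root hx
    refine ⟨f %ₘ Z, ⟨?_, (hcond _).2 (by rw [h2]; exact h)⟩, h2⟩
    rw [← hr, ← degree_eq_natDegree hZ.ne_zero]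
    exact degree_modByMonic_lt f hZ

theorem card_residueField_eq_rpow (L : Type*) [Field L] [Algebra ℚ_[p] L] [FiniteDimensional ℚ_[p] L]
    [Algebra ℤ_[p] L] [IsScalarTower ℤ_[p] ℚ_[p] L] :
    (Nat.card (IsLocalRing.ResidueField (integralClosure ℤ_[p] L)) : ℝ) =
      (p : ℝ) ^ ((Module.finrank ℚ_[p] L : ℝ) / ramIndex p L) := by
  have he := (maximalIdeal_pow_ramIndex p L).1.ne'
  have h : (Nat.card (IsLocalRing.ResidueField (integralClosure ℤ_[p] L)) : ℝ) ^ ramIndex p L =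
      (p : ℝ) ^ Module.finrank ℚ_[p] L := by exact_mod_cast card_residueField_pow p L
  rw [div_eq_mul_inv, Real.rpow_mul (Nat.cast_nonneg _), Real.rpow_natCast, ← h,
    Real.pow_rpow_inv_natCast (Nat.cast_nonneg _) he]

end Final

/-! ### The indices entering the final computation -/

section Assembly

open Polynomial

variable {p : ℕ} [Fact p.Prime] {ι : Type*} [Fintype ι] {K : ι → Type*} [∀ i, Field (K i)]
  [∀ i, Algebra ℚ_[p] (K i)] [∀ i, FiniteDimensional ℚ_[p] (K i)]
  [∀ i, Algebra ℤ_[p] (K i)] [∀ i, IsScalarTower ℤ_[p] ℚ_[p] (K i)] {x : ∀ i, K i}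

/-- Multiplication by `u` maps `L` onto `∏ 𝔪_i ^ n_i`, so `[𝒪 : L] = [u 𝒪 : ∏ 𝔪_i ^ n_i]`; the other
factor is `[𝒪 : u 𝒪]`. -/
theorem relIndex_ball_mul {u : ∀ i, K i} (hx : IsIntegral ℤ_[p] x) [(order p x).IsLattice ℚ_[p]]
    (hu : u ∈ order p x) (hu' : IsUnit u) {n : ι → ℕ}
    (hL : (maxPow p K n).comap (AddMonoidHom.mulLeft u) ≤ maxPow p K 0) :
    ((maxPow p K n).comap (AddMonoidHom.mulLeft u)).relIndex (maxPow p K 0) *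
      ((order p x).toAddSubgroup.map (AddMonoidHom.mulLeft u)).relIndex (order p x).toAddSubgroup =
      ∏ i, Nat.card (IsLocalRing.ResidueField (integralClosure ℤ_[p] (K i))) ^ n i := by
  have hinj : Function.Injective (AddMonoidHom.mulLeft u) := fun _ _ h => hu'.mul_left_cancel h
  have hsurj : Function.Surjective (AddMonoidHom.mulLeft u) := fun a => by
    obtain ⟨v, rfl⟩ := hu'
    exact ⟨((v⁻¹ : (∀ i, K i)ˣ) : ∀ i, K i) * a, by
      rw [AddMonoidHom.coe_mulLeft, ← mul_assoc, Units.mul_inv, one_mul]⟩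
  have h1 := AddSubgroup.map_comap_eq_self_of_surjective hsurj (maxPow p K n)
  rw [relIndex_map_mulLeft hx hu hu', ← AddSubgroup.relIndex_map_map_of_injective _ _ hinj, h1,
    ← relIndex_maxPow n]
  refine AddSubgroup.relIndex_mul_relIndex _ _ _ ?_ ?_
  · rw [← h1]
    exact AddSubgroup.map_mono hL
  · rintro _ ⟨a, ha, rfl⟩
    exact mul_mem_maxPow (order_le_integers hx hu) ha

theorem relIndex_pow_ne_zero (hx : IsIntegral ℤ_[p] x) [hl : (order p x).IsLattice ℚ_[p]] (N : ℕ) :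
    ((order p x).toAddSubgroup.map (DistribSMul.toAddMonoidHom _ ((p : ℤ_[p]) ^ N))).relIndex
      (maxPow p K 0) ≠ 0 := by
  rw [← AddSubgroup.relIndex_mul_relIndex _ (order p x).toAddSubgroup _ ?_
    (order_le_maxPow_zero hx)]
  · exact mul_ne_zero (relIndex_smul_ne_zero _ hl.fg N) (relIndex_order_ne_zero hx)
  · rintro _ ⟨e, he, rfl⟩
    exact (order p x).smul_mem _ he

end Assembly
end PadicOrbit

theorem mainTheorem4 (p : ℕ) [Fact p.Prime] {ι : Type*} [Fintype ι] (K : ι → Type*)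
    [∀ i, Field (K i)] [∀ i, Algebra ℚ_[p] (K i)] [∀ i, FiniteDimensional ℚ_[p] (K i)]
    [∀ i, Algebra ℤ_[p] (K i)] [∀ i, IsScalarTower ℤ_[p] ℚ_[p] (K i)]
    (r : ℕ) (hr : r = ∑ i, Module.finrank ℚ_[p] (K i))
    (x : ∀ i, K i) (hxint : x ∈ integralClosure ℤ_[p] (∀ i, K i))
    (hxnew : Algebra.adjoin ℚ_[p] {x} = ⊤)
    (s : ι → ℝ) (hs : ∀ i, ∃ n : ℕ, s i = n / PadicOrbit.ramIndex p (K i))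
    (hsdisc : ∀ i, r • PadicOrbit.val (p := p) (PadicOrbit.polyZ p x).discr <
      ((s i : ℝ) : WithTop ℝ))
    (C : PadicOrbit.LatticeClass p x)
    (M : PadicOrbit.latticeModules (p := p) x) (hM : PadicOrbit.latticeClass M = C)
    (b : Module.Basis (Fin r) ℤ_[p] (M : Submodule ℤ_[p] (∀ i, K i)))
    [MeasurableSpace (Matrix (Fin r) (Fin r) ℤ_[p])] [BorelSpace (Matrix (Fin r) (Fin r) ℤ_[p])]
    (P : MeasureTheory.Measure (Matrix (Fin r) (Fin r) ℤ_[p]))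
    [P.IsAddHaarMeasure] [MeasureTheory.IsProbabilityMeasure P] :
    PadicOrbit.autClass hxnew C ≤ PadicOrbit.integerUnits p (∀ i, K i) ∧
    (PadicOrbit.autClass hxnew C).relIndex (PadicOrbit.integerUnits p (∀ i, K i)) ≠ 0 ∧
    MeasurableSet (PadicOrbit.conjOrbit (PadicOrbit.actionMatrix M b)
      (PadicOrbit.polyF (p := p) r x s)) ∧
    P.real (PadicOrbit.conjOrbit (PadicOrbit.actionMatrix M b)
      (PadicOrbit.polyF (p := p) r x s)) =
      (∏ j ∈ Finset.Icc 1 r, (1 - ((p : ℝ) ^ j)⁻¹)) /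
        (∏ i, (1 - (p : ℝ) ^ (-((Module.finrank ℚ_[p] (K i) : ℝ) / PadicOrbit.ramIndex p (K i)))) *
          (p : ℝ) ^ (s i * Module.finrank ℚ_[p] (K i))) *
        (PadicOrbit.autClass hxnew C).relIndex (PadicOrbit.integerUnits p (∀ i, K i)) := by
  open PadicOrbit Polynomial in
  subst hM
  change autLattice x (M : Submodule ℤ_[p] (∀ i, K i)) ≤ _ ∧
    (autLattice x (M : Submodule ℤ_[p] (∀ i, K i))).relIndex _ ≠ 0 ∧ _ ∧ _ = _ *
      ((autLattice x (M : Submodule ℤ_[p] (∀ i, K i))).relIndex _ : ℝ)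
  obtain ⟨Z, hZ, hZp, hx⟩ := exists_monic_map_eq_polyZ hxint
  have hZr : Z.natDegree = r := by
    rw [← hZ.natDegree_map (algebraMap ℤ_[p] ℚ_[p]), hZp, natDegree_polyZ hxnew, hr]
  obtain ⟨bE, hbE⟩ := exists_basis_pow hxnew (hZ.map (algebraMap ℤ_[p] ℚ_[p]))
    (by rw [aeval_map_algebraMap, hx]) ((hZ.natDegree_map _).trans hZr)
    ((Module.finrank_pi_fintype ℚ_[p]).trans hr.symm)
  have hRl : (order p x).IsLattice ℚ_[p] := order_isLattice hx hZ hZr bE hbE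
  have hMl : (M : Submodule ℤ_[p] (∀ i, K i)).IsLattice ℚ_[p] := M.2.2
  obtain ⟨D, hD0, ⟨β, hβ, hD⟩, hbound⟩ := exists_discriminant_bound hx hZ hZp hZr hxint hr hsdisc
  choose n hn using hs
  set u := aeval x (derivative Z) with hu
  have huR : u ∈ order p x := by
    change u ∈ Algebra.adjoin ℤ_[p] {x}
    rw [Algebra.adjoin_singleton_eq_range_aeval]
    exact ⟨_, rfl⟩
  have huU : IsUnit u := by
    refine isUnit_of_mul_isUnit_left (y := β) ?_
    rw [hD, IsScalarTower.algebraMap_apply ℤ_[p] ℚ_[p]]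
    refine (IsUnit.mk0 _ ?_).map _
    rwa [Ne, FaithfulSMul.algebraMap_eq_zero_iff]
  set L := (maxPow p K n).comap (AddMonoidHom.mulLeft u) with hLdef
  have hLm : ∀ z ∈ L, ∃ m ∈ maxPow p K 1, z = D • m := fun z hz => hbound z fun i => by
    have h1 := mem_maxPow_iff_val.1 (show u * z ∈ maxPow p K n from hz) i
    rwa [Pi.mul_apply, val_mul, ← hn, add_comm] at h1
  -- Here `D m = u (β m)`, and `β m` is again in the radical, so Euler's formula gives divisibility
  -- by `p` in `R`.
  have hLp : ∀ z ∈ L, ∃ z' ∈ order p x, z = (p : ℤ_[p]) • z' := fun z hz => by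
    obtain ⟨m, hm, rfl⟩ := hLm z hz
    obtain ⟨e, he, h⟩ := exists_eq_smul_of_derivative_mul hx hZ hZr hxint bE hbE huU
      (mul_mem_maxPow (order_le_integers hxint hβ) hm)
    exact ⟨e, he, by rw [← h, ← mul_assoc, ← hu, hD, Algebra.smul_def]⟩
  have hLR : ∀ z ∈ L, z ∈ order p x := fun z hz => by
    obtain ⟨e, he, rfl⟩ := hLp z hz
    exact (order p x).smul_mem _ he
  obtain ⟨c, hc⟩ := exists_mul_eq_pow_smul hβ hD0 hD
  obtain ⟨k, hk⟩ := exists_pow_smul_le hRl.span_eq_top hMl.fg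
  obtain ⟨l, hl⟩ := exists_pow_smul_le hMl.span_eq_top hRl.fg
  -- `N` exceeds `c` for the tubes; `k + l + 1` puts `p ^ N End(R)` inside `p End(M)`; and the sum
  -- of the `n i` gives `p ^ N R ⊆ L`.
  set N := c + k + l + 1 + ∑ i, n i with hNdef
  have hnN : ∀ i, n i ≤ N := fun i =>
    (Finset.single_le_sum (fun _ _ => Nat.zero_le _) (Finset.mem_univ i)).trans (Nat.le_add_left _ _)
  have hNL : ∀ z ∈ order p x, (p : ℤ_[p]) ^ N • z ∈ L := fun z hz => by
    change u * (p : ℤ_[p]) ^ N • z ∈ maxPow p K n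
    exact mul_mem_maxPow (order_le_integers hxint huR)
      (pow_smul_mem_maxPow hnN (order_le_integers hxint hz))
  obtain ⟨hmeas, hP⟩ := measure_conjOrbit hxnew hx hZ hZr bE hbE hc (N := N) (m := l + k)
    (by omega) M b
    (fun w hw => ⟨(p : ℤ_[p]) ^ (N - 1) • w, exists_smul_stab_eq hk hl (by omega) hw, by
      rw [smul_smul, ← pow_succ', Nat.sub_add_cancel (by omega)]⟩)
    (fun v hv => exists_smul_stab_eq hl hk le_rfl hv) L hLp hNL
    (fun g z hz z' hz' h => eq_of_conj hxnew hxint hx hRl.fg hD0 (order_le_integers hxint hβ) hD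
      (hLm z hz) (hLm z' hz') (hLp z hz) g h)
    (polyF (p := p) r x s) (exists_mem_polyF_iff hx hZ hZr hZp hn hLR) P
  rw [← hu] at hP
  have hA := autLattice_le_integerUnits (M := (M : Submodule ℤ_[p] (∀ i, K i))) hxnew
  have hΓ := relIndex_mul_relIndex_of_inf_le (onePlus_inf_integerUnits_le (N := N) M.2.1) hA
  rw [relIndex_onePlus_integerUnits hxint (show 0 < N by omega)] at hΓ
  set W := (order p x).toAddSubgroup.map (DistribSMul.toAddMonoidHom _ ((p : ℤ_[p]) ^ N)) with hW
  have hLO : L ≤ maxPow p K 0 := fun z hz => order_le_maxPow_zero hxint (hLR z hz)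
  have hWL : W ≤ L := by
    rintro _ ⟨e, he, rfl⟩
    exact hNL e he
  have hζ := relIndex_ball_mul hxint huR huU hLO
  have hβ1 := AddSubgroup.relIndex_mul_relIndex W L _ hWL hLO
  have hβ2 := AddSubgroup.relIndex_mul_relIndex W _ _
    (smul_pow_mem_maxPow_one hxint (show 0 < N by omega)) (maxPow_le_zero (p := p) (K := K) 1)
  have hW0 : W.relIndex (maxPow p K 0) ≠ 0 := relIndex_pow_ne_zero hxint N
  rw [relIndex_maxPow] at hβ2
  simp only [Pi.one_apply, pow_one] at hβ2
  have hq1 : ∀ i, 1 < Nat.card (IsLocalRing.ResidueField (integralClosure ℤ_[p] (K i))) := fun i => by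
    have := Nat.finite_of_card_ne_zero (card_residueField_pos p (K i)).ne'
    exact Finite.one_lt_card
  have hγ0 : W.relIndex (maxPow p K 1) ≠ 0 := left_ne_zero_of_mul (hβ2 ▸ hW0)
  have hT0 : ∏ i, (Nat.card (IsLocalRing.ResidueField (integralClosure ℤ_[p] (K i))) - 1) ≠ 0 :=
    Finset.prod_ne_zero_iff.2 fun i _ => (Nat.sub_pos_of_lt (hq1 i)).ne'
  refine ⟨hA, right_ne_zero_of_mul (hΓ ▸ mul_ne_zero hT0 hγ0), hmeas, ?_⟩
  -- Factor by factor this is `(1 - q⁻¹) q ^ n * q = (q - 1) q ^ n` with `q = p ^ (r_i / e_i)` and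
  -- `q ^ n_i = p ^ (s_i r_i)`.
  have hden : (∏ i, (1 - (p : ℝ) ^ (-((Module.finrank ℚ_[p] (K i) : ℝ) / ramIndex p (K i)))) *
      (p : ℝ) ^ (s i * Module.finrank ℚ_[p] (K i))) *
      (∏ i, Nat.card (IsLocalRing.ResidueField (integralClosure ℤ_[p] (K i))) : ℕ) =
      (∏ i, (Nat.card (IsLocalRing.ResidueField (integralClosure ℤ_[p] (K i))) - 1) : ℕ) *
      (∏ i, Nat.card (IsLocalRing.ResidueField (integralClosure ℤ_[p] (K i))) ^ n i : ℕ) := by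
    rw [Nat.cast_prod, Nat.cast_prod, Nat.cast_prod, ← Finset.prod_mul_distrib,
      ← Finset.prod_mul_distrib]
    refine Finset.prod_congr rfl fun i _ => ?_
    have hp : (0 : ℝ) ≤ p := Nat.cast_nonneg _
    have h1 : s i * Module.finrank ℚ_[p] (K i) =
        (Module.finrank ℚ_[p] (K i) : ℝ) / ramIndex p (K i) * n i := by rw [hn i]; ring
    rw [h1, Real.rpow_neg hp, Real.rpow_mul hp, Real.rpow_natCast, ← card_residueField_eq_rpow,
      Nat.cast_sub (hq1 i).le, Nat.cast_one, Nat.cast_pow]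
    have h2 : (Nat.card (IsLocalRing.ResidueField (integralClosure ℤ_[p] (K i))) : ℝ) ≠ 0 := by
      exact_mod_cast (card_residueField_pos p (K i)).ne'
    field_simp
  have hS0 : ∏ i, Nat.card (IsLocalRing.ResidueField (integralClosure ℤ_[p] (K i))) ^ n i ≠ 0 :=
    Finset.prod_ne_zero_iff.2 fun i _ => pow_ne_zero _ (card_residueField_pos p (K i)).ne'
  have hQ0 : ∏ i, Nat.card (IsLocalRing.ResidueField (integralClosure ℤ_[p] (K i))) ≠ 0 :=
    Finset.prod_ne_zero_iff.2 fun i _ => (card_residueField_pos p (K i)).ne'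
  have hβ3 := hβ1.trans hβ2.symm
  generalize (∏ i, Nat.card (IsLocalRing.ResidueField (integralClosure ℤ_[p] (K i))) ^ n i) = S at *
  generalize (∏ i, Nat.card (IsLocalRing.ResidueField (integralClosure ℤ_[p] (K i)))) = Q at *
  generalize (∏ i, (Nat.card (IsLocalRing.ResidueField (integralClosure ℤ_[p] (K i))) - 1)) = T at *
  generalize (∏ i, (1 - (p : ℝ) ^ (-((Module.finrank ℚ_[p] (K i) : ℝ) / ramIndex p (K i)))) *
      (p : ℝ) ^ (s i * Module.finrank ℚ_[p] (K i))) = d at *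
  generalize W.relIndex (maxPow p K 1) = γ at *
  generalize W.relIndex L = w at *
  generalize L.relIndex (maxPow p K 0) = ℓ at *
  generalize (onePlus (powStab p x N) powStab_mul_mem).relIndex
    (autLattice x (M : Submodule ℤ_[p] (∀ i, K i))) = a at *
  generalize (autLattice x (M : Submodule ℤ_[p] (∀ i, K i))).relIndex
    (integerUnits p (∀ i, K i)) = t at *
  generalize P.real (conjOrbit (actionMatrix M b) (polyF (p := p) r x s)) = R at *
  generalize (∏ j ∈ Finset.Icc 1 r, (1 - ((p : ℝ) ^ j)⁻¹)) = V at *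
  rify at hΓ hζ hβ3 hγ0 hT0 hS0 hQ0
  have hd0 : d ≠ 0 := left_ne_zero_of_mul (hden ▸ mul_ne_zero hT0 hS0)
  rw [div_mul_eq_mul_div, eq_div_iff hd0]
  refine mul_right_cancel₀ (mul_ne_zero hQ0 hγ0) ?_
  -- With `ρ = [R : u R]`, the chain for the probability `R` is `R d Q γ = R T S γ = R S a t = R a t
  -- ℓ ρ = V w ℓ t = V t γ Q`.
  linear_combination R * γ * hden - R * S * hΓ - R * a * t * hζ + ℓ * t * hP + V * t * hβ3
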